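/- Let $\sigma$ be a finite non-empty relational signature with all arities positive, let $|\sigma|$ be its number of relation symbols and $k$ the maximum arity. A $\sigma$-structure $\mathcal A$ has a finite non-empty universe $V(\mathcal A)$ and relations $R^{\mathcal A}\subseteq V(\mathcal A)^{\operatorname{ar}(R)}$ ($R\in\sigma$), such that every element of $V(\mathcal A)$ occurs in some tuple of some relation. Let $\mathbf A=\bigcup_{R\in\sigma}R^{\mathcal A}$ and $\|\mathcal A\|=|\mathbf A|$. For tuples $\mathbf a,\mathbf b$ let $\mathsf{stp}(\mathbf a,\mathbf b)=\{(i,j): a_i=b_j\}$ and $\mathsf{atp}(\mathbf a)=\{R\in\sigma: \mathbf a\in R^{\mathcal A}\}$. Relational Color Refinement (RCR) colors the tuples $\mathbf a\in\mathbf A$ by $\varrho_0(\mathbf a)=(\mathsf{atp}(\mathbf a),\mathsf{stp}(\mathbf a,\mathbf a))$ and $$\varrho_{i+1}(\mathbf a)=\bigl(\varrho_i(\mathbf a),\ \{\!\!\{(\mathsf{stp}(\mathbf a,\mathbf b),\varrho_i(\mathbf b)) : \mathbf b\in\mathbf A,\ \mathsf{stp}(\mathbf a,\mathbf b)\neq\emptyset\}\!\!\}\bigr);$$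 its stable coloring is $\varrho_\infty=\varrho_{i_{\mathcal A}}$, where $i_{\mathcal A}$ is the least $i$ such that $\varrho_i(\mathbf a)=\varrho_i(\mathbf b)\iff\varrho_{i+1}(\mathbf a)=\varrho_{i+1}(\mathbf b)$ for all $\mathbf a,\mathbf b\in\mathbf A$. Present $\mathcal A$ to a unit-cost random access machine (with addition, truncated subtraction, comparisons and indirect addressing) by numbering its universe $0,\dots,n-1$, in any way, and by writing down $n$ followed, for each $R\in\sigma$ in turn, by $|R^{\mathcal A}|$ and the entries of the tuples of $R^{\mathcal A}$, in any order; let $L(\mathcal A)=1+|\sigma|+\sum_{R\in\sigma}\operatorname{ar}(R)\,|R^{\mathcal A}|$ be the length of this input. **Theorem.** RCR can be implemented in time $O(\|\mathcal A\|\cdot\log\|\mathcal A\|)$ for each fixed signature, where, apart from a linear-time reading of the input, the hidden factor is $2^{O(k\log k)}$. That is, there is an absolute constant $c$ such that for every signature $\sigma$ there are a program $P$ and constants $C,D$ with the following property. On every presentation of every $\sigma$-structure $\mathcal A$, the program $P$ halts after some number $t$ of steps, at no time stores a number greater than $(\|\mathcal A\|+2)^D$, and outputs for every listed tuple a color (a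 number), such that two listed tuples $\mathbf a,\mathbf b$ get the same color if and only if $\varrho_\infty(\mathbf a)=\varrho_\infty(\mathbf b)$; moreover $$t\le C\cdot\|\mathcal A\|\cdot\log_2(\|\mathcal A\|+1)\quad\text{and}\quad t\le c\cdot L(\mathcal A)+2^{\,c\,k\log_2(k+1)}\cdot\|\mathcal A\|\cdot\log_2(\|\mathcal A\|+1).$$ -/

import Mathlib

namespace RCR

/-! ### Signatures, structures, tuples -/

/-- A finite, non-empty relational signature, with its symbols enumerated as `0, …, card - 1`.
Every symbol has a positive arity. -/
structure Signature where
  card : ℕ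
  card_pos : 0 < card
  arity : Fin card → ℕ
  arity_pos : ∀ R, 0 < arity R

/-- The maximum arity of a relation symbol. -/
def Signature.maxArity (σ : Signature) : ℕ := Finset.univ.sup σ.arity

/-- A `σ`-structure with universe `V`: the universe is non-empty and every element of it occurs as
an entry of some tuple of some relation (so, the relations being finite, `V` is finite). -/
structure Structure (σ : Signature) (V : Type) where
  rel : (R : Fin σ.card) → Finset (Fin (σ.arity R) → V)
  nonempty : Nonempty V
  covers : ∀ v : V, ∃ R, ∃ a ∈ rel R, ∃ i, a i = v

/-- Tuples over `V` of arbitrary arity. -/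
abbrev Tup (V : Type) : Type := Σ k : ℕ, (Fin k → V)

/-- The similarity type of two tuples: the set of all pairs of positions at which they agree. -/
def stp {V : Type} (a b : Tup V) : Set (ℕ × ℕ) :=
  {p | ∃ (i : Fin a.1) (j : Fin b.1), p = (↑i, ↑j) ∧ a.2 i = b.2 j}

section

variable {σ : Signature} {V : Type}

open Classical in
/-- The set of all tuples that belong to some relation (a tuple belonging to several relations
occurs in it only once). -/
noncomputable def Structure.tuples (A : Structure σ V) : Finset (Tup V) :=
  Finset.univ.biUnion fun R => (A.rel R).image fun a => (⟨σ.arity R, a⟩ : Tup V)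

/-- The size `‖A‖` of a structure: the number of its tuples. -/
noncomputable def Structure.size (A : Structure σ V) : ℕ := A.tuples.card

/-- The atomic type of a tuple: the set of relations it belongs to. -/
def Structure.atp (A : Structure σ V) (a : Tup V) : Set (Fin σ.card) :=
  {R | ∃ b ∈ A.rel R, a = ⟨σ.arity R, b⟩}

/-! ### Relational Color Refinement -/

/-- The colors that are used in round `i`. -/
def Color (σ : Signature) : ℕ → Type
  | 0 => Set (Fin σ.card) × Set (ℕ × ℕ)
  | i + 1 => Color σ i × Multiset (Set (ℕ × ℕ) × Color σ i)

open Classical in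
/-- The color that a tuple has after `i` rounds. -/
noncomputable def Structure.color (A : Structure σ V) : (i : ℕ) → Tup V → Color σ i
  | 0, a => (A.atp a, stp a a)
  | i + 1, a =>
    (A.color i a,
      (A.tuples.filter fun b => (stp a b).Nonempty).val.map fun b => (stp a b, A.color i b))

/-- The coloring after `i` rounds is stable: the next round splits no color class. -/
def Structure.IsStable (A : Structure σ V) (i : ℕ) : Prop :=
  ∀ a ∈ A.tuples, ∀ b ∈ A.tuples,
    A.color i a = A.color i b ↔ A.color (i + 1) a = A.color (i + 1) b

theorem Structure.color_succ_inj (A : Structure σ V) {i : ℕ} {a b : Tup V}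
    (h : A.color (i + 1) a = A.color (i + 1) b) : A.color i a = A.color i b :=
  congrArg Prod.fst h

open Classical in
theorem Structure.exists_isStable (A : Structure σ V) : ∃ i, A.IsStable i := by
  let S : ℕ → Finset (Tup V × Tup V) := fun i =>
    (A.tuples ×ˢ A.tuples).filter fun p => A.color i p.1 = A.color i p.2
  have hS : ∀ i, S (i + 1) ⊆ S i := by
    intro i p hp
    simp only [S, Finset.mem_filter] at hp ⊢
    exact ⟨hp.1, A.color_succ_inj hp.2⟩
  by_contra hno
  push Not at hno
  have hlt : ∀ i, (S (i + 1)).card < (S i).card := by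
    intro i
    refine Finset.card_lt_card ((hS i).ssubset_of_ne fun heq => hno i ?_)
    intro a ha b hb
    refine ⟨fun h => ?_, A.color_succ_inj⟩
    have hm : (a, b) ∈ S i := by
      simp only [S, Finset.mem_filter, Finset.mem_product]
      exact ⟨⟨ha, hb⟩, h⟩
    rw [← heq] at hm
    exact (Finset.mem_filter.mp hm).2
  have hbound : ∀ i, (S i).card + i ≤ (S 0).card := by
    intro i
    induction i with
    | zero => simp
    | succ i ih => have := hlt i; omega
  have := hbound ((S 0).card + 1)
  omega

open Classical in
/-- The smallest number of rounds after which the coloring is stable. -/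
noncomputable def Structure.stableRound (A : Structure σ V) : ℕ := Nat.find A.exists_isStable

/-- The stable color of a tuple. -/
noncomputable def Structure.stableColor (A : Structure σ V) (a : Tup V) :
    Color σ A.stableRound :=
  A.color A.stableRound a

end

/-! ### Random access machines

A machine has registers and a memory, all of whose cells hold natural numbers. A program is built
from single register and memory instructions by sequencing, branching and looping; every
instruction and every evaluation of a test takes one step. -/

/-- A configuration: the contents of the registers and of the memory cells. -/
structure State where
  reg : ℕ → ℕ
  mem : ℕ → ℕ

/-- All registers and memory cells hold numbers of size at most `B`. -/
def State.Bounded (B : ℕ) (s : State) : Prop := (∀ r, s.reg r ≤ B) ∧ ∀ x, s.mem x ≤ B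

/-- Instructions; `d`, `a`, `b` are registers. -/
inductive Instr where
  | const (d n : ℕ)
  | copy (d a : ℕ)
  | add (d a b : ℕ)
  | sub (d a b : ℕ)
  | load (d a : ℕ)
  | store (a b : ℕ)

/-- The effect of an instruction: `load d a` reads the memory cell whose address is in register
`a`, and `store a b` writes to it; `sub` is truncated subtraction. -/
def Instr.apply (s : State) : Instr → State
  | .const d n => { s with reg := Function.update s.reg d n }
  | .copy d a => { s with reg := Function.update s.reg d (s.reg a) }
  | .add d a b => { s with reg := Function.update s.reg d (s.reg a + s.reg b) }
  | .sub d a b => { s with reg := Function.update s.reg d (s.reg a - s.reg b) }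
  | .load d a => { s with reg := Function.update s.reg d (s.mem (s.reg a)) }
  | .store a b => { s with mem := Function.update s.mem (s.reg a) (s.reg b) }

/-- Comparisons of two registers. -/
inductive Test where
  | eq (a b : ℕ)
  | ne (a b : ℕ)
  | lt (a b : ℕ)
  | le (a b : ℕ)

def Test.Holds (s : State) : Test → Prop
  | .eq a b => s.reg a = s.reg b
  | .ne a b => s.reg a ≠ s.reg b
  | .lt a b => s.reg a < s.reg b
  | .le a b => s.reg a ≤ s.reg b

inductive Program where
  | skip
  | instr (i : Instr)
  | seq (p q : Program)
  | ite (c : Test) (p q : Program)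
  | loop (c : Test) (p : Program)

/-- `Exec B p s s' t`: started in `s`, the program `p` halts in `s'` after exactly `t` steps, and
each instruction on the way leaves only numbers of size at most `B` in the machine. -/
inductive Exec (B : ℕ) : Program → State → State → ℕ → Prop
  | skip (s : State) : Exec B .skip s s 0
  | instr (i : Instr) (s : State) (h : (i.apply s).Bounded B) :
      Exec B (.instr i) s (i.apply s) 1
  | seq {p q : Program} {s s' s'' : State} {t t' : ℕ} :
      Exec B p s s' t → Exec B q s' s'' t' → Exec B (.seq p q) s s'' (t + t')
  | ite_true {c : Test} {p q : Program} {s s' : State} {t : ℕ} :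
      c.Holds s → Exec B p s s' t → Exec B (.ite c p q) s s' (t + 1)
  | ite_false {c : Test} {p q : Program} {s s' : State} {t : ℕ} :
      ¬ c.Holds s → Exec B q s s' t → Exec B (.ite c p q) s s' (t + 1)
  | loop_true {c : Test} {p : Program} {s s' s'' : State} {t t' : ℕ} :
      c.Holds s → Exec B p s s' t → Exec B (.loop c p) s' s'' t' →
      Exec B (.loop c p) s s'' (t + t' + 1)
  | loop_false {c : Test} {p : Program} {s : State} :
      ¬ c.Holds s → Exec B (.loop c p) s s 1

/-- The initial configuration: the input word is in the first memory cells, everything else is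
zero. -/
def State.init (w : List ℕ) : State where
  reg := fun _ => 0
  mem := fun x => w.getD x 0

/-! ### Encoding of structures -/

/-- A presentation of a structure: a numbering of its universe by `0, …, n - 1`, and, for each
relation, a listing of its tuples without repetition, in an arbitrary order. -/
structure Presentation {σ : Signature} {V : Type} (A : Structure σ V) where
  n : ℕ
  num : V ≃ Fin n
  list : (R : Fin σ.card) → List (Fin (σ.arity R) → V)
  nodup : ∀ R, (list R).Nodup
  mem_list : ∀ R a, a ∈ list R ↔ a ∈ A.rel R

/-- The input word: the number of elements, followed, for each relation in turn, by the number of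
its tuples and the entries of these tuples. -/
def Presentation.input {σ : Signature} {V : Type} {A : Structure σ V} (E : Presentation A) :
    List ℕ :=
  E.n :: (List.finRange σ.card).flatMap fun R =>
    (E.list R).length ::
      (E.list R).flatMap fun a => List.ofFn fun i => (E.num (a i) : ℕ)

/-- The tuples in the order in which the input lists them. -/
def Presentation.listed {σ : Signature} {V : Type} {A : Structure σ V} (E : Presentation A) :
    List (Tup V) :=
  (List.finRange σ.card).flatMap fun R => (E.list R).map fun a => ⟨σ.arity R, a⟩

/-- The memory segment that starts at the address in register `0` holds, at its `j`-th cell, a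
color of the `j`-th listed tuple, and this coloring is equivalent to the stable coloring of RCR. -/
def Presentation.IsOutput {σ : Signature} {V : Type} {A : Structure σ V} (E : Presentation A)
    (s : State) : Prop :=
  ∀ i j : Fin E.listed.length,
    s.mem (s.reg 0 + i) = s.mem (s.reg 0 + j) ↔
      A.stableColor (E.listed.get i) = A.stableColor (E.listed.get j)

end RCR

/-!
# Relational Color Refinement in time `O(‖A‖ log ‖A‖)`

The stable coloring of a structure is computed by partition refinement on an auxiliary graph. Let
`K` exceed all arities. The vertices of the graph are the tuples of the structure and their slices:
a slice of a tuple `a` is a sequence `a ∘ f` of length `K`, for a list `f` of positions of `a`. There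
are edges, labelled by `f`, in both directions between `a` and `a ∘ f`, and a loop at `a`, labelled by
`(i, j)`, whenever `a i = a j`. A tuple contributes `2 ^ O(k log k)` edges. Two tuples
share the slice `a ∘ f = b ∘ g` if and only if `stp a b` contains the pairs `(f i, g i)`; as `f` ranges
over all lists of `K` positions, the slices of `a` therefore see, for each set of pairs, how many tuples
of each color agree with `a` at least at these pairs, which by inclusion and exclusion (in the form of
an induction from the largest sets downwards) determines the multiset in the definition of Relational
Color Refinement. So the stable coloring is, on the tuples, the coarsest coloring of the graph that
respects the relations and is equitable (`Presentation.stableColor_iff`).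

That coarsest equitable coloring is found by the method of Paige and Tarjan. The vertices are kept in
an array in which every class of the current partition is an interval (`Part`). A round
(`Part.round`) separates the vertices by the number of their occurrences in a list, by moving each
occurrence from its class to the neighbouring class that has been created for it
(`Part.Good.rounds`). A coarser partition into blocks, with respect to which the current partition is
stable, is kept as well (`Blocks.Inv`). As long as a block contains two classes, the smaller one of
its first and last class becomes a block of its own, and the partition is refined with respect to it
(`Blocks.Inv.split`); stability with respect to the rest of the block is automatic, since numbers of
edges into the two parts add up. A vertex is in the part that is split off at most logarithmically
often, because the size of its block is halved each time (`Blocks.split_pot`). When each block is a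
single class, the partition is equitable (`Blocks.Inv.equitable`).

For the implementation, a small imperative language (`Cmd`) with variables and arrays is compiled to
the machine, every elementary operation to at most ten instructions (`IExec.compile_correct`);
programs are verified with weakest preconditions (`wp`). Tuples and slices are identified in constant
time per entry by numbers, their expansions in base `n + 1` (`key`), which serve as indices into
arrays; since the memory is initialized with zeros, the large arrays need not be cleared. Reading the
input takes constant time per entry, except for the first occurrence of each tuple, for which
`2 ^ O(k log k)` slices and edges are created (`wp_read`); the main loop is `wp_main`, and
`total_cost_le` sums up the costs.
-/

namespace RCR

/-! ### A small imperative language on top of the random access machine -/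

/-- The variables of the refinement program; each is kept in a register of its own. -/
inductive Var
  | base | ptr | src | cnt | n1 | pow | acc | t1 | t2 | t3 | row | key | skey | size | edges | li
  | fresh | qfresh | start | vtx | cl | dl | bd | pv | wv | lo | hi | bn | ix | ed | lab | nlab
  | work | blk | ce
deriving DecidableEq

/-- The arrays of the refinement program; each has one cell for every natural number. -/
inductive Arr
  | pw | seen | ord | pos | head | esrc | elbl | enx | tl | cls | cst | cen | nxt | cq | qlo | qhi
  | buf
deriving DecidableEq

/-- A state of the imperative language: variables, arrays, the raw input cells, and a clock. -/
structure St where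
  v : Var → ℕ
  a : Arr → ℕ → ℕ
  raw : ℕ → ℕ
  tick : ℕ

/-- Elementary operations. `ld` and `st` access arrays, `rld` and `rst` access the raw input cells,
`addc` and `subc` have a constant as second operand. -/
inductive Op
  | set (x : Var) (n : ℕ)
  | copy (x y : Var)
  | addc (x y : Var) (n : ℕ)
  | subc (x y : Var) (n : ℕ)
  | add (x y z : Var)
  | sub (x y z : Var)
  | ld (x : Var) (A : Arr) (y : Var)
  | st (A : Arr) (y z : Var)
  | rld (x y : Var)
  | rst (y z : Var)

/-- The effect of an elementary operation, which takes one tick. -/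
def Op.app (s : St) : Op → St
  | .set x n => ⟨Function.update s.v x n, s.a, s.raw, s.tick + 1⟩
  | .copy x y => ⟨Function.update s.v x (s.v y), s.a, s.raw, s.tick + 1⟩
  | .addc x y n => ⟨Function.update s.v x (s.v y + n), s.a, s.raw, s.tick + 1⟩
  | .subc x y n => ⟨Function.update s.v x (s.v y - n), s.a, s.raw, s.tick + 1⟩
  | .add x y z => ⟨Function.update s.v x (s.v y + s.v z), s.a, s.raw, s.tick + 1⟩
  | .sub x y z => ⟨Function.update s.v x (s.v y - s.v z), s.a, s.raw, s.tick + 1⟩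
  | .ld x A y => ⟨Function.update s.v x (s.a A (s.v y)), s.a, s.raw, s.tick + 1⟩
  | .st A y z =>
    ⟨s.v, Function.update s.a A (Function.update (s.a A) (s.v y) (s.v z)), s.raw, s.tick + 1⟩
  | .rld x y => ⟨Function.update s.v x (s.raw (s.v y)), s.a, s.raw, s.tick + 1⟩
  | .rst y z => ⟨s.v, s.a, Function.update s.raw (s.v y) (s.v z), s.tick + 1⟩

/-- The side conditions of an operation: sums of two variables do not exceed `G`, raw cells lie
within the input, of length `L`, and array accesses find `L` in the variable `base`. -/
def Op.Ok (G L : ℕ) (s : St) : Op → Prop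
  | .add _ y z => s.v y + s.v z ≤ G
  | .ld _ _ _ => s.v .base = L
  | .st _ _ _ => s.v .base = L
  | .rld _ y => s.v y < L
  | .rst y _ => s.v y < L
  | _ => True

/-- The largest constant in an operation. -/
def Op.maxConst : Op → ℕ
  | .set _ n => n
  | .addc _ _ n => n
  | .subc _ _ n => n
  | _ => 0

/-- Tests of branches and loops; `nz` tests for being non-zero. -/
inductive Cond
  | nz (x : Var)
  | eq (x y : Var)
  | lt (x y : Var)
  | le (x y : Var)

/-- The truth of a test in a state. -/
def Cond.True (s : St) : Cond → Prop
  | .nz x => s.v x ≠ 0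
  | .eq x y => s.v x = s.v y
  | .lt x y => s.v x < s.v y
  | .le x y => s.v x ≤ s.v y

/-- Commands of the imperative language. -/
inductive Cmd
  | skip
  | op (o : Op)
  | seq (c d : Cmd)
  | ite (t : Cond) (c d : Cmd)
  | loop (t : Cond) (c : Cmd)

/-- The largest constant in a command. -/
def Cmd.maxConst : Cmd → ℕ
  | .skip => 0
  | .op o => o.maxConst
  | .seq c d => max c.maxConst d.maxConst
  | .ite _ c d => max c.maxConst d.maxConst
  | .loop _ c => c.maxConst

/-- One tick of the clock, for the evaluation of a test. -/
def St.step (s : St) : St := ⟨s.v, s.a, s.raw, s.tick + 1⟩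

/-- Big-step semantics of commands. -/
inductive IExec (G L : ℕ) : Cmd → St → St → Prop
  | skip (s : St) : IExec G L .skip s s
  | op (o : Op) (s : St) (h : o.Ok G L s) : IExec G L (.op o) s (o.app s)
  | seq {c d : Cmd} {s s' s'' : St} :
      IExec G L c s s' → IExec G L d s' s'' → IExec G L (.seq c d) s s''
  | ite_true {t : Cond} {c d : Cmd} {s s' : St} :
      t.True s → IExec G L c s.step s' → IExec G L (.ite t c d) s s'
  | ite_false {t : Cond} {c d : Cmd} {s s' : St} :
      ¬ t.True s → IExec G L d s.step s' → IExec G L (.ite t c d) s s'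
  | loop_true {t : Cond} {c : Cmd} {s s' s'' : St} :
      t.True s → IExec G L c s.step s' → IExec G L (.loop t c) s' s'' →
      IExec G L (.loop t c) s s''
  | loop_false {t : Cond} {c : Cmd} {s : St} :
      ¬ t.True s → IExec G L (.loop t c) s s.step

/-- All values of a state are at most `m`. -/
def St.Le (m : ℕ) (s : St) : Prop :=
  (∀ x, s.v x ≤ m) ∧ (∀ A i, s.a A i ≤ m) ∧ ∀ i, s.raw i ≤ m

theorem St.Le.mono {m m' : ℕ} {s : St} (h : s.Le m) (hm : m ≤ m') : s.Le m' :=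
  ⟨fun x => (h.1 x).trans hm, fun A i => (h.2.1 A i).trans hm, fun i => (h.2.2 i).trans hm⟩

theorem Op.app_tick (s : St) (o : Op) : (o.app s).tick = s.tick + 1 := by
  cases o <;> rfl

theorem Op.app_le {G L m : ℕ} {s : St} {o : Op} (ho : o.Ok G L s) (hs : s.Le m) (hG : G ≤ m) :
    (o.app s).Le (m + o.maxConst) := by
  have hv : ∀ x val, val ≤ m + o.maxConst → ∀ x', Function.update s.v x val x' ≤ m + o.maxConst := by
    intro x val h x'
    rw [Function.update_apply]
    split_ifs
    · exact h
    · exact (hs.1 _).trans (by omega)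
  have h2 : ∀ A i, s.a A i ≤ m + o.maxConst := fun A i => (hs.2.1 A i).trans (by omega)
  have h3 : ∀ i, s.raw i ≤ m + o.maxConst := fun i => (hs.2.2 i).trans (by omega)
  have h1 : ∀ x, s.v x ≤ m + o.maxConst := fun x => (hs.1 x).trans (by omega)
  cases o with
  | set x n => exact ⟨hv _ _ (by simp [maxConst]), h2, h3⟩
  | copy x y => exact ⟨hv _ _ (h1 _), h2, h3⟩
  | addc x y n => exact ⟨hv _ _ (by have := hs.1 y; simp [maxConst, this]), h2, h3⟩
  | subc x y n => exact ⟨hv _ _ (by have := h1 y; omega), h2, h3⟩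
  | add x y z => exact ⟨hv _ _ (by have : s.v y + s.v z ≤ G := ho; omega), h2, h3⟩
  | sub x y z => exact ⟨hv _ _ (by have := h1 y; omega), h2, h3⟩
  | ld x A y => exact ⟨hv _ _ (h2 _ _), h2, h3⟩
  | st A y z =>
    refine ⟨h1, fun A' i => ?_, h3⟩
    simp only [app, Function.update_apply]
    split_ifs with hA
    · subst hA
      rw [Function.update_apply]
      split_ifs
      · exact h1 _
      · exact h2 _ _
    · exact h2 _ _
  | rld x y => exact ⟨hv _ _ (h3 _), h2, h3⟩
  | rst y z =>
    refine ⟨h1, h2, fun i => ?_⟩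
    simp only [app, Function.update_apply]
    split_ifs
    · exact h1 _
    · exact h3 _

theorem IExec.tick_le {G L : ℕ} {c : Cmd} {s s' : St} (h : IExec G L c s s') :
    s.tick ≤ s'.tick := by
  induction h with
  | skip => exact le_rfl
  | op o s h => rw [Op.app_tick]; omega
  | seq _ _ h1 h2 => omega
  | ite_true _ _ h => simp only [St.step] at h; omega
  | ite_false _ _ h => simp only [St.step] at h; omega
  | loop_true _ _ _ h1 h2 => simp only [St.step] at h1; omega
  | loop_false => simp [St.step]

/-- Values grow at most by the largest constant in each tick, as the sums of two variables are
bounded by a side condition. -/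
theorem IExec.le {G L m : ℕ} {c : Cmd} {s s' : St} (h : IExec G L c s s') {k : ℕ}
    (hc : c.maxConst ≤ k) (hs : s.Le (m + k * s.tick)) (hG : G ≤ m) :
    s'.Le (m + k * s'.tick) := by
  induction h with
  | skip => exact hs
  | op o s h =>
    refine (Op.app_le h hs (by omega)).mono ?_
    rw [Op.app_tick]
    simp only [Cmd.maxConst] at hc
    nlinarith
  | seq _ _ h1 h2 =>
    simp only [Cmd.maxConst, max_le_iff] at hc
    exact h2 hc.2 (h1 hc.1 hs)
  | ite_true _ _ h =>
    simp only [Cmd.maxConst, max_le_iff] at hc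
    exact h hc.1 (hs.mono (by simp only [St.step]; nlinarith))
  | ite_false _ _ h =>
    simp only [Cmd.maxConst, max_le_iff] at hc
    exact h hc.2 (hs.mono (by simp only [St.step]; nlinarith))
  | loop_true _ _ _ h1 h2 =>
    exact h2 hc (h1 hc (hs.mono (by simp only [St.step]; nlinarith)))
  | loop_false => exact hs.mono (by simp only [St.step]; nlinarith)

/-! ### Compilation -/

/-- The register of a variable; register `0` always holds `0`, and `1`, `2` are for addresses. -/
def Var.reg (x : Var) : ℕ := x.ctorIdx + 3

theorem Var.reg_inj {x y : Var} : x.reg = y.reg ↔ x = y := by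
  refine ⟨fun h => ?_, fun h => h ▸ rfl⟩
  rw [← Var.ofNat_ctorIdx x, ← Var.ofNat_ctorIdx y]
  congr 1
  simpa [Var.reg] using h

theorem Arr.ctorIdx_inj {A B : Arr} : A.ctorIdx = B.ctorIdx ↔ A = B := by
  refine ⟨fun h => ?_, fun h => h ▸ rfl⟩
  rw [← Arr.ofNat_ctorIdx A, ← Arr.ofNat_ctorIdx B, h]

theorem Arr.ctorIdx_lt (A : Arr) : A.ctorIdx < 32 := by
  cases A <;> decide

/-- Sequencing of a list of instructions. -/
def instrs : List Instr → Program
  | [] => .skip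
  | i :: l => .seq (.instr i) (instrs l)

/-- Puts the address of the cell of array `A` whose index is in the variable `y` into
register `1`. -/
def Arr.addr (A : Arr) (y : Var) : List Instr :=
  [.add 1 y.reg y.reg, .add 1 1 1, .add 1 1 1, .add 1 1 1, .add 1 1 1, .add 1 Var.base.reg 1,
    .const 2 A.ctorIdx, .add 1 1 2]

/-- The machine instructions for an operation. -/
def Op.compile : Op → List Instr
  | .set x n => [.const x.reg n]
  | .copy x y => [.copy x.reg y.reg]
  | .addc x y n => [.const 2 n, .add x.reg y.reg 2]
  | .subc x y n => [.const 2 n, .sub x.reg y.reg 2]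
  | .add x y z => [.add x.reg y.reg z.reg]
  | .sub x y z => [.sub x.reg y.reg z.reg]
  | .ld x A y => A.addr y ++ [.load x.reg 1]
  | .st A y z => A.addr y ++ [.store 1 z.reg]
  | .rld x y => [.load x.reg y.reg]
  | .rst y z => [.store y.reg z.reg]

/-- The machine test for a test. -/
def Cond.compile : Cond → Test
  | .nz x => .ne x.reg 0
  | .eq x y => .eq x.reg y.reg
  | .lt x y => .lt x.reg y.reg
  | .le x y => .le x.reg y.reg

/-- The machine program for a command. -/
def Cmd.compile : Cmd → Program
  | .skip => .skip
  | .op o => instrs o.compile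
  | .seq c d => .seq c.compile d.compile
  | .ite t c d => .ite t.compile c.compile d.compile
  | .loop t c => .loop t.compile c.compile

/-- The machine state `S` represents the state `s`: the raw cells are the first `L` memory cells,
and the arrays are interleaved behind them. -/
structure Sim (L B : ℕ) (s : St) (S : State) : Prop where
  reg : ∀ x : Var, S.reg x.reg = s.v x
  zero : S.reg 0 = 0
  raw : ∀ i < L, S.mem i = s.raw i
  arr : ∀ (A : Arr) i, S.mem (L + 32 * i + A.ctorIdx) = s.a A i
  bdd : S.Bounded B

theorem Sim.step {L B : ℕ} {s : St} {S : State} (h : Sim L B s S) : Sim L B s.step S :=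
  ⟨h.reg, h.zero, h.raw, h.arr, h.bdd⟩

theorem Cond.holds_iff {L B : ℕ} {s : St} {S : State} (h : Sim L B s S) (t : Cond) :
    t.compile.Holds S ↔ t.True s := by
  cases t <;> simp [compile, Test.Holds, Cond.True, h.reg, h.zero]

theorem State.Bounded.update_reg {B : ℕ} {S : State} (h : S.Bounded B) {r n : ℕ} (hn : n ≤ B) :
    State.Bounded B { S with reg := Function.update S.reg r n } := by
  refine ⟨fun r' => ?_, h.2⟩
  simp only [Function.update_apply]
  split_ifs
  · exact hn
  · exact h.1 _

/-- An update of a register that does not belong to a variable. -/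
theorem Sim.update_tmp {L B : ℕ} {s : St} {S : State} (h : Sim L B s S) {r n : ℕ}
    (hr : 0 < r) (hr' : r < 3) (hn : n ≤ B) :
    Sim L B s { S with reg := Function.update S.reg r n } where
  reg x := by
    have hx : x.reg ≠ r := by unfold Var.reg; omega
    rw [← h.reg x]
    exact Function.update_of_ne hx _ _
  zero := by
    have hx : 0 ≠ r := by omega
    simpa only [Function.update_of_ne hx] using h.zero
  raw := h.raw
  arr := h.arr
  bdd := h.bdd.update_reg hn

theorem Sim.update_var {L B : ℕ} {s : St} {S : State} (h : Sim L B s S) (x : Var) {n : ℕ}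
    (hn : n ≤ B) (k : ℕ) :
    Sim L B ⟨Function.update s.v x n, s.a, s.raw, k⟩
      { S with reg := Function.update S.reg x.reg n } where
  reg y := by
    simp only [Function.update_apply, Var.reg_inj, h.reg]
  zero := by
    have hx : 0 ≠ x.reg := by unfold Var.reg; omega
    simpa only [Function.update_of_ne hx] using h.zero
  raw := h.raw
  arr := h.arr
  bdd := h.bdd.update_reg hn

theorem exec_cons {B : ℕ} {i : Instr} {l : List Instr} {S S' : State} {t : ℕ}
    (h : (i.apply S).Bounded B) (h' : Exec B (instrs l) (i.apply S) S' t) :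
    Exec B (instrs (i :: l)) S S' (1 + t) :=
  .seq (.instr i S h) h'

/-- The address computation preserves the represented state. -/
theorem Sim.addr {L B : ℕ} {s : St} {S : State} (h : Sim L B s S) (A : Arr) (y : Var)
    (hb : s.v .base = L) (hB : L + 32 * s.v y + 32 ≤ B) {l : List Instr} {P : State → Prop} {k : ℕ}
    (hl : ∀ S', Sim L B s S' → S'.reg 1 = L + 32 * s.v y + A.ctorIdx →
      ∃ S'' t, Exec B (instrs l) S' S'' t ∧ P S'' ∧ t ≤ k) :
    ∃ S'' t, Exec B (instrs (A.addr y ++ l)) S S'' t ∧ P S'' ∧ t ≤ k + 8 := by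
  have hA := A.ctorIdx_lt
  have key : ∀ (a b : ℕ) (S : State), Sim L B s S → S.reg a + S.reg b ≤ B →
      ∃ S', Instr.apply S (.add 1 a b) = S' ∧ Sim L B s S' ∧ S'.reg 1 = S.reg a + S.reg b := by
    intro a b S h hab
    exact ⟨_, rfl, h.update_tmp (by omega) (by omega) hab, by simp [Instr.apply]⟩
  obtain ⟨S1, e1, h1, r1⟩ := key y.reg y.reg S h (by rw [h.reg]; omega)
  rw [h.reg] at r1
  obtain ⟨S2, e2, h2, r2⟩ := key 1 1 S1 h1 (by omega)
  obtain ⟨S3, e3, h3, r3⟩ := key 1 1 S2 h2 (by omega)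
  obtain ⟨S4, e4, h4, r4⟩ := key 1 1 S3 h3 (by omega)
  obtain ⟨S5, e5, h5, r5⟩ := key 1 1 S4 h4 (by omega)
  obtain ⟨S6, e6, h6, r6⟩ := key Var.base.reg 1 S5 h5 (by rw [h5.reg, hb]; omega)
  rw [h5.reg, hb] at r6
  have h7 : Sim L B s (Instr.apply S6 (.const 2 A.ctorIdx)) :=
    h6.update_tmp (by omega) (by omega) (by omega)
  have r7 : (Instr.apply S6 (.const 2 A.ctorIdx)).reg 1 = S6.reg 1 := by
    simp [Instr.apply]
  have r7' : (Instr.apply S6 (.const 2 A.ctorIdx)).reg 2 = A.ctorIdx := by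
    simp [Instr.apply]
  obtain ⟨S8, e8, h8, r8⟩ := key 1 2 _ h7 (by omega)
  obtain ⟨S', t, he, hP, ht⟩ := hl S8 h8 (by omega)
  refine ⟨S', 1 + (1 + (1 + (1 + (1 + (1 + (1 + (1 + t))))))), ?_, hP, by omega⟩
  refine exec_cons (e1 ▸ h1.bdd) ?_
  rw [e1]
  refine exec_cons (e2 ▸ h2.bdd) ?_
  rw [e2]
  refine exec_cons (e3 ▸ h3.bdd) ?_
  rw [e3]
  refine exec_cons (e4 ▸ h4.bdd) ?_
  rw [e4]
  refine exec_cons (e5 ▸ h5.bdd) ?_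
  rw [e5]
  refine exec_cons (e6 ▸ h6.bdd) ?_
  rw [e6]
  refine exec_cons h7.bdd ?_
  refine exec_cons (e8 ▸ h8.bdd) ?_
  rw [e8]
  exact he

theorem Op.compile_correct {G L B m : ℕ} {s : St} {S : State} {o : Op} (h : Sim L B s S)
    (ho : o.Ok G L s) (hs : s.Le m) (hG : G ≤ m) (hB : L + 32 * (m + o.maxConst) + 32 ≤ B) :
    ∃ S' t, Exec B (instrs o.compile) S S' t ∧ Sim L B (o.app s) S' ∧ t ≤ 10 := by
  have one : ∀ {i : Instr} {S S' : State}, Instr.apply S i = S' → Sim L B (o.app s) S' →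
      ∃ S'' t, Exec B (instrs [i]) S S'' t ∧ Sim L B (o.app s) S'' ∧ t ≤ 2 := by
    rintro i S S' rfl h
    exact ⟨_, _, exec_cons h.bdd (.skip _), h, by omega⟩
  have fin : ∀ {l : List Instr} {S : State} {k : ℕ}, k ≤ 10 →
      (∃ S'' t, Exec B (instrs l) S S'' t ∧ Sim L B (o.app s) S'' ∧ t ≤ k) →
      ∃ S'' t, Exec B (instrs l) S S'' t ∧ Sim L B (o.app s) S'' ∧ t ≤ 10 := by
    rintro l S k hk ⟨S'', t, h1, h2, h3⟩
    exact ⟨S'', t, h1, h2, h3.trans hk⟩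
  have happ := Op.app_le ho hs hG
  have hvB : ∀ x, (o.app s).v x ≤ B := fun x => (happ.1 x).trans (by omega)
  have two : ∀ {i : Instr} {n : ℕ}, n ≤ B →
      (∃ S'' t, Exec B (instrs [i]) { S with reg := Function.update S.reg 2 n } S'' t ∧
        Sim L B (o.app s) S'' ∧ t ≤ 2) →
      ∃ S'' t, Exec B (instrs [.const 2 n, i]) S S'' t ∧ Sim L B (o.app s) S'' ∧ t ≤ 3 := by
    rintro i n hn ⟨S'', t, h1, h2, h3⟩
    exact ⟨S'', _, exec_cons (h.bdd.update_reg hn) h1, h2, by omega⟩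
  cases o with
  | set x n =>
    exact fin (k := 2) (by omega) (one rfl (h.update_var x
      (by simpa [Op.app] using hvB x) _))
  | copy x y =>
    refine fin (k := 2) (by omega) (one ?_ (h.update_var x (n := s.v y)
      (by simpa [Op.app] using hvB x) _))
    simp [Instr.apply, h.reg]
  | addc x y n =>
    have hn : n ≤ B := by simp only [maxConst] at hB; omega
    have h' := h.update_tmp (r := 2) (n := n) (by omega) (by omega) hn
    refine fin (k := 3) (by omega) (two hn (one ?_ (h'.update_var x (n := s.v y + n)
      (by simpa [Op.app] using hvB x) _)))
    have hy := h'.reg y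
    simp only at hy
    simp only [Instr.apply, hy, Function.update_self]
  | subc x y n =>
    have hn : n ≤ B := by simp only [maxConst] at hB; omega
    have h' := h.update_tmp (r := 2) (n := n) (by omega) (by omega) hn
    refine fin (k := 3) (by omega) (two hn (one ?_ (h'.update_var x (n := s.v y - n)
      (by simpa [Op.app] using hvB x) _)))
    have hy := h'.reg y
    simp only at hy
    simp only [Instr.apply, hy, Function.update_self]
  | add x y z =>
    refine fin (k := 2) (by omega) (one ?_ (h.update_var x (n := s.v y + s.v z)
      (by simpa [Op.app] using hvB x) _))
    simp [Instr.apply, h.reg]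
  | sub x y z =>
    refine fin (k := 2) (by omega) (one ?_ (h.update_var x (n := s.v y - s.v z)
      (by simpa [Op.app] using hvB x) _))
    simp [Instr.apply, h.reg]
  | ld x A y =>
    have hy := hs.1 y
    refine h.addr A y ho (by omega) fun S' hS' hr => one ?_ (hS'.update_var x (n := s.a A (s.v y))
      (by simpa [Op.app] using hvB x) _)
    simp only [Instr.apply, hr, hS'.arr]
  | st A y z =>
    have hy := hs.1 y
    have hz := hs.1 z
    have hA := A.ctorIdx_lt
    refine h.addr A y ho (by omega) fun S' hS' hr => one rfl
      ⟨fun x => hS'.reg x, hS'.zero, ?_, ?_, ?_⟩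
    · intro i hi
      simp only [Instr.apply, Op.app]
      rw [← hS'.raw i hi, Function.update_of_ne (by omega)]
    · intro A' i
      have hA' := A'.ctorIdx_lt
      simp only [Instr.apply, Op.app, hr, hS'.reg]
      by_cases hAA : A' = A
      · subst hAA
        by_cases hi : i = s.v y
        · subst hi
          simp
        · rw [Function.update_of_ne (by omega), hS'.arr, Function.update_self,
            Function.update_of_ne hi]
      · have := mt Arr.ctorIdx_inj.1 hAA
        rw [Function.update_of_ne (by omega), hS'.arr, Function.update_of_ne hAA]
    · refine ⟨hS'.bdd.1, fun a => ?_⟩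
      simp only [Instr.apply, Function.update_apply, hS'.reg]
      split_ifs
      · omega
      · exact hS'.bdd.2 a
  | rld x y =>
    have hy : s.v y < L := ho
    refine fin (k := 2) (by omega) (one ?_ (h.update_var x (n := s.raw (s.v y))
      (by simpa [Op.app] using hvB x) _))
    simp [Instr.apply, h.reg, h.raw _ hy]
  | rst y z =>
    have hy : s.v y < L := ho
    have hz := hs.1 z
    refine fin (k := 2) (by omega) (one rfl ⟨fun x => h.reg x, h.zero, ?_, ?_, ?_⟩)
    · intro i hi
      simp only [Instr.apply, Op.app, Function.update_apply, h.reg, h.raw i hi]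
    · intro A i
      simp only [Instr.apply, Op.app]
      rw [← h.arr A i, h.reg, Function.update_of_ne (by omega)]
    · refine ⟨h.bdd.1, fun a => ?_⟩
      simp only [Instr.apply, Function.update_apply, h.reg]
      split_ifs
      · omega
      · exact h.bdd.2 a

/-- The compiled program simulates the command, with a constant slowdown. -/
theorem IExec.compile_correct {G L B m k T : ℕ} {c : Cmd} {s s' : St} (h : IExec G L c s s')
    (hc : c.maxConst ≤ k) (hs : s.Le (m + k * s.tick)) (hG : G ≤ m) (hT : s'.tick ≤ T)
    (hB : L + 32 * (m + k * T) + 32 ≤ B) {S : State} (hS : Sim L B s S) :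
    ∃ S' t, Exec B c.compile S S' t ∧ Sim L B s' S' ∧ t + 10 * s.tick ≤ 10 * s'.tick := by
  induction h generalizing S with
  | skip => exact ⟨S, 0, .skip S, hS, by omega⟩
  | op o s h =>
    rw [Op.app_tick] at hT
    simp only [Cmd.maxConst] at hc
    obtain ⟨S', t, h1, h2, h3⟩ := Op.compile_correct hS h hs (by omega) (by nlinarith)
    exact ⟨S', t, h1, h2, by rw [Op.app_tick]; omega⟩
  | seq e1 e2 h1 h2 =>
    simp only [Cmd.maxConst, max_le_iff] at hc
    obtain ⟨S1, t1, x1, y1, z1⟩ := h1 hc.1 hs (e2.tick_le.trans hT) hS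
    obtain ⟨S2, t2, x2, y2, z2⟩ := h2 hc.2 (e1.le hc.1 hs hG) hT y1
    exact ⟨S2, _, .seq x1 x2, y2, by omega⟩
  | ite_true ht _ h =>
    simp only [Cmd.maxConst, max_le_iff] at hc
    obtain ⟨S1, t1, x1, y1, z1⟩ :=
      h hc.1 (hs.mono (by simp only [St.step]; nlinarith)) hT hS.step
    simp only [St.step] at z1
    exact ⟨S1, _, .ite_true ((Cond.holds_iff hS _).2 ht) x1, y1, by omega⟩
  | ite_false ht _ h =>
    simp only [Cmd.maxConst, max_le_iff] at hc
    obtain ⟨S1, t1, x1, y1, z1⟩ :=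
      h hc.2 (hs.mono (by simp only [St.step]; nlinarith)) hT hS.step
    simp only [St.step] at z1
    exact ⟨S1, _, .ite_false (mt (Cond.holds_iff hS _).1 ht) x1, y1, by omega⟩
  | @loop_true t c s s1 s2 ht e1 e2 h1 h2 =>
    have hs' : s.step.Le (m + k * s.step.tick) := hs.mono (by simp only [St.step]; nlinarith)
    obtain ⟨S1, t1, x1, y1, z1⟩ := h1 hc hs' (e2.tick_le.trans hT) hS.step
    simp only [St.step] at z1
    obtain ⟨S2, t2, x2, y2, z2⟩ := h2 hc (e1.le hc hs' hG) hT y1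
    exact ⟨S2, _, .loop_true ((Cond.holds_iff hS _).2 ht) x1 x2, y2, by omega⟩
  | loop_false ht =>
    refine ⟨S, _, .loop_false (mt (Cond.holds_iff hS _).1 ht), hS.step, ?_⟩
    simp only [St.step]
    omega

/-! ### Weakest preconditions -/

/-- The weakest precondition, for total correctness, of a command. -/
def wp (G L : ℕ) (c : Cmd) (Q : St → Prop) (s : St) : Prop := ∃ s', IExec G L c s s' ∧ Q s'

section

variable {G L : ℕ} {Q : St → Prop} {s : St}

theorem wp_skip (h : Q s) : wp G L .skip Q s := ⟨s, .skip s, h⟩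

theorem wp_op {o : Op} (h : o.Ok G L s) (h' : Q (o.app s)) : wp G L (.op o) Q s :=
  ⟨_, .op o s h, h'⟩

theorem wp_seq {c d : Cmd} (h : wp G L c (wp G L d Q) s) : wp G L (.seq c d) Q s := by
  obtain ⟨s', h1, s'', h2, h3⟩ := h
  exact ⟨s'', .seq h1 h2, h3⟩

theorem wp_ite {t : Cond} {c d : Cmd} (h1 : t.True s → wp G L c Q s.step)
    (h2 : ¬ t.True s → wp G L d Q s.step) : wp G L (.ite t c d) Q s := by
  by_cases ht : t.True s
  · obtain ⟨s', h, h'⟩ := h1 ht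
    exact ⟨s', .ite_true ht h, h'⟩
  · obtain ⟨s', h, h'⟩ := h2 ht
    exact ⟨s', .ite_false ht h, h'⟩

theorem wp.mono {c : Cmd} {Q' : St → Prop} (h : wp G L c Q s) (hQ : ∀ s', Q s' → Q' s') :
    wp G L c Q' s := by
  obtain ⟨s', h1, h2⟩ := h
  exact ⟨s', h1, hQ s' h2⟩

theorem wp_loop_false {t : Cond} {c : Cmd} (h : ¬ t.True s) (hQ : Q s.step) :
    wp G L (.loop t c) Q s := ⟨_, .loop_false h, hQ⟩

theorem wp_loop_true {t : Cond} {c : Cmd} (h : t.True s)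
    (hQ : wp G L c (wp G L (.loop t c) Q) s.step) : wp G L (.loop t c) Q s := by
  obtain ⟨s', h1, s'', h2, h3⟩ := hQ
  exact ⟨s'', .loop_true h h1 h2, h3⟩

/-- The rule for loops whose number of iterations is known. -/
theorem wp_for {t : Cond} {c : Cmd} (I : ℕ → St → Prop) {n : ℕ} (h : I n s)
    (hs : ∀ n s, I (n + 1) s → t.True s ∧ wp G L c (I n) s.step)
    (h0 : ∀ s, I 0 s → ¬ t.True s ∧ Q s.step) : wp G L (.loop t c) Q s := by
  induction n generalizing s with
  | zero => exact wp_loop_false (h0 s h).1 (h0 s h).2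
  | succ n ih => exact wp_loop_true (hs n s h).1 ((hs n s h).2.mono fun s' h' => ih h')

/-- The rule for loops whose invariant bounds the clock. -/
theorem wp_while {t : Cond} {c : Cmd} (I : St → Prop) {T : ℕ} (h : I s)
    (hT : ∀ s, I s → s.tick ≤ T) (hs : ∀ s, I s → t.True s → wp G L c I s.step)
    (h0 : ∀ s, I s → ¬ t.True s → Q s.step) : wp G L (.loop t c) Q s := by
  obtain ⟨k, hk⟩ : ∃ k, k = T - s.tick := ⟨_, rfl⟩
  induction k using Nat.strong_induction_on generalizing s with
  | _ k ih =>
    by_cases ht : t.True s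
    · refine wp_loop_true ht ?_
      obtain ⟨s', h1, h2⟩ := hs s h ht
      have h3 := h1.tick_le
      have h4 := hT s' h2
      simp only [St.step] at h3
      exact ⟨s', h1, ih (T - s'.tick) (by omega) h2 rfl⟩
    · exact wp_loop_false ht (h0 s h ht)

end

/-- Sequencing of a list of commands. -/
def seqs : List Cmd → Cmd
  | [] => .skip
  | c :: l => .seq c (seqs l)

/-- Sequencing of a list of operations. -/
def ops : List Op → Cmd
  | [] => .skip
  | o :: l => .seq (.op o) (ops l)

/-- The side conditions of a list of operations. -/
def OpsOk (G L : ℕ) : List Op → St → Prop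
  | [], _ => True
  | o :: l, s => o.Ok G L s ∧ OpsOk G L l (o.app s)

theorem wp_ops {G L : ℕ} {Q : St → Prop} {l : List Op} {s : St} (h : OpsOk G L l s)
    (hQ : Q (l.foldl Op.app s)) : wp G L (ops l) Q s := by
  induction l generalizing s with
  | nil => exact wp_skip hQ
  | cons o l ih => exact wp_seq (wp_op h.1 (ih h.2 hQ))

theorem wp_seqs_cons {G L : ℕ} {Q : St → Prop} {c : Cmd} {l : List Cmd} {s : St}
    (h : wp G L c (wp G L (seqs l) Q) s) : wp G L (seqs (c :: l)) Q s := wp_seq h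

theorem wp_seqs_nil {G L : ℕ} {Q : St → Prop} {s : St} (h : Q s) : wp G L (seqs []) Q s :=
  wp_skip h

/-- The rule for a sequence of similar commands, one for each element of a list. -/
theorem wp_seqs_map {G L : ℕ} {Q : St → Prop} {α : Type*} {l : List α} {f : α → Cmd}
    (I : List α → St → Prop) {s : St} (h : I l s)
    (hs : ∀ x l s, I (x :: l) s → wp G L (f x) (I l) s) (h0 : ∀ s, I [] s → Q s) :
    wp G L (seqs (l.map f)) Q s := by
  induction l generalizing s with
  | nil => exact wp_seqs_nil (h0 s h)
  | cons x l ih => exact wp_seqs_cons ((hs x l s h).mono fun s' h' => ih h')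

/-! ### Ordered partitions and their refinement -/

/-- A partition of a finite set of vertices: the array `ord` lists the vertices so that each class
occupies an interval, the class `c` the positions from `cst c` to `cen c - 1`; `pos` is the inverse
of `ord`, and `cls` maps vertices to their classes. The numbers below `fresh` are class numbers (of
possibly empty classes), `nxt c` is the class that receives the vertices moved out of the class
`c`, and `cq c` is the block, of a coarser partition, that contains the class `c`. -/
structure Part where
  ord : ℕ → ℕ
  pos : ℕ → ℕ
  cls : ℕ → ℕ
  cst : ℕ → ℕ
  cen : ℕ → ℕ
  nxt : ℕ → ℕ
  cq : ℕ → ℕ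
  fresh : ℕ

namespace Part

/-- Makes sure that the class `c` has a receiving class numbered `start` or above. A new one is
empty and lies directly to the left of `c`. -/
def ensure (start : ℕ) (P : Part) (c : ℕ) : Part :=
  if P.nxt c < start then
    { P with
      cst := Function.update P.cst P.fresh (P.cst c)
      cen := Function.update P.cen P.fresh (P.cst c)
      cq := Function.update P.cq P.fresh (P.cq c)
      nxt := Function.update (Function.update P.nxt c P.fresh) P.fresh 0
      fresh := P.fresh + 1 }
  else P

/-- Moves the vertex `u` to the receiving class of its class: `u` swaps places with the first
vertex of its class, and the boundary between the two classes moves by one. -/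
def shift (P : Part) (u : ℕ) : Part :=
  { P with
    ord := Function.update (Function.update P.ord (P.pos u) (P.ord (P.cst (P.cls u))))
      (P.cst (P.cls u)) u
    pos := Function.update (Function.update P.pos (P.ord (P.cst (P.cls u))) (P.pos u))
      u (P.cst (P.cls u))
    cls := Function.update P.cls u (P.nxt (P.cls u))
    cst := Function.update P.cst (P.cls u) (P.cst (P.cls u) + 1)
    cen := Function.update P.cen (P.nxt (P.cls u)) (P.cst (P.cls u) + 1) }

/-- Moves the vertex `u`, in a round in which the numbers of new classes begin with `start`. -/
def move (start : ℕ) (P : Part) (u : ℕ) : Part := (P.ensure start (P.cls u)).shift u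

/-- A refinement round: moves the vertices of a list, each as often as it is listed. -/
def round (P : Part) (l : List ℕ) : Part := l.foldl (move P.fresh) P

/-- The consistency of a partition of the vertex set `X`, which has `N` elements. -/
structure Good (X : Finset ℕ) (N : ℕ) (P : Part) : Prop where
  pos_lt : ∀ u ∈ X, P.pos u < N
  ord_pos : ∀ u ∈ X, P.ord (P.pos u) = u
  ord_mem : ∀ i < N, P.ord i ∈ X
  pos_ord : ∀ i < N, P.pos (P.ord i) = i
  cls_lt : ∀ u ∈ X, P.cls u < P.fresh
  cst_le : ∀ u ∈ X, P.cst (P.cls u) ≤ P.pos u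
  lt_cen : ∀ u ∈ X, P.pos u < P.cen (P.cls u)
  le : ∀ c < P.fresh, P.cst c ≤ P.cen c
  blk : ∀ c < P.fresh, ∀ i, P.cst c ≤ i → i < P.cen c → i < N ∧ P.cls (P.ord i) = c
  nxt_lt : ∀ c < P.fresh, P.nxt c < P.fresh

/-- The invariant of a round in which each vertex `u` has been moved `m u` times. The ghost `nm`
maps a class to the class at the start of the round that it is part of, and to the number of moves
of its vertices; it determines the class. -/
structure Mid (X : Finset ℕ) (N start : ℕ) (cls0 m : ℕ → ℕ) (nm : ℕ → ℕ × ℕ) (P : Part) : Prop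
    extends Good X N P where
  start_le : start ≤ P.fresh
  name_old : ∀ c < start, nm c = (c, 0)
  name_nxt : ∀ c < P.fresh, start ≤ P.nxt c → nm (P.nxt c) = ((nm c).1, (nm c).2 + 1)
  adj : ∀ c < P.fresh, start ≤ P.nxt c → P.cen (P.nxt c) = P.cst c
  nxt_cq : ∀ c < P.fresh, start ≤ P.nxt c → P.cq (P.nxt c) = P.cq c
  parent : ∀ d < P.fresh, start ≤ d → ∃ c < P.fresh, P.nxt c = d
  inj : ∀ c < P.fresh, ∀ c' < P.fresh, nm c = nm c' → c = c'
  name_cls : ∀ u ∈ X, nm (P.cls u) = (cls0 u, m u)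
  cls0_lt : ∀ u ∈ X, cls0 u < start

/-- `P'` refines `P` without touching the coarser partition into blocks. -/
structure Ext (X : Finset ℕ) (N : ℕ) (P P' : Part) : Prop where
  fresh_le : P.fresh ≤ P'.fresh
  cq_eq : ∀ c < P.fresh, P'.cq c = P.cq c
  qcls : ∀ u ∈ X, P'.cq (P'.cls u) = P.cq (P.cls u)
  qord : ∀ i < N, P'.cq (P'.cls (P'.ord i)) = P.cq (P.cls (P.ord i))
  cq_new : ∀ c < P'.fresh, ∃ c' < P.fresh, P'.cq c = P.cq c'

variable {X : Finset ℕ} {N start : ℕ} {cls0 m : ℕ → ℕ} {nm : ℕ → ℕ × ℕ} {P P' P'' : Part}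

theorem Ext.refl (P : Part) : Ext X N P P :=
  ⟨le_rfl, fun _ _ => rfl, fun _ _ => rfl, fun _ _ => rfl, fun c hc => ⟨c, hc, rfl⟩⟩

theorem Ext.trans (h : Ext X N P P') (h' : Ext X N P' P'') : Ext X N P P'' where
  fresh_le := h.fresh_le.trans h'.fresh_le
  cq_eq c hc := (h'.cq_eq c (hc.trans_le h.fresh_le)).trans (h.cq_eq c hc)
  qcls u hu := (h'.qcls u hu).trans (h.qcls u hu)
  qord i hi := (h'.qord i hi).trans (h.qord i hi)
  cq_new c hc := by
    obtain ⟨c1, h1, e1⟩ := h'.cq_new c hc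
    obtain ⟨c2, h2, e2⟩ := h.cq_new c1 h1
    exact ⟨c2, h2, e1.trans e2⟩

theorem Mid.ensure (h : Mid X N start cls0 m nm P) {c : ℕ} (hc : c < P.fresh) :
    ∃ nm', Mid X N start cls0 m nm' (P.ensure start c) ∧ start ≤ (P.ensure start c).nxt c ∧
      (P.ensure start c).cls = P.cls ∧ Ext X N P (P.ensure start c) := by
  unfold Part.ensure
  split_ifs with hn
  swap
  · exact ⟨nm, h, by omega, rfl, Ext.refl P⟩
  have hs := h.start_le
  have hne : ∀ {e}, e < P.fresh → e ≠ P.fresh := fun h => h.ne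
  refine ⟨Function.update nm P.fresh ((nm c).1, (nm c).2 + 1), ?_, ?_, rfl, ?_⟩
  · refine ⟨⟨h.pos_lt, h.ord_pos, h.ord_mem, h.pos_ord, ?_, ?_, ?_, ?_, ?_, ?_⟩,
      ?_, ?_, ?_, ?_, ?_, ?_, ?_, ?_, h.cls0_lt⟩
    · intro u hu
      have := h.cls_lt u hu
      simp only; omega
    · intro u hu
      simpa only [Function.update_of_ne (hne (h.cls_lt u hu))] using h.cst_le u hu
    · intro u hu
      simpa only [Function.update_of_ne (hne (h.cls_lt u hu))] using h.lt_cen u hu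
    · intro e he
      by_cases hef : e = P.fresh
      · subst hef; simp
      · simp only at he
        simpa only [Function.update_of_ne hef] using h.le e (by omega)
    · intro e he i
      by_cases hef : e = P.fresh
      · subst hef; simp only [Function.update_self]; omega
      · simp only at he
        simpa only [Function.update_of_ne hef] using h.blk e (by omega) i
    · intro e he
      simp only at he ⊢
      by_cases hef : e = P.fresh
      · subst hef; simp
      · rw [Function.update_of_ne hef, Function.update_apply]
        split_ifs
        · omega
        · have := h.nxt_lt e (by omega); omega
    · simp only; omega
    · intro e he
      rw [Function.update_of_ne (by omega)]
      exact h.name_old e he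
    · intro e he
      simp only at he ⊢
      by_cases hef : e = P.fresh
      · subst hef; simp only [Function.update_self]; omega
      · rw [Function.update_of_ne hef, Function.update_of_ne hef, Function.update_apply]
        split_ifs with hec
        · subst hec; simp
        · intro h1
          rw [Function.update_of_ne (hne (h.nxt_lt e (by omega)))]
          exact h.name_nxt e (by omega) h1
    · intro e he
      simp only at he ⊢
      by_cases hef : e = P.fresh
      · subst hef; simp only [Function.update_self]; omega
      · rw [Function.update_of_ne hef, Function.update_of_ne hef, Function.update_apply]
        split_ifs with hec
        · subst hec; simp
        · intro h1
          rw [Function.update_of_ne (hne (h.nxt_lt e (by omega)))]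
          exact h.adj e (by omega) h1
    · intro e he
      simp only at he ⊢
      by_cases hef : e = P.fresh
      · subst hef; simp only [Function.update_self]; omega
      · rw [Function.update_of_ne hef, Function.update_of_ne hef, Function.update_apply]
        split_ifs with hec
        · subst hec; simp
        · intro h1
          rw [Function.update_of_ne (hne (h.nxt_lt e (by omega)))]
          exact h.nxt_cq e (by omega) h1
    · intro d hd hsd
      simp only at hd ⊢
      by_cases hdf : d = P.fresh
      · exact ⟨c, by omega, by rw [Function.update_of_ne (hne hc), Function.update_self, hdf]⟩
      · obtain ⟨c', hc', he⟩ := h.parent d (by omega) hsd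
        refine ⟨c', by omega, ?_⟩
        rw [Function.update_of_ne (hne hc'), Function.update_of_ne, he]
        rintro rfl
        omega
    · have key : ∀ e < P.fresh, nm e ≠ ((nm c).1, (nm c).2 + 1) := by
        intro e he hnm
        have hes : start ≤ e := by
          by_contra hlt
          have := h.name_old e (by omega)
          rw [this] at hnm
          have := congrArg Prod.snd hnm
          simp at this
        obtain ⟨c', hc', hn'⟩ := h.parent e he hes
        have h2 := h.name_nxt c' hc' (by omega)
        rw [hn', hnm] at h2
        have h3 : nm c = nm c' := by
          simp only [Prod.mk.injEq] at h2
          exact Prod.ext h2.1 (by omega)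
        have := h.inj c hc c' hc' h3
        subst this
        omega
      intro e he e' he'
      simp only at he he'
      simp only [Function.update_apply]
      split_ifs with h1 h2 h2
      · intro _; omega
      · intro hh; exact absurd hh.symm (key e' (by omega))
      · intro hh; exact absurd hh (key e (by omega))
      · exact h.inj e (by omega) e' (by omega)
    · intro u hu
      simp only
      rw [Function.update_of_ne (hne (h.cls_lt u hu))]
      exact h.name_cls u hu
  · simp only
    rw [Function.update_of_ne (hne hc), Function.update_self]
    exact hs
  · refine ⟨by simp, ?_, ?_, ?_, ?_⟩
    · intro e he
      exact Function.update_of_ne (hne he) _ _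
    · intro u hu
      exact Function.update_of_ne (hne (h.cls_lt u hu)) _ _
    · intro i hi
      exact Function.update_of_ne (hne (h.cls_lt _ (h.ord_mem i hi))) _ _
    · intro e he
      simp only at he ⊢
      by_cases hef : e = P.fresh
      · exact ⟨c, hc, by rw [hef, Function.update_self]⟩
      · exact ⟨e, by omega, Function.update_of_ne hef _ _⟩

theorem Mid.shift (h : Mid X N start cls0 m nm P) {u : ℕ} (hu : u ∈ X) (hn : start ≤ P.nxt (P.cls u)) :
    Mid X N start cls0 (Function.update m u (m u + 1)) nm (P.shift u) ∧
      Ext X N P (P.shift u) := by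
  obtain ⟨c, hc⟩ : ∃ c, c = P.cls u := ⟨_, rfl⟩
  obtain ⟨b, hb⟩ : ∃ b, b = P.cst c := ⟨_, rfl⟩
  obtain ⟨p, hp⟩ : ∃ p, p = P.pos u := ⟨_, rfl⟩
  obtain ⟨w, hw⟩ : ∃ w, w = P.ord b := ⟨_, rfl⟩
  obtain ⟨d, hd⟩ : ∃ d, d = P.nxt c := ⟨_, rfl⟩
  have hshift : P.shift u = { P with
      ord := Function.update (Function.update P.ord p w) b u
      pos := Function.update (Function.update P.pos w p) u b
      cls := Function.update P.cls u d
      cst := Function.update P.cst c (b + 1)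
      cen := Function.update P.cen d (b + 1) } := by
    unfold Part.shift
    rw [hd, hw, hp, hb, hc]
  have hcf : c < P.fresh := hc ▸ h.cls_lt u hu
  rw [← hc, ← hd] at hn
  have hdf : d < P.fresh := hd ▸ h.nxt_lt c hcf
  have hadj : P.cen d = b := by rw [hd, hb]; exact h.adj c hcf (hd ▸ hn)
  have hname := h.name_nxt c hcf (hd ▸ hn)
  rw [← hd] at hname
  have hdc : d ≠ c := by
    intro he
    rw [he] at hname
    have := congrArg Prod.snd hname
    simp at this
  have hbp : b ≤ p := by rw [hb, hp, hc]; exact h.cst_le u hu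
  have hpc : p < P.cen c := by rw [hp, hc]; exact h.lt_cen u hu
  have hop : P.ord p = u := hp ▸ h.ord_pos u hu
  have hpN : p < N := hp ▸ h.pos_lt u hu
  obtain ⟨hbN, hclw⟩ := h.blk c hcf b hb.ge (by omega)
  rw [← hw] at hclw
  have hwX : w ∈ X := hw ▸ h.ord_mem b hbN
  have hpw : P.pos w = b := hw ▸ h.pos_ord b hbN
  have hcd := h.le d hdf
  have huw : u = w ↔ p = b := by
    constructor
    · intro e; rw [hp, e, hpw]
    · intro e; rw [hw, ← e, hop]
  have hposp : ∀ x ∈ X, P.pos x = p → x = u := fun x hx e => by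
    rw [← h.ord_pos x hx, e, hop]
  have hposb : ∀ x ∈ X, P.pos x = b → x = w := fun x hx e => by
    rw [← h.ord_pos x hx, e, hw]
  have hclu : ∀ x, P.cls x ≠ c → x ≠ u := by
    rintro x hx rfl; exact hx hc.symm
  have hclw' : ∀ x, P.cls x ≠ c → x ≠ w := by
    rintro x hx rfl; exact hx hclw
  have hordp : ∀ i < N, P.ord i = u → i = p := fun i hi e => by
    rw [← h.pos_ord i hi, e, hp]
  have hordw : ∀ i < N, P.ord i = w → i = b := fun i hi e => by
    rw [← h.pos_ord i hi, e, hpw]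
  have hcle : P.cst d ≤ b := hadj ▸ hcd
  rw [hshift]
  refine ⟨⟨⟨?_, ?_, ?_, ?_, ?_, ?_, ?_, ?_, ?_, h.nxt_lt⟩,
      h.start_le, h.name_old, h.name_nxt, ?_, h.nxt_cq, h.parent, h.inj, ?_, h.cls0_lt⟩, ?_⟩
  · intro x hx
    simp only [Function.update_apply]
    split_ifs
    · exact hbN
    · exact hpN
    · exact h.pos_lt x hx
  · intro x hx
    have h1 := hposp x hx
    have h2 := hposb x hx
    have h3 := h.ord_pos x hx
    simp only [Function.update_apply]
    grind
  · intro i hi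
    simp only [Function.update_apply]
    split_ifs
    · exact hu
    · exact hwX
    · exact h.ord_mem i hi
  · intro i hi
    have h1 := hordp i hi
    have h2 := hordw i hi
    have h3 := h.pos_ord i hi
    simp only [Function.update_apply]
    grind
  · intro x hx
    simp only [Function.update_apply]
    split_ifs
    · exact hdf
    · exact h.cls_lt x hx
  · intro x hx
    have h1 := hposp x hx
    have h2 := hposb x hx
    have h3 := h.cst_le x hx
    simp only [Function.update_apply]
    grind
  · intro x hx
    have h1 := hposp x hx
    have h2 := hposb x hx
    have h3 := h.lt_cen x hx
    simp only [Function.update_apply]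
    grind
  · intro e he
    have h1 := h.le e he
    simp only [Function.update_apply]
    grind
  · intro e he i
    have h1 := h.blk e he i
    have h2 := hordp i
    have h3 := hordw i
    simp only [Function.update_apply]
    grind
  · intro e he hne
    simp only at he hne ⊢
    have h1 := h.adj e he hne
    by_cases hec : e = c
    · subst hec
      rw [← hd, Function.update_self, Function.update_self]
    · rw [Function.update_of_ne hec, Function.update_of_ne, h1]
      intro hnd
      refine hec (h.inj e he c hcf ?_)
      have h2 := h.name_nxt e he hne
      rw [hnd, hname] at h2
      ext
      · exact (congrArg Prod.fst h2).symm
      · have := congrArg Prod.snd h2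
        simp only at this
        omega
  · intro x hx
    have h1 := h.name_cls x hx
    simp only [Function.update_apply]
    split_ifs with hxu
    · subst hxu
      rw [hname, hc, h1]
    · exact h1
  · have hqd : P.cq d = P.cq c := by rw [hd]; exact h.nxt_cq c hcf (hd ▸ hn)
    refine ⟨le_rfl, fun _ _ => rfl, ?_, ?_, fun e he => ⟨e, he, rfl⟩⟩
    · intro x hx
      simp only [Function.update_apply]
      grind
    · intro i hi
      simp only [Function.update_apply]
      grind

theorem Mid.move (h : Mid X N start cls0 m nm P) {u : ℕ} (hu : u ∈ X) :
    ∃ nm', Mid X N start cls0 (Function.update m u (m u + 1)) nm' (P.move start u) ∧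
      Ext X N P (P.move start u) := by
  obtain ⟨nm', h1, h2, h3, h4⟩ := h.ensure (h.cls_lt u hu)
  have h2 : start ≤ (P.ensure start (P.cls u)).nxt ((P.ensure start (P.cls u)).cls u) := by
    rwa [h3]
  obtain ⟨h5, h6⟩ := h1.shift hu h2
  exact ⟨nm', h5, h4.trans h6⟩

theorem Mid.moves (h : Mid X N start cls0 m nm P) {l : List ℕ} (hl : ∀ u ∈ l, u ∈ X) :
    ∃ nm', Mid X N start cls0 (fun u => m u + l.count u) nm' (l.foldl (Part.move start) P) ∧
      Ext X N P (l.foldl (Part.move start) P) := by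
  induction l generalizing m nm P with
  | nil => exact ⟨nm, by simpa using h, Ext.refl P⟩
  | cons u l ih =>
    obtain ⟨nm1, h1, e1⟩ := h.move (hl u (by simp))
    obtain ⟨nm2, h2, e2⟩ := ih h1 fun x hx => hl x (by simp [hx])
    refine ⟨nm2, ?_, e1.trans e2⟩
    convert h2 using 1
    swap
    · rfl
    funext x
    by_cases hx : x = u
    · subst hx
      simp only [List.count_cons_self, Function.update_self]
      omega
    · rw [Function.update_of_ne hx, List.count_cons_of_ne (Ne.symm hx)]

/-- The effect of several rounds: vertices stay together if they occur equally often in each of the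
lists. -/
theorem Good.rounds {ls : List (List ℕ)} (h : Good X N P) (hl : ∀ l ∈ ls, ∀ u ∈ l, u ∈ X) :
    Good X N (ls.foldl round P) ∧ Ext X N P (ls.foldl round P) ∧
      (∀ u ∈ X, (ls.foldl round P).cls u = P.cls u ∨ P.fresh ≤ (ls.foldl round P).cls u) ∧
      ∀ u ∈ X, ∀ u' ∈ X, (ls.foldl round P).cls u = (ls.foldl round P).cls u' ↔
        P.cls u = P.cls u' ∧ ∀ l ∈ ls, l.count u = l.count u' := by
  induction ls generalizing P with
  | nil => exact ⟨h, Ext.refl P, fun u _ => .inl rfl, by simp⟩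
  | cons l ls ih =>
    have h0 : Mid X N P.fresh P.cls (fun _ => 0) (fun c => (c, 0)) P :=
      ⟨h, le_rfl, fun _ _ => rfl,
        fun c hc hn => absurd (h.nxt_lt c hc) (by omega),
        fun c hc hn => absurd (h.nxt_lt c hc) (by omega),
        fun c hc hn => absurd (h.nxt_lt c hc) (by omega),
        fun d hd hn => absurd hd (by omega),
        fun c _ c' _ hcc => congrArg Prod.fst hcc, fun _ _ => rfl, h.cls_lt⟩
    obtain ⟨nm, h1, e1⟩ := h0.moves (hl l (by simp))
    change Mid X N P.fresh P.cls _ nm (P.round l) at h1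
    obtain ⟨h2, e2, n2, c2⟩ := ih (P := P.round l) h1.toGood fun l' hl' => hl l' (by simp [hl'])
    have n1 : ∀ u ∈ X, (P.round l).cls u = P.cls u ∨ P.fresh ≤ (P.round l).cls u := by
      intro u hu
      by_contra hcon
      push Not at hcon
      have h3 := h1.name_cls u hu
      rw [h1.name_old _ hcon.2] at h3
      exact hcon.1 (congrArg Prod.fst h3)
    refine ⟨h2, Ext.trans e1 e2, ?_, ?_⟩
    · intro u hu
      have h3 : P.fresh ≤ (P.round l).fresh := e1.fresh_le
      simp only [List.foldl_cons]
      rcases n2 u hu with h4 | h4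
      · rw [h4]
        exact n1 u hu
      · exact .inr (h3.trans h4)
    · intro u hu u' hu'
      simp only [List.foldl_cons]
      rw [c2 u hu u' hu']
      have h3 : (P.round l).cls u = (P.round l).cls u' ↔
          P.cls u = P.cls u' ∧ l.count u = l.count u' := by
        have h4 := h1.name_cls u hu
        have h5 := h1.name_cls u' hu'
        simp only [zero_add] at h4 h5
        rw [← Prod.mk.injEq, ← h4, ← h5]
        exact ⟨fun hh => congrArg nm hh, h1.inj _ (h1.cls_lt u hu) _ (h1.cls_lt u' hu')⟩
      rw [h3]
      simp only [List.mem_cons, forall_eq_or_imp, and_assoc]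

end Part

/-! ### Equitable colorings of labelled graphs -/

/-- The in-edges of a vertex: their sources and labels. Edges are triples of a source, a label and a
target. -/
def inEdges (es : List (ℕ × ℕ × ℕ)) (v : ℕ) : List (ℕ × ℕ) :=
  (es.filter (·.2.2 = v)).map fun e => (e.1, e.2.1)

/-- The sources of the edges with label `ℓ` into the vertices of a list. -/
def sources (es : List (ℕ × ℕ × ℕ)) (l : List ℕ) (ℓ : ℕ) : List ℕ :=
  l.flatMap fun v => ((inEdges es v).filter (·.2 = ℓ)).map (·.1)

open Classical in
/-- The number of edges with label `ℓ` from `u` into the set `Y`. -/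
noncomputable def deg (es : List (ℕ × ℕ × ℕ)) (ℓ : ℕ) (Y : Set ℕ) (u : ℕ) : ℕ :=
  es.countP fun e => e.1 = u ∧ e.2.1 = ℓ ∧ e.2.2 ∈ Y

/-- The coloring `h` of the vertices in `X` respects the lists `ls`, and vertices of the same color
have, for each label, equally many edges into each union of color classes. -/
def Equitable {α : Type} (X : Finset ℕ) (es : List (ℕ × ℕ × ℕ)) (ls : List (List ℕ))
    (h : ℕ → α) : Prop :=
  ∀ u ∈ X, ∀ u' ∈ X, h u = h u' →
    (∀ l ∈ ls, l.count u = l.count u') ∧ ∀ ℓ (Y : Set α), deg es ℓ (h ⁻¹' Y) u = deg es ℓ (h ⁻¹' Y) u'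

variable {X : Finset ℕ} {N : ℕ} {es : List (ℕ × ℕ × ℕ)} {ls : List (List ℕ)}

theorem deg_congr (he : ∀ e ∈ es, e.2.2 ∈ X) {Y Y' : Set ℕ} (h : ∀ v ∈ X, v ∈ Y ↔ v ∈ Y')
    (ℓ u : ℕ) : deg es ℓ Y u = deg es ℓ Y' u := by
  unfold deg
  refine List.countP_congr fun e hm => ?_
  simp only [decide_eq_true_eq, h _ (he e hm)]

theorem deg_union {Y Y' : Set ℕ} (h : Disjoint Y Y') (ℓ u : ℕ) :
    deg es ℓ (Y ∪ Y') u = deg es ℓ Y u + deg es ℓ Y' u := by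
  induction es with
  | nil => simp [deg]
  | cons e es ih =>
    unfold deg at ih ⊢
    have hd : e.2.2 ∈ Y → e.2.2 ∉ Y' := fun h1 h2 => Set.disjoint_left.1 h h1 h2
    simp only [List.countP_cons, ih, decide_eq_true_eq]
    have hm : e.2.2 ∈ Y ∪ Y' ↔ e.2.2 ∈ Y ∨ e.2.2 ∈ Y' := Iff.rfl
    grind

theorem deg_empty (ℓ u : ℕ) : deg es ℓ ∅ u = 0 := by simp [deg]

/-- Edges into a set that is a union of fibres of `f` are counted fibre by fibre. -/
theorem deg_eq_of_fibres (he : ∀ e ∈ es, e.2.2 ∈ X) {f : ℕ → ℕ} {n : ℕ} (hf : ∀ v ∈ X, f v < n)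
    {Y : Set ℕ} (hY : ∀ v ∈ X, ∀ v' ∈ X, f v = f v' → v ∈ Y → v' ∈ Y) {ℓ u u' : ℕ}
    (h : ∀ q < n, deg es ℓ {v | v ∈ X ∧ f v = q} u = deg es ℓ {v | v ∈ X ∧ f v = q} u') :
    deg es ℓ Y u = deg es ℓ Y u' := by
  have key : ∀ k ≤ n, deg es ℓ {v | v ∈ X ∧ f v < k ∧ v ∈ Y} u =
      deg es ℓ {v | v ∈ X ∧ f v < k ∧ v ∈ Y} u' := by
    intro k hk
    induction k with
    | zero => simp [deg_empty]
    | succ k ih =>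
      have hs : {v | v ∈ X ∧ f v < k + 1 ∧ v ∈ Y} =
          {v | v ∈ X ∧ f v < k ∧ v ∈ Y} ∪ {v | v ∈ X ∧ f v = k ∧ v ∈ Y} := by
        ext v
        simp only [Set.mem_ofPred_eq, Set.mem_union, Nat.lt_succ_iff_lt_or_eq]
        tauto
      have hd : Disjoint {v | v ∈ X ∧ f v < k ∧ v ∈ Y} {v | v ∈ X ∧ f v = k ∧ v ∈ Y} := by
        rw [Set.disjoint_left]
        rintro v ⟨_, h1, _⟩ ⟨_, h2, _⟩
        omega
      rw [hs, deg_union hd, deg_union hd, ih (by omega)]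
      congr 1
      by_cases hv : ∃ v ∈ X, f v = k ∧ v ∈ Y
      · obtain ⟨v, h1, h2, h3⟩ := hv
        have : {v | v ∈ X ∧ f v = k ∧ v ∈ Y} = {v | v ∈ X ∧ f v = k} := by
          ext x
          simp only [Set.mem_ofPred_eq]
          exact ⟨fun h => ⟨h.1, h.2.1⟩, fun h => ⟨h.1, h.2, hY v h1 x h.1 (h2.trans h.2.symm) h3⟩⟩
        rw [this]
        exact h k (by omega)
      · have : {v | v ∈ X ∧ f v = k ∧ v ∈ Y} = ∅ := by
          ext x
          simp only [Set.mem_ofPred_eq, Set.mem_empty_iff_false, iff_false]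
          exact fun h => hv ⟨x, h⟩
        rw [this, deg_empty, deg_empty]
  have h2 : ∀ w, deg es ℓ Y w = deg es ℓ {v | v ∈ X ∧ f v < n ∧ v ∈ Y} w := by
    refine fun w => deg_congr he (fun v hv => ?_) ℓ w
    simp only [Set.mem_ofPred_eq, hv, hf v hv, true_and]
  rw [h2, h2, key n le_rfl]

theorem count_sources {l : List ℕ} (hl : l.Nodup) (ℓ u : ℕ) :
    (sources es l ℓ).count u = deg es ℓ {v | v ∈ l} u := by
  induction l with
  | nil => simp [sources, deg]
  | cons v l ih =>
    have hs : {x | x ∈ v :: l} = {v} ∪ {x | x ∈ l} := by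
      ext x; simp
    have hd : Disjoint ({v} : Set ℕ) {x | x ∈ l} := by
      rw [Set.disjoint_left]
      rintro x hx h1
      rw [Set.mem_singleton_iff.1 hx] at h1
      exact (List.nodup_cons.1 hl).1 h1
    rw [hs, deg_union hd, ← ih (List.nodup_cons.1 hl).2]
    unfold sources deg inEdges
    rw [List.flatMap_cons, List.count_append]
    congr 1
    rw [List.count_eq_countP, List.countP_map, List.countP_filter, List.countP_map,
      List.countP_filter]
    refine List.countP_congr fun e _ => ?_
    simp only [Function.comp, beq_iff_eq, decide_eq_true_eq, Bool.and_eq_true, Set.mem_singleton_iff]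
    tauto

theorem sources_subset (he : ∀ e ∈ es, e.1 ∈ X) (l : List ℕ) (ℓ : ℕ) :
    ∀ u ∈ sources es l ℓ, u ∈ X := by
  intro u hu
  simp only [sources, inEdges, List.mem_flatMap, List.mem_map, List.mem_filter] at hu
  obtain ⟨v, _, p, ⟨⟨e, ⟨h1, _⟩, rfl⟩, _⟩, rfl⟩ := hu
  exact he e h1

/-! ### Refinement against a coarser partition -/

/-- The state of the refinement algorithm: a partition, and the coarser partition into blocks; the
block `q` occupies the positions from `qlo q` to `qhi q - 1`. -/
structure Blocks where
  P : Part
  qlo : ℕ → ℕ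
  qhi : ℕ → ℕ
  qf : ℕ

/-- The vertices of the class `c`, in their order. -/
def Part.members (P : Part) (c : ℕ) : List ℕ :=
  (List.range' (P.cst c) (P.cen c - P.cst c)).map P.ord

/-- One round for each label, moving the sources of the edges into the listed vertices. -/
def Part.refine (es : List (ℕ × ℕ × ℕ)) (nl : ℕ) (P : Part) (l : List ℕ) : Part :=
  ((List.range nl).map (sources es l)).foldl Part.round P

/-- Splits off the class `c` from the block `q`, of which `[lo, hi)` remains, and refines the
partition with respect to `c`. -/
def Blocks.split (es : List (ℕ × ℕ × ℕ)) (nl : ℕ) (S : Blocks) (c q lo hi : ℕ) : Blocks where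
  P := Part.refine es nl { S.P with cq := Function.update S.P.cq c S.qf } (S.P.members c)
  qlo := Function.update (Function.update S.qlo q lo) S.qf (S.P.cst c)
  qhi := Function.update (Function.update S.qhi q hi) S.qf (S.P.cen c)
  qf := S.qf + 1

/-- The block of a vertex. -/
def Blocks.blockOf (S : Blocks) (u : ℕ) : ℕ := S.P.cq (S.P.cls u)

/-- The invariant of the refinement algorithm. The partition is stable with respect to the blocks,
and it is not finer than any equitable coloring. -/
structure Blocks.Inv (X : Finset ℕ) (N : ℕ) (es : List (ℕ × ℕ × ℕ)) (ls : List (List ℕ))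
    (S : Blocks) : Prop where
  good : S.P.Good X N
  cq_lt : ∀ c < S.P.fresh, S.P.cq c < S.qf
  mem : ∀ u ∈ X, S.qlo (S.blockOf u) ≤ S.P.pos u ∧ S.P.pos u < S.qhi (S.blockOf u)
  blk : ∀ q < S.qf, ∀ i, S.qlo q ≤ i → i < S.qhi q → i < N ∧ S.blockOf (S.P.ord i) = q
  lt : ∀ q < S.qf, S.qlo q < S.qhi q
  init : ∀ u ∈ X, ∀ u' ∈ X, S.P.cls u = S.P.cls u' → ∀ l ∈ ls, l.count u = l.count u'
  stable : ∀ u ∈ X, ∀ u' ∈ X, S.P.cls u = S.P.cls u' → ∀ ℓ, ∀ q < S.qf,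
    deg es ℓ {v | v ∈ X ∧ S.blockOf v = q} u = deg es ℓ {v | v ∈ X ∧ S.blockOf v = q} u'
  coarse : ∀ {α : Type} (h : ℕ → α), Equitable X es ls h → ∀ u ∈ X, ∀ u' ∈ X, h u = h u' →
    S.P.cls u = S.P.cls u'

/-- The block `q` contains only one class. -/
def Blocks.Simple (X : Finset ℕ) (S : Blocks) (q : ℕ) : Prop :=
  ∀ u ∈ X, ∀ u' ∈ X, S.blockOf u = q → S.blockOf u' = q → S.P.cls u = S.P.cls u'

/-- The block `q` contains a class with number `w` or above. -/
def Blocks.Pending (w : ℕ) (S : Blocks) (q : ℕ) : Prop := ∃ c, w ≤ c ∧ c < S.P.fresh ∧ S.P.cq c = q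

/-- The weight of a vertex: the costs of having it in a class that is split off. -/
def weight (es : List (ℕ × ℕ × ℕ)) (v : ℕ) : ℕ := 1 + (inEdges es v).length

/-- The potential of the refinement algorithm: each vertex can be split off as often as the size of
its block can be halved. -/
def Blocks.pot (X : Finset ℕ) (es : List (ℕ × ℕ × ℕ)) (S : Blocks) : ℕ :=
  ∑ v ∈ X, weight es v * Nat.log 2 (S.qhi (S.blockOf v) - S.qlo (S.blockOf v))

theorem Part.Good.members_nodup {P : Part} (h : P.Good X N) {c : ℕ} (hc : c < P.fresh) :
    (P.members c).Nodup := by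
  refine List.Nodup.map_on ?_ List.nodup_range'
  intro i hi j hj hij
  simp only [List.mem_range'_1] at hi hj
  have h1 := h.blk c hc i hi.1 (by omega)
  have h2 := h.blk c hc j hj.1 (by omega)
  rw [← h.pos_ord i h1.1, ← h.pos_ord j h2.1, hij]

theorem Part.Good.mem_members {P : Part} (h : P.Good X N) {c : ℕ} (hc : c < P.fresh) (v : ℕ) :
    v ∈ P.members c ↔ v ∈ X ∧ P.cls v = c := by
  simp only [Part.members, List.mem_map, List.mem_range'_1]
  constructor
  · rintro ⟨i, hi, rfl⟩
    have h1 := h.blk c hc i hi.1 (by omega)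
    exact ⟨h.ord_mem i h1.1, h1.2⟩
  · rintro ⟨h1, rfl⟩
    have h2 := h.cst_le v h1
    have h3 := h.lt_cen v h1
    exact ⟨P.pos v, ⟨h2, by omega⟩, h.ord_pos v h1⟩

theorem Part.Good.refine {P : Part} (h : P.Good X N) {nl : ℕ}
    (he : ∀ e ∈ es, e.1 ∈ X ∧ e.2.1 < nl ∧ e.2.2 ∈ X) {l : List ℕ} (hl : l.Nodup) :
    (P.refine es nl l).Good X N ∧ Part.Ext X N P (P.refine es nl l) ∧
      (∀ u ∈ X, (P.refine es nl l).cls u = P.cls u ∨ P.fresh ≤ (P.refine es nl l).cls u) ∧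
      ∀ u ∈ X, ∀ u' ∈ X, (P.refine es nl l).cls u = (P.refine es nl l).cls u' ↔
        P.cls u = P.cls u' ∧ ∀ ℓ, deg es ℓ {v | v ∈ l} u = deg es ℓ {v | v ∈ l} u' := by
  obtain ⟨h1, h2, h3, h4⟩ := h.rounds (ls := (List.range nl).map (sources es l)) (by
    intro l' hl'
    obtain ⟨ℓ, _, rfl⟩ := List.mem_map.1 hl'
    exact sources_subset (fun e hm => (he e hm).1) l ℓ)
  refine ⟨h1, h2, h3, fun u hu u' hu' => (h4 u hu u' hu').trans ?_⟩
  refine and_congr_right fun _ => ?_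
  simp only [List.mem_map, List.mem_range, forall_exists_index, and_imp,
    forall_apply_eq_imp_iff₂, count_sources hl]
  refine ⟨fun hh ℓ => ?_, fun hh ℓ _ => hh ℓ⟩
  by_cases hℓ : ℓ < nl
  · exact hh ℓ hℓ
  · have hz : ∀ w, deg es ℓ {v | v ∈ l} w = 0 := by
      intro w
      unfold deg
      rw [List.countP_eq_zero]
      intro e hm
      have := (he e hm).2.1
      simp only [decide_eq_true_eq, not_and]
      intro _ h5
      omega
    rw [hz, hz]

/-- The invariant of blocks is preserved by refinement. -/
theorem Part.Ext.blocks {S S' : Blocks} (hS : S'.P.Good X N) (hG : S.P.Good X N)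
    (h : Part.Ext X N S.P S'.P)
    (hlo : S'.qlo = S.qlo) (hhi : S'.qhi = S.qhi) (hqf : S'.qf = S.qf)
    (cq_lt : ∀ c < S.P.fresh, S.P.cq c < S.qf)
    (mem : ∀ u ∈ X, S.qlo (S.blockOf u) ≤ S.P.pos u ∧ S.P.pos u < S.qhi (S.blockOf u))
    (blk : ∀ q < S.qf, ∀ i, S.qlo q ≤ i → i < S.qhi q → i < N ∧ S.blockOf (S.P.ord i) = q) :
    (∀ c < S'.P.fresh, S'.P.cq c < S'.qf) ∧
    (∀ u ∈ X, S'.qlo (S'.blockOf u) ≤ S'.P.pos u ∧ S'.P.pos u < S'.qhi (S'.blockOf u)) ∧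
    ∀ q < S'.qf, ∀ i, S'.qlo q ≤ i → i < S'.qhi q → i < N ∧ S'.blockOf (S'.P.ord i) = q := by
  have hq : ∀ i < N, S'.blockOf (S'.P.ord i) = S.blockOf (S.P.ord i) := h.qord
  refine ⟨?_, ?_, ?_⟩
  · intro c hc
    obtain ⟨c', h1, h2⟩ := h.cq_new c hc
    rw [h2, hqf]
    exact cq_lt c' h1
  · intro u hu
    have h1 := hq _ (hS.pos_lt u hu)
    rw [hS.ord_pos u hu] at h1
    have h2 := mem _ (hG.ord_mem _ (hS.pos_lt u hu))
    rw [hG.pos_ord _ (hS.pos_lt u hu), ← h1] at h2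
    rw [hlo, hhi]
    exact h2
  · intro q hqq i h1 h2
    rw [hlo] at h1
    rw [hhi] at h2
    rw [hqf] at hqq
    obtain ⟨h3, h4⟩ := blk q hqq i h1 h2
    exact ⟨h3, (hq i h3).trans h4⟩

/-- A class that is a union of color classes of an equitable coloring is respected by it. -/
theorem Equitable.deg_class {α : Type} {h : ℕ → α} (hh : Equitable X es ls h)
    (he : ∀ e ∈ es, e.2.2 ∈ X) {Y : Set ℕ}
    (hY : ∀ v ∈ X, ∀ v' ∈ X, h v = h v' → v ∈ Y → v' ∈ Y) {u u' : ℕ} (hu : u ∈ X)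
    (hu' : u' ∈ X) (huu : h u = h u') (ℓ : ℕ) : deg es ℓ Y u = deg es ℓ Y u' := by
  have h1 := (hh u hu u' hu' huu).2 ℓ (h '' {v | v ∈ X ∧ v ∈ Y})
  have h2 : ∀ w, deg es ℓ Y w = deg es ℓ (h ⁻¹' (h '' {v | v ∈ X ∧ v ∈ Y})) w := by
    refine fun w => deg_congr he (fun v hv => ?_) ℓ w
    simp only [Set.mem_preimage, Set.mem_image, Set.mem_ofPred_eq]
    refine ⟨fun h3 => ⟨v, ⟨hv, h3⟩, rfl⟩, ?_⟩
    rintro ⟨v', ⟨h3, h4⟩, h5⟩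
    exact hY v' h3 v hv h5 h4
  rw [h2, h2, h1]

section split

variable {S : Blocks} {c q lo hi nl : ℕ}

/-- What remains of the block `q`, and the class `c` that is split off, are intervals that partition
the block. -/
structure Blocks.SplitsInto (S : Blocks) (c q lo hi : ℕ) : Prop where
  q_lt : q < S.qf
  c_lt : c < S.P.fresh
  cq : S.P.cq c = q
  ne : S.P.cst c < S.P.cen c
  lt : lo < hi
  iff : ∀ i, (lo ≤ i ∧ i < hi) ↔
    (S.qlo q ≤ i ∧ i < S.qhi q) ∧ ¬ (S.P.cst c ≤ i ∧ i < S.P.cen c)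
  half : 2 * (S.P.cen c - S.P.cst c) ≤ S.qhi q - S.qlo q
  len : hi - lo ≤ S.qhi q - S.qlo q

theorem Blocks.split_blockOf (h : S.Inv X N es ls) (hs : S.SplitsInto c q lo hi)
    (he : ∀ e ∈ es, e.1 ∈ X ∧ e.2.1 < nl ∧ e.2.2 ∈ X) {u : ℕ} (hu : u ∈ X) :
    (S.split es nl c q lo hi).blockOf u = if S.P.cls u = c then S.qf else S.blockOf u := by
  have hG : Part.Good X N { S.P with cq := Function.update S.P.cq c S.qf } := ⟨h.good.pos_lt,
    h.good.ord_pos, h.good.ord_mem, h.good.pos_ord, h.good.cls_lt, h.good.cst_le, h.good.lt_cen,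
    h.good.le, h.good.blk, h.good.nxt_lt⟩
  have h1 := (hG.refine he (h.good.members_nodup hs.c_lt)).2.1.qcls u hu
  refine h1.trans ?_
  simp only [Function.update_apply, Blocks.blockOf]

theorem Blocks.Inv.split (h : S.Inv X N es ls) (hs : S.SplitsInto c q lo hi)
    (he : ∀ e ∈ es, e.1 ∈ X ∧ e.2.1 < nl ∧ e.2.2 ∈ X) :
    (S.split es nl c q lo hi).Inv X N es ls := by
  have hG : Part.Good X N { S.P with cq := Function.update S.P.cq c S.qf } := ⟨h.good.pos_lt,
    h.good.ord_pos, h.good.ord_mem, h.good.pos_ord, h.good.cls_lt, h.good.cst_le, h.good.lt_cen,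
    h.good.le, h.good.blk, h.good.nxt_lt⟩
  obtain ⟨g1, g2, g3, g4⟩ := hG.refine he (h.good.members_nodup hs.c_lt)
  have hmem : ∀ w, w ∈ S.P.members c ↔ w ∈ X ∧ S.P.cls w = c := h.good.mem_members hs.c_lt
  have hblock : ∀ u ∈ X, (S.split es nl c q lo hi).blockOf u =
    if S.P.cls u = c then S.qf else S.blockOf u := fun u hu => split_blockOf h hs he hu
  have hbl : ∀ u ∈ X, S.blockOf u < S.qf := fun u hu => h.cq_lt _ (h.good.cls_lt u hu)
  have hci : ∀ i, S.P.cst c ≤ i ∧ i < S.P.cen c → S.qlo q ≤ i ∧ i < S.qhi q := by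
    intro i hi
    obtain ⟨h1, h2⟩ := h.good.blk c hs.c_lt i hi.1 hi.2
    have h3 := h.mem _ (h.good.ord_mem i h1)
    rw [h.good.pos_ord i h1, Blocks.blockOf, h2, hs.cq] at h3
    exact h3
  have hcpos : ∀ u ∈ X, S.P.cls u = c ↔ (S.P.cst c ≤ S.P.pos u ∧ S.P.pos u < S.P.cen c) := by
    intro u hu
    constructor
    · rintro rfl
      exact ⟨h.good.cst_le u hu, h.good.lt_cen u hu⟩
    · rintro ⟨h1, h2⟩
      have := (h.good.blk c hs.c_lt _ h1 h2).2
      rwa [h.good.ord_pos u hu] at this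
  obtain ⟨b1, b2, b3⟩ := Part.Ext.blocks (X := X) (N := N)
    (S := ⟨{ S.P with cq := Function.update S.P.cq c S.qf },
      Function.update (Function.update S.qlo q lo) S.qf (S.P.cst c),
      Function.update (Function.update S.qhi q hi) S.qf (S.P.cen c), S.qf + 1⟩)
    (S' := S.split es nl c q lo hi) g1 hG g2 rfl rfl rfl
    (by
      intro c' hc'
      simp only [Function.update_apply]
      split_ifs
      · omega
      · have := h.cq_lt c' hc'; omega)
    (by
      intro u hu
      have h1 := h.mem u hu
      have h2 := hcpos u hu
      have h3 := hs.iff (S.P.pos u)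
      have h4 := hbl u hu
      have h5 : S.P.cls u = c → S.blockOf u = q := by
        rintro rfl; exact hs.cq
      simp only [Blocks.blockOf, Function.update_apply] at h1 h4 h5 ⊢
      by_cases h6 : S.P.cls u = c
      · simpa only [h6, if_true] using h2.1 h6
      · simp only [h6, if_false, h4.ne]
        split_ifs with h7
        · rw [h7] at h1
          exact h3.2 ⟨h1, fun h8 => h6 (h2.2 h8)⟩
        · exact h1)
    (by
      intro q' hq' i h1 h2
      simp only [Blocks.blockOf, Function.update_apply] at h1 h2 ⊢
      have h3 := hs.iff i
      split_ifs at h1 h2 with h4 h5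
      · obtain ⟨h6, h7⟩ := h.good.blk c hs.c_lt i h1 h2
        exact ⟨h6, by rw [if_pos h7, h4]⟩
      · have h6 := h3.1 ⟨h1, h2⟩
        obtain ⟨h7, h8⟩ := h.blk q hs.q_lt i h6.1.1 h6.1.2
        refine ⟨h7, ?_⟩
        rw [if_neg, h5]
        · exact h8
        · intro h9
          have h10 := (hcpos _ (h.good.ord_mem i h7)).1 h9
          rw [h.good.pos_ord i h7] at h10
          exact h6.2 h10
      · obtain ⟨h7, h8⟩ := h.blk q' (by simp only at hq'; omega) i h1 h2
        refine ⟨h7, ?_⟩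
        rw [if_neg]
        · exact h8
        · intro h9
          have : S.blockOf (S.P.ord i) = q := by rw [Blocks.blockOf, h9, hs.cq]
          exact h5 (by rw [← h8, this]))
  have hcls : ∀ u ∈ X, ∀ u' ∈ X, (S.split es nl c q lo hi).P.cls u =
      (S.split es nl c q lo hi).P.cls u' ↔ S.P.cls u = S.P.cls u' ∧
        ∀ ℓ, deg es ℓ {v | v ∈ S.P.members c} u = deg es ℓ {v | v ∈ S.P.members c} u' := g4
  refine ⟨g1, b1, b2, b3, ?_, ?_, ?_, ?_⟩
  · intro q' hq'
    simp only [Blocks.split, Function.update_apply] at hq' ⊢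
    split_ifs with h1 h2
    · exact hs.ne
    · exact hs.lt
    · exact h.lt q' (by omega)
  · intro u hu u' hu' huu
    exact h.init u hu u' hu' ((hcls u hu u' hu').1 huu).1
  · intro u hu u' hu' huu ℓ q' hq'
    obtain ⟨h1, h2⟩ := (hcls u hu u' hu').1 huu
    have h3 := h.stable u hu u' hu' h1 ℓ
    simp only [Blocks.split] at hq'
    by_cases hqf : q' = S.qf
    · have hset : ∀ w, deg es ℓ {v | v ∈ X ∧ (S.split es nl c q lo hi).blockOf v = q'} w =
          deg es ℓ {v | v ∈ S.P.members c} w := by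
        refine fun w => deg_congr (fun e hm => (he e hm).2.2) (fun v hv => ?_) ℓ w
        have h4 := hbl v hv
        simp only [Set.mem_ofPred_eq, hmem, hv, true_and, hblock v hv]
        split_ifs with h5
        · simp [h5, hqf]
        · simp only [h5, iff_false]; omega
      rw [hset, hset, h2 ℓ]
    · by_cases hqq : q' = q
      · have hset : ∀ w, deg es ℓ {v | v ∈ X ∧ S.blockOf v = q} w =
            deg es ℓ {v | v ∈ X ∧ (S.split es nl c q lo hi).blockOf v = q'} w +
            deg es ℓ {v | v ∈ S.P.members c} w := by
          intro w
          rw [← deg_union]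
          · refine deg_congr (fun e hm => (he e hm).2.2) (fun v hv => ?_) ℓ w
            simp only [Set.mem_ofPred_eq, Set.mem_union, hmem, hv, true_and, hblock v hv]
            have h5 : S.P.cls v = c → S.blockOf v = q := by
              rintro rfl; exact hs.cq
            split_ifs with h6
            · simp [h6, h5 h6]
            · simp [h6, hqq]
          · rw [Set.disjoint_left]
            rintro v ⟨hv, h4⟩ h5
            rw [hblock v hv, if_pos ((hmem v).1 h5).2] at h4
            exact hqf h4.symm
        have h4 := h3 q hs.q_lt
        rw [hset, hset, h2 ℓ] at h4
        omega
      · have hset : ∀ w, deg es ℓ {v | v ∈ X ∧ (S.split es nl c q lo hi).blockOf v = q'} w =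
            deg es ℓ {v | v ∈ X ∧ S.blockOf v = q'} w := by
          refine fun w => deg_congr (fun e hm => (he e hm).2.2) (fun v hv => ?_) ℓ w
          have h5 : S.P.cls v = c → S.blockOf v = q := by
            rintro rfl; exact hs.cq
          simp only [Set.mem_ofPred_eq, hv, true_and, hblock v hv]
          split_ifs with h6
          · rw [h5 h6]
            exact ⟨fun h7 => absurd h7.symm hqf, fun h7 => absurd h7.symm hqq⟩
          · rfl
        rw [hset, hset]
        exact h3 q' (by omega)
  · intro α col hcol u hu u' hu' huu
    refine (hcls u hu u' hu').2 ⟨h.coarse col hcol u hu u' hu' huu, fun ℓ => ?_⟩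
    refine hcol.deg_class (fun e hm => (he e hm).2.2) (fun v hv v' hv' hvv h1 => ?_) hu hu' huu ℓ
    simp only [Set.mem_ofPred_eq, hmem] at h1 ⊢
    exact ⟨hv', (h.coarse col hcol v hv v' hv' hvv).symm.trans h1.2⟩

/-- After a split, blocks other than `q` that contain several classes contain a class that still
awaits its processing. -/
theorem Blocks.split_pending (h : S.Inv X N es ls) (hs : S.SplitsInto c q lo hi)
    (he : ∀ e ∈ es, e.1 ∈ X ∧ e.2.1 < nl ∧ e.2.2 ∈ X) {w : ℕ} (hw : w ≤ S.P.fresh)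
    (hp : ∀ q' < S.qf, q' ≠ q → S.Simple X q' ∨ S.Pending w q') {q' : ℕ}
    (hq' : q' < S.qf + 1) (hne : q' ≠ q) :
    (S.split es nl c q lo hi).Simple X q' ∨ (S.split es nl c q lo hi).Pending w q' := by
  have hG : Part.Good X N { S.P with cq := Function.update S.P.cq c S.qf } := ⟨h.good.pos_lt,
    h.good.ord_pos, h.good.ord_mem, h.good.pos_ord, h.good.cls_lt, h.good.cst_le, h.good.lt_cen,
    h.good.le, h.good.blk, h.good.nxt_lt⟩
  obtain ⟨g1, g2, g3, g4⟩ := hG.refine he (h.good.members_nodup hs.c_lt)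
  have hblock : ∀ u ∈ X, (S.split es nl c q lo hi).blockOf u =
    if S.P.cls u = c then S.qf else S.blockOf u := fun u hu => split_blockOf h hs he hu
  -- a block that was simple and is not any more contains a new class
  have key : (∀ u ∈ X, ∀ u' ∈ X, (S.split es nl c q lo hi).blockOf u = q' →
      (S.split es nl c q lo hi).blockOf u' = q' → S.P.cls u = S.P.cls u') →
      (S.split es nl c q lo hi).Simple X q' ∨ (S.split es nl c q lo hi).Pending w q' := by
    intro hold
    by_cases hsim : (S.split es nl c q lo hi).Simple X q'
    · exact .inl hsim
    refine .inr ?_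
    unfold Blocks.Simple at hsim
    push Not at hsim
    obtain ⟨u, hu, u', hu', h1, h2, h3⟩ := hsim
    have h4 := hold u hu u' hu' h1 h2
    rcases g3 u hu with h5 | h5
    · rcases g3 u' hu' with h6 | h6
      · exact absurd (h5.trans (h4.trans h6.symm)) h3
      · exact ⟨_, hw.trans h6, g1.cls_lt u' hu', h2⟩
    · exact ⟨_, hw.trans h5, g1.cls_lt u hu, h1⟩
  by_cases hqf : q' = S.qf
  · refine key fun u hu u' hu' h1 h2 => ?_
    have h3 : ∀ x ∈ X, (S.split es nl c q lo hi).blockOf x = q' → S.P.cls x = c := by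
      intro x hx h4
      by_contra h5
      rw [hblock x hx, if_neg h5] at h4
      have : S.blockOf x < S.qf := h.cq_lt _ (h.good.cls_lt x hx)
      omega
    rw [h3 u hu h1, h3 u' hu' h2]
  · rcases hp q' (by omega) hne with hsim | ⟨d, h1, h2, h3⟩
    · refine key fun u hu u' hu' h1 h2 => ?_
      have h3 : ∀ x ∈ X, (S.split es nl c q lo hi).blockOf x = q' → S.blockOf x = q' := by
        intro x hx h4
        rw [hblock x hx] at h4
        split_ifs at h4 with h5
        · exact absurd h4.symm hqf
        · exact h4
      exact hsim u hu u' hu' (h3 u hu h1) (h3 u' hu' h2)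
    · refine .inr ⟨d, h1, h2.trans_le g2.fresh_le, ?_⟩
      have h4 := g2.cq_eq d h2
      have hdc : d ≠ c := by
        rintro rfl
        exact hne (h3.symm.trans hs.cq)
      simp only [Function.update_of_ne hdc] at h4
      exact h4.trans h3

/-- The potential pays for the vertices of the class that is split off. -/
theorem Blocks.split_pot (h : S.Inv X N es ls) (hs : S.SplitsInto c q lo hi)
    (he : ∀ e ∈ es, e.1 ∈ X ∧ e.2.1 < nl ∧ e.2.2 ∈ X) :
    (S.split es nl c q lo hi).pot X es + ((S.P.members c).map (weight es)).sum ≤ S.pot X es := by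
  have h1 : ((S.P.members c).map (weight es)).sum =
      ∑ v ∈ X, if S.P.cls v = c then weight es v else 0 := by
    rw [← Finset.sum_filter, ← List.sum_toFinset _ (h.good.members_nodup hs.c_lt)]
    congr 1
    ext v
    simp [h.good.mem_members hs.c_lt]
  rw [h1, Blocks.pot, Blocks.pot, ← Finset.sum_add_distrib]
  refine Finset.sum_le_sum fun v hv => ?_
  have hb : S.blockOf v < S.qf := h.cq_lt _ (h.good.cls_lt v hv)
  rw [split_blockOf h hs he hv]
  by_cases hc : S.P.cls v = c
  · have hq : S.blockOf v = q := by rw [Blocks.blockOf, hc, hs.cq]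
    rw [if_pos hc, if_pos hc]
    simp only [Blocks.split, Function.update_self, hq]
    have h2 := hs.ne
    have h3 : Nat.log 2 (2 * (S.P.cen c - S.P.cst c)) = Nat.log 2 (S.P.cen c - S.P.cst c) + 1 := by
      rw [mul_comm]
      exact Nat.log_mul_base (by omega) (by omega)
    have h4 := Nat.log_mono_right (b := 2) hs.half
    rw [h3] at h4
    calc _ = weight es v * (Nat.log 2 (S.P.cen c - S.P.cst c) + 1) := by ring
      _ ≤ _ := Nat.mul_le_mul_left _ h4
  · rw [if_neg hc, if_neg hc, add_zero]
    refine Nat.mul_le_mul_left _ (Nat.log_mono_right ?_)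
    simp only [Blocks.split, Function.update_of_ne hb.ne]
    by_cases hq : S.blockOf v = q
    · rw [hq, Function.update_self, Function.update_self]
      exact hs.len
    · rw [Function.update_of_ne hq, Function.update_of_ne hq]

end split

/-- When every block is a single class, the partition is an equitable coloring. -/
theorem Blocks.Inv.equitable {S : Blocks} (h : S.Inv X N es ls) (he : ∀ e ∈ es, e.2.2 ∈ X)
    (hs : ∀ q < S.qf, S.Simple X q) : Equitable X es ls S.P.cls := by
  intro u hu u' hu' huu
  refine ⟨h.init u hu u' hu' huu, fun ℓ Y => ?_⟩
  have hbl : ∀ u ∈ X, S.blockOf u < S.qf := fun u hu => h.cq_lt _ (h.good.cls_lt u hu)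
  refine deg_eq_of_fibres he hbl ?_ fun q hq => h.stable u hu u' hu' huu ℓ q hq
  intro v hv v' hv' hvv hY
  have := hs _ (hbl v hv) v hv v' hv' rfl hvv.symm
  simpa only [Set.mem_preimage, ← this] using hY

/-- The state before the first split: one block, and a partition that has been refined with respect
to the given lists and to the edges into all vertices. -/
theorem Blocks.inv_start {P : Part} {l : List ℕ} {nl : ℕ} (h : P.Good X N) (hN : 0 < N)
    (hcls : ∀ u ∈ X, P.cls u = 0) (hfresh : P.fresh = 1) (hcq : P.cq 0 = 0)
    (hls : ∀ l ∈ ls, ∀ u ∈ l, u ∈ X) (hl : l.Nodup) (hlX : ∀ v, v ∈ l ↔ v ∈ X)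
    (he : ∀ e ∈ es, e.1 ∈ X ∧ e.2.1 < nl ∧ e.2.2 ∈ X) {qlo qhi : ℕ → ℕ} (hlo : qlo 0 = 0)
    (hhi : qhi 0 = N) :
    (Blocks.mk ((ls.foldl Part.round P).refine es nl l) qlo qhi 1).Inv X N es ls := by
  obtain ⟨g1, g2, g3, g4⟩ := h.rounds hls
  obtain ⟨k1, k2, k3, k4⟩ := g1.refine he hl
  have hb0 : ∀ u ∈ X, (Blocks.mk P qlo qhi 1).blockOf u = 0 := fun u hu => by
    simp [Blocks.blockOf, hcls u hu, hcq]
  obtain ⟨b1, b2, b3⟩ := Part.Ext.blocks (X := X) (N := N) (S := ⟨P, qlo, qhi, 1⟩)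
    (S' := ⟨(ls.foldl Part.round P).refine es nl l, qlo, qhi, 1⟩) k1 h (g2.trans k2) rfl rfl rfl
    (by
      intro c hc
      simp only at hc ⊢
      have : c = 0 := by omega
      subst this
      omega)
    (by
      intro u hu
      have := h.pos_lt u hu
      rw [hb0 u hu]
      simp only [hlo, hhi]
      omega)
    (by
      intro q hq i h1 h2
      have : q = 0 := by simp only at hq; omega
      subst this
      simp only [hhi] at h2
      exact ⟨h2, hb0 _ (h.ord_mem i h2)⟩)
  have hcl : ∀ u ∈ X, ∀ u' ∈ X, ((ls.foldl Part.round P).refine es nl l).cls u =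
      ((ls.foldl Part.round P).refine es nl l).cls u' ↔
      (∀ l ∈ ls, l.count u = l.count u') ∧
        ∀ ℓ, deg es ℓ {v | v ∈ l} u = deg es ℓ {v | v ∈ l} u' := by
    intro u hu u' hu'
    rw [k4 u hu u' hu', g4 u hu u' hu', hcls u hu, hcls u' hu']
    simp
  refine ⟨k1, b1, b2, b3, ?_, ?_, ?_, ?_⟩
  · intro q hq
    have : q = 0 := by simp only at hq; omega
    subst this
    simp only [hlo, hhi]
    exact hN
  · intro u hu u' hu' huu
    exact ((hcl u hu u' hu').1 huu).1
  · intro u hu u' hu' huu ℓ q hq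
    have h1 := ((hcl u hu u' hu').1 huu).2 ℓ
    have hset : ∀ w, deg es ℓ {v | v ∈ X ∧ Blocks.blockOf
        ⟨(ls.foldl Part.round P).refine es nl l, qlo, qhi, 1⟩ v = q} w =
        deg es ℓ {v | v ∈ l} w := by
      refine fun w => deg_congr (fun e hm => (he e hm).2.2) (fun v hv => ?_) ℓ w
      have h2 : Blocks.blockOf ⟨(ls.foldl Part.round P).refine es nl l, qlo, qhi, 1⟩ v = 0 :=
        ((g2.trans k2).qcls v hv).trans (hb0 v hv)
      simp only [Set.mem_ofPred_eq, h2, hlX, hv, true_and, iff_true]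
      simp only at hq
      omega
    rw [hset, hset, h1]
  · intro α col hcol u hu u' hu' huu
    refine (hcl u hu u' hu').2 ⟨(hcol u hu u' hu' huu).1, fun ℓ => ?_⟩
    refine hcol.deg_class (fun e hm => (he e hm).2.2) (fun v hv v' hv' hvv h1 => ?_) hu hu' huu ℓ
    simpa only [Set.mem_ofPred_eq, hlX] using hv'

/-! ### Numerical codes of tuples -/

/-- The vertex that stands for a list of numbers below `n`, in base `n + 1`. The digit `0` is not
used, so that lists of different lengths have different keys. -/
def key (n : ℕ) (l : List ℕ) : ℕ := Nat.ofDigits (n + 1) (l.map (· + 1))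

theorem key_inj {n : ℕ} {l l' : List ℕ} (hl : ∀ x ∈ l, x < n) (hl' : ∀ x ∈ l', x < n)
    (h : key n l = key n l') : l = l' := by
  rcases Nat.eq_zero_or_pos n with rfl | hn
  · have h1 : ∀ m : List ℕ, (∀ x ∈ m, x < 0) → m = [] := fun m hm =>
      List.eq_nil_iff_forall_not_mem.2 fun x hx => by simpa using hm x hx
    rw [h1 l hl, h1 l' hl']
  have key : ∀ m : List ℕ, (∀ x ∈ m, x < n) → Nat.digits (n + 1) (key n m) = m.map (· + 1) := by
    intro m hm
    refine Nat.digits_ofDigits _ (by omega) _ ?_ ?_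
    · simp only [List.mem_map, forall_exists_index, and_imp, forall_apply_eq_imp_iff₂]
      intro x hx
      have := hm x hx
      omega
    · intro hne
      have := List.getLast_mem hne
      simp only [List.mem_map] at this
      obtain ⟨x, _, hx⟩ := this
      omega
  have h2 := key l hl
  rw [h, key l' hl'] at h2
  exact (List.map_injective_iff.2 (add_left_injective 1) h2).symm

/-- The entries of `a` at the positions in `f`. -/
def slice (a f : List ℕ) : List ℕ := f.map fun i => a.getD i 0

/-- The lists of length `K` of numbers below `m`, for `m ≤ K`: the positions from which a slice of
a tuple of arity `m` can take its entries. -/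
noncomputable def indexLists (K m : ℕ) : List (List ℕ) :=
  (((Finset.univ : Finset (Fin K → Fin K)).toList.map fun f => List.ofFn fun i => (f i : ℕ)).filter
    fun l => ∀ x ∈ l, x < m)

theorem mem_indexLists {K m : ℕ} (hm : m ≤ K) {f : List ℕ} :
    f ∈ indexLists K m ↔ f.length = K ∧ ∀ x ∈ f, x < m := by
  simp only [indexLists, List.mem_filter, List.mem_map, Finset.mem_toList, Finset.mem_univ,
    true_and, decide_eq_true_eq]
  constructor
  · rintro ⟨⟨g, rfl⟩, h⟩
    exact ⟨by simp, h⟩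
  · rintro ⟨h1, h2⟩
    refine ⟨⟨fun i => ⟨f[i]'(by omega), (h2 _ (List.getElem_mem _)).trans_le hm⟩, ?_⟩, h2⟩
    subst h1
    simp

theorem nodup_indexLists (K m : ℕ) : (indexLists K m).Nodup := by
  refine List.Nodup.filter _ (List.Nodup.map ?_ (Finset.nodup_toList _))
  intro f g h
  funext i
  have := congrFun (List.ofFn_injective h) i
  exact Fin.ext this

theorem length_indexLists_le (K m : ℕ) : (indexLists K m).length ≤ K ^ K := by
  refine (List.length_filter_le _ _).trans ?_
  simp

/-- The pairs of positions of a tuple of arity `m`. -/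
def indexPairs (m : ℕ) : List (ℕ × ℕ) := (List.range m).product (List.range m)

/-- The label that stands for a list of positions. -/
def code (K : ℕ) (f : List ℕ) : ℕ := Nat.ofDigits K f

/-- The label that stands for a pair of positions. -/
def pairCode (K : ℕ) (p : ℕ × ℕ) : ℕ := K ^ K + (p.1 * K + p.2)

theorem code_lt {K : ℕ} (hK : 1 < K) {f : List ℕ} (h1 : f.length = K) (h2 : ∀ x ∈ f, x < K) :
    code K f < K ^ K := by
  have := Nat.ofDigits_lt_base_pow_length hK h2
  rwa [h1] at this

theorem code_inj {K : ℕ} (hK : 1 < K) {f g : List ℕ} (hf : f.length = K) (hf' : ∀ x ∈ f, x < K)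
    (hg : g.length = K) (hg' : ∀ x ∈ g, x < K) (h : code K f = code K g) : f = g :=
  Nat.ofDigits_inj_of_len_eq hK (hf.trans hg.symm) hf' hg' h

theorem pairCode_lt {K : ℕ} {p : ℕ × ℕ} (h1 : p.1 < K) (h2 : p.2 < K) :
    pairCode K p < K ^ K + K ^ 2 := by
  unfold pairCode
  nlinarith

theorem pairCode_inj {K : ℕ} {p p' : ℕ × ℕ} (h1 : p.2 < K) (h2 : p'.2 < K)
    (h : pairCode K p = pairCode K p') : p = p' := by
  unfold pairCode at h
  have h3 : p.1 * K + p.2 = p'.1 * K + p'.2 := by omega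
  have h4 := congrArg (· / K) h3
  have h5 := congrArg (· % K) h3
  have hK : 0 < K := by omega
  simp only [mul_comm _ K, Nat.mul_add_div hK, Nat.div_eq_of_lt h1, Nat.div_eq_of_lt h2,
    Nat.mul_add_mod, Nat.mod_eq_of_lt h1, Nat.mod_eq_of_lt h2, add_zero] at h4 h5
  exact Prod.ext h4 h5

/-- The two edges between a tuple and one of its slices. -/
def sliceEdges (n K : ℕ) (a f : List ℕ) : List (ℕ × ℕ × ℕ) :=
  [(key n a, code K f, key n (slice a f)), (key n (slice a f), code K f, key n a)]

/-- The loop at a tuple for a pair of positions at which it has equal entries. -/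
def loopEdges (n K : ℕ) (a : List ℕ) (p : ℕ × ℕ) : List (ℕ × ℕ × ℕ) :=
  if a.getD p.1 0 = a.getD p.2 0 then [(key n a, pairCode K p, key n a)] else []

/-- The edges that belong to a tuple. -/
noncomputable def edgesOf (n K : ℕ) (a : List ℕ) : List (ℕ × ℕ × ℕ) :=
  (indexLists K a.length).flatMap (sliceEdges n K a) ++
    (indexPairs a.length).flatMap (loopEdges n K a)

/-- The vertices that belong to a tuple: the tuple itself and its slices. -/
noncomputable def verticesOf (n K : ℕ) (a : List ℕ) : Finset ℕ :=
  insert (key n a) ((indexLists K a.length).map fun f => key n (slice a f)).toFinset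

/-- The edges of the graph of tuples and slices. -/
noncomputable def graphEdges (n K : ℕ) (ts : Finset (List ℕ)) : Multiset (ℕ × ℕ × ℕ) :=
  ∑ a ∈ ts, (edgesOf n K a : Multiset (ℕ × ℕ × ℕ))

/-- The vertices of the graph of tuples and slices. -/
noncomputable def graphVertices (n K : ℕ) (ts : Finset (List ℕ)) : Finset ℕ :=
  ts.biUnion (verticesOf n K)

theorem countP_flatMap_ite {α β : Type*} (l : List α) (g : α → List β) (p : β → Bool)
    (q : α → Bool) (h : ∀ a ∈ l, (g a).countP p = if q a then 1 else 0) :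
    (l.flatMap g).countP p = l.countP q := by
  induction l with
  | nil => simp
  | cons a l ih =>
    rw [List.flatMap_cons, List.countP_append, h a (by simp), ih fun b hb => h b (by simp [hb]),
      List.countP_cons, add_comm]

section graph

variable {n K : ℕ} {ts : Finset (List ℕ)} {es : List (ℕ × ℕ × ℕ)}

theorem slice_lt {a f : List ℕ} (ha : ∀ x ∈ a, x < n) (hf : ∀ x ∈ f, x < a.length) :
    ∀ x ∈ slice a f, x < n := by
  intro x hx
  obtain ⟨i, hi, rfl⟩ := List.mem_map.1 hx
  rw [List.getD_eq_getElem _ _ (hf i hi)]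
  exact ha _ (List.getElem_mem _)

theorem length_slice (a f : List ℕ) : (slice a f).length = f.length := List.length_map _

theorem graph_edge_mem (hes : (es : Multiset (ℕ × ℕ × ℕ)) = graphEdges n K ts) (hK : 1 < K)
    (hlen : ∀ a ∈ ts, a.length < K) {e : ℕ × ℕ × ℕ} (he : e ∈ es) :
    e.1 ∈ graphVertices n K ts ∧ e.2.1 < K ^ K + K ^ 2 ∧ e.2.2 ∈ graphVertices n K ts := by
  rw [← Multiset.mem_coe, hes, graphEdges, Multiset.mem_sum] at he
  obtain ⟨a, ha, he⟩ := he
  have hv : ∀ v, v ∈ verticesOf n K a → v ∈ graphVertices n K ts := fun v hv =>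
    Finset.mem_biUnion.2 ⟨a, ha, hv⟩
  have hl := hlen a ha
  have h1 : key n a ∈ graphVertices n K ts := hv _ (Finset.mem_insert_self _ _)
  simp only [Multiset.mem_coe, edgesOf, List.mem_append, List.mem_flatMap] at he
  rcases he with ⟨f, hf, he⟩ | ⟨p, hp, he⟩
  · have h2 : key n (slice a f) ∈ graphVertices n K ts := by
      refine hv _ (Finset.mem_insert_of_mem ?_)
      rw [List.mem_toFinset]
      exact List.mem_map.2 ⟨f, hf, rfl⟩
    rw [mem_indexLists hl.le] at hf
    have h3 : code K f < K ^ K + K ^ 2 :=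
      (code_lt hK hf.1 fun x hx => (hf.2 x hx).trans hl).trans_le (by omega)
    simp only [sliceEdges, List.mem_cons, List.not_mem_nil, or_false] at he
    rcases he with rfl | rfl
    · exact ⟨h1, h3, h2⟩
    · exact ⟨h2, h3, h1⟩
  · simp only [loopEdges] at he
    split_ifs at he
    · simp only [List.mem_cons, List.not_mem_nil, or_false] at he
      subst he
      obtain ⟨i, j⟩ := p
      rw [indexPairs, List.pair_mem_product, List.mem_range, List.mem_range] at hp
      exact ⟨h1, pairCode_lt (hp.1.trans hl) (hp.2.trans hl), h1⟩
    · simp at he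

theorem deg_eq_sum (hes : (es : Multiset (ℕ × ℕ × ℕ)) = graphEdges n K ts) (ℓ : ℕ) (Y : Set ℕ)
    (u : ℕ) : deg es ℓ Y u = ∑ a ∈ ts, deg (edgesOf n K a) ℓ Y u := by
  classical
  unfold deg
  rw [← Multiset.coe_countP, hes, graphEdges, ← Multiset.coe_countPAddMonoidHom, map_sum]
  simp

open Classical in
/-- The edges from a tuple go to its slices and to itself. -/
theorem deg_tuple (hes : (es : Multiset (ℕ × ℕ × ℕ)) = graphEdges n K ts)
    (hlen : ∀ a ∈ ts, a.length < K) (hts : ∀ a ∈ ts, ∀ x ∈ a, x < n) {a : List ℕ} (ha : a ∈ ts)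
    (ℓ : ℕ) (Y : Set ℕ) :
    deg es ℓ Y (key n a) =
      (indexLists K a.length).countP (fun f => code K f = ℓ ∧ key n (slice a f) ∈ Y) +
      (indexPairs a.length).countP
        (fun p => a.getD p.1 0 = a.getD p.2 0 ∧ pairCode K p = ℓ ∧ key n a ∈ Y) := by
  have hne : ∀ b ∈ ts, ∀ f ∈ indexLists K b.length, key n (slice b f) ≠ key n a := by
    intro b hb f hf he
    rw [mem_indexLists (hlen b hb).le] at hf
    have := key_inj (slice_lt (hts b hb) hf.2) (hts a ha) he
    have h1 := congrArg List.length this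
    rw [length_slice] at h1
    have := hlen a ha
    omega
  have hinj : ∀ b ∈ ts, key n b = key n a ↔ b = a := fun b hb =>
    ⟨fun h => key_inj (hts b hb) (hts a ha) h, fun h => h ▸ rfl⟩
  rw [deg_eq_sum hes, Finset.sum_eq_single_of_mem a ha]
  · unfold deg edgesOf
    rw [List.countP_append]
    congr 1
    · refine countP_flatMap_ite _ _ _ _ fun f hf => ?_
      simp [sliceEdges, List.countP_cons, hne a ha f hf]
    · refine countP_flatMap_ite _ _ _ _ fun p hp => ?_
      unfold loopEdges
      split_ifs <;> simp_all
  · intro b hb hba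
    unfold deg edgesOf
    rw [List.countP_append, countP_flatMap_ite _ _ _ (fun _ => false),
      countP_flatMap_ite _ _ _ (fun _ => false)]
    · simp
    · intro p hp
      unfold loopEdges
      split_ifs <;> first | contradiction | simp [hinj b hb, hba]
    · intro f hf
      simp [sliceEdges, hne b hb f hf, hinj b hb, hba]

open Classical in
/-- The edges from a slice go to the tuples of which it is a slice. -/
theorem deg_slice (hes : (es : Multiset (ℕ × ℕ × ℕ)) = graphEdges n K ts) {v : ℕ}
    (hv : ∀ a ∈ ts, key n a ≠ v) (ℓ : ℕ) (Y : Set ℕ) :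
    deg es ℓ Y v = ∑ b ∈ ts, (indexLists K b.length).countP
      (fun f => key n (slice b f) = v ∧ code K f = ℓ ∧ key n b ∈ Y) := by
  rw [deg_eq_sum hes]
  refine Finset.sum_congr rfl fun b hb => ?_
  unfold deg edgesOf
  rw [List.countP_append, countP_flatMap_ite (indexPairs _) _ _ (fun _ => false)]
  · simp only [List.countP_false]
    refine countP_flatMap_ite _ _ _ _ fun f hf => ?_
    simp [sliceEdges, List.countP_cons, hv b hb]
  · intro p hp
    unfold loopEdges
    split_ifs <;> first | contradiction | simp [hv b hb]

end graph

/-! ### The graph of tuples and slices determines the stable coloring -/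

section words

variable {σ : Signature} {V : Type} {A : Structure σ V} (E : Presentation A)

/-- A tuple as a list of numbers. -/
def Presentation.word (a : Tup V) : List ℕ := List.ofFn fun i => (E.num (a.2 i) : ℕ)

theorem Presentation.length_word (a : Tup V) : (E.word a).length = a.1 := by
  simp [Presentation.word]

theorem Presentation.word_getD (a : Tup V) (i : Fin a.1) :
    (E.word a).getD i 0 = E.num (a.2 i) := by
  rw [List.getD_eq_getElem _ _ (by rw [E.length_word]; exact i.2)]
  simp [Presentation.word]

theorem Presentation.word_lt (a : Tup V) : ∀ x ∈ E.word a, x < E.n := by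
  intro x hx
  simp only [Presentation.word, List.mem_ofFn] at hx
  obtain ⟨i, rfl⟩ := hx
  exact Fin.is_lt _

theorem Presentation.word_injective : Function.Injective E.word := by
  rintro ⟨k, a⟩ ⟨k', b⟩ h
  have h1 := congrArg List.length h
  rw [E.length_word, E.length_word] at h1
  simp only at h1
  subst h1
  have h2 := List.ofFn_injective h
  congr 1
  funext i
  exact E.num.injective (Fin.ext (congrFun h2 i))

theorem Presentation.mem_stp (a b : Tup V) (p : ℕ × ℕ) :
    p ∈ stp a b ↔ p.1 < a.1 ∧ p.2 < b.1 ∧ (E.word a).getD p.1 0 = (E.word b).getD p.2 0 := by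
  obtain ⟨i, j⟩ := p
  constructor
  · rintro ⟨i', j', h, h'⟩
    obtain ⟨rfl, rfl⟩ := Prod.mk.injEq .. ▸ h
    exact ⟨i'.2, j'.2, by rw [E.word_getD, E.word_getD, h']⟩
  · rintro ⟨hi, hj, h⟩
    refine ⟨⟨i, hi⟩, ⟨j, hj⟩, rfl, ?_⟩
    have h1 := E.word_getD a ⟨i, hi⟩
    have h2 := E.word_getD b ⟨j, hj⟩
    simp only at h h1 h2
    exact E.num.injective (Fin.ext (h1.symm.trans (h.trans h2)))

theorem Structure.mem_tuples (A : Structure σ V) (a : Tup V) :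
    a ∈ A.tuples ↔ ∃ R, ∃ b ∈ A.rel R, a = ⟨σ.arity R, b⟩ := by
  classical
  simp only [Structure.tuples, Finset.mem_biUnion, Finset.mem_univ, true_and, Finset.mem_image,
    eq_comm]

theorem Structure.arity_pos_le (A : Structure σ V) {a : Tup V} (ha : a ∈ A.tuples) :
    0 < a.1 ∧ a.1 ≤ σ.maxArity := by
  obtain ⟨R, b, _, rfl⟩ := (A.mem_tuples a).1 ha
  exact ⟨σ.arity_pos R, Finset.le_sup (f := σ.arity) (Finset.mem_univ R)⟩

theorem Signature.one_lt (σ : Signature) : 1 < σ.maxArity + 1 := by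
  have h1 := σ.arity_pos ⟨0, σ.card_pos⟩
  have h2 : σ.arity ⟨0, σ.card_pos⟩ ≤ σ.maxArity := Finset.le_sup (Finset.mem_univ _)
  omega

open Classical in
/-- The tuples of the structure, as lists of numbers. -/
noncomputable def Presentation.words : Finset (List ℕ) := A.tuples.image E.word

/-- The vertex of a tuple. -/
def Presentation.vertex (a : Tup V) : ℕ := key E.n (E.word a)

theorem Presentation.vertex_injective : Function.Injective E.vertex := fun a b h =>
  E.word_injective (key_inj (E.word_lt a) (E.word_lt b) h)

/-- The tuples of each relation, as lists of vertices. -/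
def Presentation.vertexLists : List (List ℕ) :=
  (List.finRange σ.card).map fun R => (E.list R).map fun a => E.vertex ⟨σ.arity R, a⟩

theorem Presentation.mem_words {E : Presentation A} {l : List ℕ} :
    l ∈ E.words ↔ ∃ a ∈ A.tuples, E.word a = l := by
  classical
  simp [Presentation.words]

theorem Presentation.sum_words {M : Type*} [AddCommMonoid M] (f : List ℕ → M) :
    ∑ l ∈ E.words, f l = ∑ a ∈ A.tuples, f (E.word a) := by
  classical
  exact Finset.sum_image fun a _ b _ h => E.word_injective h

theorem Presentation.count_vertexLists (a : Tup V) (R : Fin σ.card) [Decidable (R ∈ A.atp a)] :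
    ((E.list R).map fun a => E.vertex ⟨σ.arity R, a⟩).count (E.vertex a) =
      if R ∈ A.atp a then 1 else 0 := by
  classical
  have hnd : ((E.list R).map fun a => E.vertex ⟨σ.arity R, a⟩).Nodup := by
    refine (E.nodup R).map fun a b h => ?_
    have := E.vertex_injective h
    simpa using this
  rw [hnd.count]
  congr 1
  simp only [List.mem_map, E.mem_list, Structure.atp, eq_iff_iff]
  exact ⟨fun ⟨b, hb, h⟩ => ⟨b, hb, (E.vertex_injective h).symm⟩,
    fun ⟨b, hb, h⟩ => ⟨b, hb, by rw [h]⟩⟩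

end words

section coloring

variable {σ : Signature} {V : Type} {A : Structure σ V} {E : Presentation A}

theorem Presentation.words_length {K : ℕ} (hK : K = σ.maxArity + 1) :
    ∀ l ∈ E.words, l.length < K := by
  intro l hl
  obtain ⟨a, ha, rfl⟩ := Presentation.mem_words.1 hl
  have := A.arity_pos_le ha
  rw [E.length_word]
  omega

theorem Presentation.words_lt : ∀ l ∈ E.words, ∀ x ∈ l, x < E.n := by
  intro l hl
  obtain ⟨a, ha, rfl⟩ := Presentation.mem_words.1 hl
  exact E.word_lt a

/-- Two tuples agree on slices if and only if the pairs of positions belong to the similarity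
type. -/
theorem Presentation.slice_eq_iff {a b : Tup V} {f g : List ℕ} (hfg : f.length = g.length)
    (hf : ∀ x ∈ f, x < a.1) :
    ((∀ x ∈ g, x < b.1) ∧ slice (E.word b) g = slice (E.word a) f) ↔
      ∀ p ∈ f.zip g, p ∈ stp a b := by
  induction f generalizing g with
  | nil =>
    obtain rfl := List.length_eq_zero_iff.1 hfg.symm
    simp [slice]
  | cons i f ih =>
    cases g with
    | nil => simp at hfg
    | cons j g =>
      have := ih (g := g) (by simpa using hfg) fun x hx => hf x (by simp [hx])
      have hi := hf i (by simp)
      simp only [slice, List.map_cons, List.zip_cons_cons, List.forall_mem_cons,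
        List.cons.injEq] at this ⊢
      rw [← this, E.mem_stp]
      simp only [hi, true_and]
      rw [eq_comm (a := (E.word a).getD i 0)]
      tauto

/-- Stable colors determine the number of tuples in relation to a tuple. -/
theorem Structure.sum_eq_of_color_succ_eq {i : ℕ} {a a' : Tup V}
    (h : A.color (i + 1) a = A.color (i + 1) a') (F : Set (ℕ × ℕ) → Color σ i → ℕ)
    (hF : ∀ τ c, τ = ∅ → F τ c = 0) :
    ∑ b ∈ A.tuples, F (stp a b) (A.color i b) = ∑ b ∈ A.tuples, F (stp a' b) (A.color i b) := by
  classical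
  have key : ∀ x : Tup V, ∑ b ∈ A.tuples, F (stp x b) (A.color i b) =
      (((A.tuples.filter fun b => (stp x b).Nonempty).val.map fun b =>
        (stp x b, A.color i b)).map fun p => F p.1 p.2).sum := by
    intro x
    rw [Multiset.map_map]
    change _ = ∑ b ∈ A.tuples.filter fun b => (stp x b).Nonempty, F (stp x b) (A.color i b)
    refine (Finset.sum_filter_of_ne fun b _ hb => ?_).symm
    by_contra hne
    rw [Set.not_nonempty_iff_eq_empty] at hne
    exact hb (hF _ _ hne)
  rw [key, key]
  have h2 := congrArg Prod.snd h
  simp only [Structure.color] at h2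
  congr 2

open Classical in
/-- The coloring of the graph that belongs to the coloring after `i` rounds: tuples keep their
colors, and slices are colored by the numbers of their edges into sets of colors. -/
noncomputable def Presentation.graphColor (E : Presentation A) (K i : ℕ) (v : ℕ) :
    Color σ i ⊕ (ℕ → Set (Color σ i) → ℕ) :=
  if h : ∃ a ∈ A.tuples, E.vertex a = v then .inl (A.color i h.choose)
  else .inr fun ℓ Y => ∑ b ∈ A.tuples, (indexLists K b.1).countP
    fun f => key E.n (slice (E.word b) f) = v ∧ code K f = ℓ ∧ A.color i b ∈ Y

theorem Presentation.graphColor_vertex (K i : ℕ) {a : Tup V} (ha : a ∈ A.tuples) :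
    E.graphColor K i (E.vertex a) = .inl (A.color i a) := by
  have h : ∃ b ∈ A.tuples, E.vertex b = E.vertex a := ⟨a, ha, rfl⟩
  rw [graphColor, dif_pos h, E.vertex_injective h.choose_spec.2]

theorem Presentation.slice_ne_vertex {K : ℕ} (hK : K = σ.maxArity + 1) {a : Tup V}
    (b : Tup V) (ha : a ∈ A.tuples) {f : List ℕ} (hf : f.length = K) (hfb : ∀ x ∈ f, x < b.1) :
    E.vertex a ≠ key E.n (slice (E.word b) f) := by
  intro he
  have := key_inj (E.word_lt a)
    (slice_lt (E.word_lt b) (by rwa [E.length_word])) he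
  have h1 := congrArg List.length this
  rw [length_slice, E.length_word] at h1
  have := A.arity_pos_le ha
  omega

/-- Tuples with the same color have slices with the same colors. -/
theorem Presentation.graphColor_slice {K i : ℕ} (hK : K = σ.maxArity + 1) {a a' : Tup V}
    (hlen : a.1 = a'.1) (h : A.color (i + 1) a = A.color (i + 1) a') {f : List ℕ}
    (hf : f.length = K) (hfa : ∀ x ∈ f, x < a.1) :
    E.graphColor K i (key E.n (slice (E.word a) f)) =
      E.graphColor K i (key E.n (slice (E.word a') f)) := by
  classical
  have hfa' : ∀ x ∈ f, x < a'.1 := hlen ▸ hfa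
  have hno : ∀ x : Tup V, (∀ y ∈ f, y < x.1) →
      ¬ ∃ b ∈ A.tuples, E.vertex b = key E.n (slice (E.word x) f) := by
    rintro x hx ⟨b, hb, he⟩
    exact E.slice_ne_vertex hK x hb hf hx he
  rw [graphColor, graphColor, dif_neg (hno a hfa), dif_neg (hno a' hfa')]
  congr 1
  funext ℓ Y
  -- the conditions on the slice and its positions only depend on the similarity type
  have hcount : ∀ x : Tup V, (∀ y ∈ f, y < x.1) → ∀ b ∈ A.tuples,
      (indexLists K b.1).countP (fun g => key E.n (slice (E.word b) g) =
        key E.n (slice (E.word x) f) ∧ code K g = ℓ ∧ A.color i b ∈ Y) =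
      (indexLists K K).countP (fun g => (∀ p ∈ f.zip g, p ∈ stp x b) ∧ code K g = ℓ ∧
        A.color i b ∈ Y) := by
    intro x hx b hb
    have hbK : b.1 ≤ K := by have := A.arity_pos_le hb; omega
    rw [List.countP_eq_length_filter, List.countP_eq_length_filter]
    refine List.Perm.length_eq ?_
    rw [List.perm_ext_iff_of_nodup ((nodup_indexLists _ _).filter _)
      ((nodup_indexLists _ _).filter _)]
    intro g
    simp only [List.mem_filter, mem_indexLists hbK, mem_indexLists le_rfl, decide_eq_true_eq]
    constructor
    · rintro ⟨⟨h1, h2⟩, h3, h4⟩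
      have h5 := key_inj (slice_lt (E.word_lt b) (by rwa [E.length_word]))
        (slice_lt (E.word_lt x) (by rwa [E.length_word])) h3
      exact ⟨⟨h1, fun y hy => (h2 y hy).trans_le hbK⟩,
        (slice_eq_iff (hf.trans h1.symm) hx).1 ⟨h2, h5⟩, h4⟩
    · rintro ⟨⟨h1, h2⟩, h3, h4⟩
      obtain ⟨h5, h6⟩ := (slice_eq_iff (hf.trans h1.symm) hx).2 h3
      exact ⟨⟨h1, h5⟩, by rw [h6], h4⟩
  rw [Finset.sum_congr rfl (hcount a hfa), Finset.sum_congr rfl (hcount a' hfa')]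
  refine Structure.sum_eq_of_color_succ_eq h (fun τ c => (indexLists K K).countP
    (fun g => (∀ p ∈ f.zip g, p ∈ τ) ∧ code K g = ℓ ∧ c ∈ Y)) fun τ c hτ => ?_
  rw [List.countP_eq_zero]
  intro g hg
  rw [mem_indexLists le_rfl] at hg
  have hKpos : 0 < K := by omega
  cases f with
  | nil => simp at hf; omega
  | cons x f =>
    cases g with
    | nil => simp at hg; omega
    | cons y g =>
      rw [decide_eq_true_eq]
      rintro ⟨h1, _⟩
      exact (hτ ▸ h1 (x, y) (by simp) : (x, y) ∈ (∅ : Set (ℕ × ℕ)))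

theorem Structure.color_atp_stp {i : ℕ} {a a' : Tup V} (h : A.color i a = A.color i a') :
    A.atp a = A.atp a' ∧ stp a a = stp a' a' := by
  induction i with
  | zero =>
    exact ⟨congrArg Prod.fst h, congrArg Prod.snd h⟩
  | succ i ih => exact ih (A.color_succ_inj h)

theorem Structure.length_eq_of_atp {a a' : Tup V} (ha : a ∈ A.tuples)
    (h : A.atp a = A.atp a') : a.1 = a'.1 := by
  obtain ⟨R, b, hb, rfl⟩ := (A.mem_tuples a).1 ha
  have h1 : R ∈ A.atp ⟨σ.arity R, b⟩ := ⟨b, hb, rfl⟩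
  rw [h] at h1
  obtain ⟨b', _, rfl⟩ := h1
  rfl

/-- A stable coloring of the tuples yields an equitable coloring of the graph. -/
theorem Presentation.graphColor_equitable {K i : ℕ} (hK : K = σ.maxArity + 1)
    (hi : A.IsStable i) {es : List (ℕ × ℕ × ℕ)}
    (hes : (es : Multiset (ℕ × ℕ × ℕ)) = graphEdges E.n K E.words) :
    Equitable (graphVertices E.n K E.words) es E.vertexLists (E.graphColor K i) := by
  classical
  have hlen := E.words_length hK
  -- vertices are vertices of tuples or of slices
  have hcases : ∀ u ∈ graphVertices E.n K E.words, (∃ a ∈ A.tuples, u = E.vertex a) ∨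
      ¬ ∃ a ∈ A.tuples, E.vertex a = u := by
    intro u _
    by_cases h : ∃ a ∈ A.tuples, u = E.vertex a
    · exact .inl h
    · exact .inr fun ⟨a, ha, he⟩ => h ⟨a, ha, he.symm⟩
  intro u hu u' hu' huu
  rcases hcases u hu with ⟨a, ha, rfl⟩ | hn
  · rcases hcases u' hu' with ⟨a', ha', rfl⟩ | hn'
    · rw [E.graphColor_vertex K i ha, E.graphColor_vertex K i ha', Sum.inl.injEq] at huu
      obtain ⟨hatp, hstp⟩ := Structure.color_atp_stp huu
      have hl := Structure.length_eq_of_atp ha hatp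
      constructor
      · intro l hl
        obtain ⟨R, _, rfl⟩ := List.mem_map.1 hl
        rw [E.count_vertexLists, E.count_vertexLists, hatp]
      · intro ℓ Y
        have hw : ∀ x ∈ A.tuples, E.word x ∈ E.words := fun x hx =>
          Presentation.mem_words.2 ⟨x, hx, rfl⟩
        have h1 := deg_tuple hes hlen E.words_lt (hw a ha) ℓ (E.graphColor K i ⁻¹' Y)
        have h2 := deg_tuple hes hlen E.words_lt (hw a' ha') ℓ (E.graphColor K i ⁻¹' Y)
        change deg es ℓ _ (E.vertex a) = _ at h1
        change deg es ℓ _ (E.vertex a') = _ at h2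
        rw [h1, h2, E.length_word, E.length_word, ← hl]
        congr 1
        · refine List.countP_congr fun f hf => ?_
          rw [mem_indexLists (by have := A.arity_pos_le ha; omega)] at hf
          simp only [decide_eq_true_eq, Set.mem_preimage]
          rw [E.graphColor_slice hK hl ((hi a ha a' ha').1 huu) hf.1 hf.2]
        · refine List.countP_congr fun p hp => ?_
          obtain ⟨x, y⟩ := p
          rw [indexPairs, List.pair_mem_product, List.mem_range, List.mem_range] at hp
          simp only [decide_eq_true_eq, Set.mem_preimage]
          change _ ∧ _ ∧ E.graphColor K i (E.vertex a) ∈ Y ↔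
            _ ∧ _ ∧ E.graphColor K i (E.vertex a') ∈ Y
          rw [E.graphColor_vertex K i ha, E.graphColor_vertex K i ha', huu]
          have h3 : (x, y) ∈ stp a a ↔ (x, y) ∈ stp a' a' := by rw [hstp]
          rw [E.mem_stp, E.mem_stp] at h3
          simp only [hp, ← hl, true_and] at h3
          rw [h3]
    · rw [E.graphColor_vertex K i ha, graphColor, dif_neg hn'] at huu
      exact absurd huu (by simp)
  · rcases hcases u' hu' with ⟨a', ha', rfl⟩ | hn'
    · rw [E.graphColor_vertex K i ha', graphColor, dif_neg hn] at huu
      exact absurd huu (by simp)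
    · constructor
      · intro l hl
        obtain ⟨R, _, rfl⟩ := List.mem_map.1 hl
        have h0 : ∀ w, (¬ ∃ a ∈ A.tuples, E.vertex a = w) →
            ((E.list R).map fun a => E.vertex ⟨σ.arity R, a⟩).count w = 0 := by
          intro w hw
          rw [List.count_eq_zero]
          intro hmem
          obtain ⟨b, hb, rfl⟩ := List.mem_map.1 hmem
          exact hw ⟨_, (A.mem_tuples _).2 ⟨R, b, (E.mem_list R b).1 hb, rfl⟩, rfl⟩
        rw [h0 u hn, h0 u' hn']
      · intro ℓ Y
        have hdeg : ∀ w, (¬ ∃ a ∈ A.tuples, E.vertex a = w) →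
            deg es ℓ (E.graphColor K i ⁻¹' Y) w = ∑ b ∈ A.tuples, (indexLists K b.1).countP
              fun f => key E.n (slice (E.word b) f) = w ∧ code K f = ℓ ∧
                A.color i b ∈ Sum.inl ⁻¹' Y := by
          intro w hw
          rw [deg_slice hes, E.sum_words]
          · refine Finset.sum_congr rfl fun b hb => ?_
            rw [E.length_word]
            refine List.countP_congr fun f _ => ?_
            simp only [decide_eq_true_eq, Set.mem_preimage]
            change _ ∧ _ ∧ E.graphColor K i (E.vertex b) ∈ Y ↔ _
            rw [E.graphColor_vertex K i hb]
          · intro l hl he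
            obtain ⟨a, ha, rfl⟩ := Presentation.mem_words.1 hl
            exact hw ⟨a, ha, he⟩
        rw [graphColor, graphColor, dif_neg hn, dif_neg hn', Sum.inr.injEq] at huu
        rw [hdeg u hn, hdeg u' hn']
        exact congrFun (congrFun huu ℓ) _

/-- If the sets `s b` and `s' b` equally often include each non-empty set, then they also equally
often equal each non-empty set. -/
theorem card_filter_eq_of_card_filter_subset {ι β : Type*} [DecidableEq β] {U : Finset β}
    {T : Finset ι} {s s' : ι → Finset β} (hs : ∀ b ∈ T, s b ⊆ U) (hs' : ∀ b ∈ T, s' b ⊆ U)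
    (h : ∀ τ ⊆ U, τ.Nonempty →
      (T.filter fun b => τ ⊆ s b).card = (T.filter fun b => τ ⊆ s' b).card)
    {τ : Finset β} (hτ : τ ⊆ U) (hne : τ.Nonempty) :
    (T.filter fun b => s b = τ).card = (T.filter fun b => s' b = τ).card := by
  obtain ⟨k, hk⟩ : ∃ k, k = U.card - τ.card := ⟨_, rfl⟩
  induction k using Nat.strong_induction_on generalizing τ with
  | _ k ih =>
    have key : ∀ r : ι → Finset β, (∀ b ∈ T, r b ⊆ U) → (T.filter fun b => τ ⊆ r b).card =
        (T.filter fun b => r b = τ).card +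
          ∑ ρ ∈ (U.powerset.filter fun ρ => τ ⊂ ρ), (T.filter fun b => r b = ρ).card := by
      intro r hr
      have hU : U.powerset.filter (fun ρ => τ ⊆ ρ) =
          insert τ (U.powerset.filter fun ρ => τ ⊂ ρ) := by
        ext ρ
        simp only [Finset.mem_filter, Finset.mem_powerset, Finset.mem_insert,
          subset_iff_ssubset_or_eq]
        constructor
        · rintro ⟨h1, h2 | h2⟩
          · exact .inr ⟨h1, h2⟩
          · exact .inl h2.symm
        · rintro (rfl | ⟨h1, h2⟩)
          · exact ⟨subset_iff_ssubset_or_eq.1 hτ, .inr rfl⟩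
          · exact ⟨h1, .inl h2⟩
      rw [Finset.card_eq_sum_card_fiberwise (f := r)
        (t := U.powerset.filter fun ρ => τ ⊆ ρ), hU, Finset.sum_insert]
      · congr 1
        · congr 1
          ext b
          simp only [Finset.mem_filter]
          exact ⟨fun h => ⟨h.1.1, h.2⟩, fun h => ⟨⟨h.1, h.2.ge⟩, h.2⟩⟩
        · refine Finset.sum_congr rfl fun ρ hρ => ?_
          congr 1
          ext b
          simp only [Finset.mem_filter, Finset.mem_powerset] at hρ ⊢
          exact ⟨fun h => ⟨h.1.1, h.2⟩, fun h => ⟨⟨h.1, h.2 ▸ hρ.2.subset⟩, h.2⟩⟩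
      · simp
      · intro b hb
        simp only [Finset.coe_filter, Finset.mem_powerset, Set.mem_ofPred_eq] at hb ⊢
        exact ⟨hr b hb.1, hb.2⟩
    have h1 := h τ hτ hne
    rw [key s hs, key s' hs'] at h1
    have h2 : ∑ ρ ∈ (U.powerset.filter fun ρ => τ ⊂ ρ), (T.filter fun b => s b = ρ).card =
        ∑ ρ ∈ (U.powerset.filter fun ρ => τ ⊂ ρ), (T.filter fun b => s' b = ρ).card := by
      refine Finset.sum_congr rfl fun ρ hρ => ?_
      simp only [Finset.mem_filter, Finset.mem_powerset] at hρ
      have h3 := Finset.card_lt_card hρ.2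
      have h4 := Finset.card_le_card hρ.1
      exact ih (U.card - ρ.card) (by omega) hρ.1 (hne.mono hρ.2.subset) rfl
    omega

section refinement

variable {K : ℕ} {es : List (ℕ × ℕ × ℕ)} {cls : ℕ → ℕ}

theorem Presentation.vertex_mem {a : Tup V} (ha : a ∈ A.tuples) :
    E.vertex a ∈ graphVertices E.n K E.words :=
  Finset.mem_biUnion.2 ⟨E.word a, Presentation.mem_words.2 ⟨a, ha, rfl⟩,
    Finset.mem_insert_self _ _⟩

theorem Presentation.slice_mem {a : Tup V} (ha : a ∈ A.tuples) (hK : K = σ.maxArity + 1)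
    {f : List ℕ} (hf : f.length = K) (hfa : ∀ x ∈ f, x < a.1) :
    key E.n (slice (E.word a) f) ∈ graphVertices E.n K E.words := by
  refine Finset.mem_biUnion.2 ⟨E.word a, Presentation.mem_words.2 ⟨a, ha, rfl⟩,
    Finset.mem_insert_of_mem ?_⟩
  rw [List.mem_toFinset, List.mem_map]
  refine ⟨f, (mem_indexLists ?_).2 ⟨hf, ?_⟩, rfl⟩
  · rw [E.length_word]
    have := A.arity_pos_le ha
    omega
  · rwa [E.length_word]

/-- The edges from a tuple with the label of an index list: only one, to the slice. -/
theorem Presentation.deg_code (hK : K = σ.maxArity + 1)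
    (hes : (es : Multiset (ℕ × ℕ × ℕ)) = graphEdges E.n K E.words) {a : Tup V}
    (ha : a ∈ A.tuples) {f : List ℕ} (hf : f.length = K) (hfa : ∀ x ∈ f, x < a.1) (Y : Set ℕ)
    [Decidable (key E.n (slice (E.word a) f) ∈ Y)] :
    deg es (code K f) Y (E.vertex a) =
      if key E.n (slice (E.word a) f) ∈ Y then 1 else 0 := by
  classical
  have hK1 : 1 < K := hK ▸ σ.one_lt
  have haK := A.arity_pos_le ha
  have h1 := deg_tuple hes (E.words_length hK) E.words_lt
    (Presentation.mem_words.2 ⟨a, ha, rfl⟩) (code K f) Y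
  change deg es _ _ (E.vertex a) = _ at h1
  have h2 : (indexPairs (E.word a).length).countP (fun p => (E.word a).getD p.1 0 =
      (E.word a).getD p.2 0 ∧ pairCode K p = code K f ∧ key E.n (E.word a) ∈ Y) = 0 := by
    rw [List.countP_eq_zero]
    intro p _
    rw [decide_eq_true_eq]
    rintro ⟨_, h3, _⟩
    have := code_lt hK1 hf fun x hx => (hfa x hx).trans (by omega)
    unfold pairCode at h3
    omega
  have hm : f ∈ indexLists K (E.word a).length := by
    rw [E.length_word, mem_indexLists (by omega)]
    exact ⟨hf, hfa⟩
  rw [h1, h2, add_zero, List.countP_congr (q := fun g => g == f && decide (key E.n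
    (slice (E.word a) f) ∈ Y))]
  · split_ifs with h3
    · simp only [h3, decide_true, Bool.and_true]
      exact List.count_eq_one_of_mem (nodup_indexLists _ _) hm
    · simp [h3]
  · intro g hg
    rw [E.length_word, mem_indexLists (by omega)] at hg
    simp only [decide_eq_true_eq, Bool.and_eq_true, beq_iff_eq]
    constructor
    · rintro ⟨h4, h5⟩
      have := code_inj hK1 hg.1 (fun x hx => (hg.2 x hx).trans (by omega)) hf
        (fun x hx => (hfa x hx).trans (by omega)) h4
      subst this
      exact ⟨rfl, h5⟩
    · rintro ⟨rfl, h5⟩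
      exact ⟨rfl, h5⟩

/-- The edges from a tuple with the label of a pair of positions: a loop if the entries agree. -/
theorem Presentation.deg_pairCode (hK : K = σ.maxArity + 1)
    (hes : (es : Multiset (ℕ × ℕ × ℕ)) = graphEdges E.n K E.words) {a : Tup V}
    (ha : a ∈ A.tuples) {p : ℕ × ℕ} (h1 : p.1 < a.1) (h2 : p.2 < a.1) :
    0 < deg es (pairCode K p) Set.univ (E.vertex a) ↔ p ∈ stp a a := by
  classical
  have hK1 : 1 < K := hK ▸ σ.one_lt
  have haK := A.arity_pos_le ha
  obtain ⟨Y, hY⟩ : ∃ Y : Set ℕ, Y = Set.univ := ⟨_, rfl⟩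
  have hmY : ∀ v, v ∈ Y := fun v => hY ▸ Set.mem_univ v
  rw [← hY]
  have h3 := deg_tuple hes (E.words_length hK) E.words_lt
    (Presentation.mem_words.2 ⟨a, ha, rfl⟩) (pairCode K p) Y
  change deg es _ _ (E.vertex a) = _ at h3
  have h4 : (indexLists K (E.word a).length).countP (fun f => code K f = pairCode K p ∧
      key E.n (slice (E.word a) f) ∈ Y) = 0 := by
    rw [List.countP_eq_zero]
    intro f hf
    rw [E.length_word, mem_indexLists (by omega)] at hf
    rw [decide_eq_true_eq]
    rintro ⟨h3, _⟩
    have := code_lt hK1 hf.1 fun x hx => (hf.2 x hx).trans (by omega)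
    unfold pairCode at h3
    omega
  rw [h3, h4, zero_add, List.countP_pos_iff, E.mem_stp]
  simp only [decide_eq_true_eq, hmY, and_true, h1, h2, true_and]
  constructor
  · rintro ⟨⟨x, y⟩, hm, h5, h6⟩
    rw [indexPairs, E.length_word, List.pair_mem_product, List.mem_range, List.mem_range] at hm
    have := pairCode_inj (p := (x, y)) (p' := p) (K := K) (by simp only; omega) (by omega) h6
    subst this
    exact h5
  · intro h5
    obtain ⟨x, y⟩ := p
    refine ⟨(x, y), ?_, h5, rfl⟩
    rw [indexPairs, E.length_word, List.pair_mem_product, List.mem_range, List.mem_range]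
    exact ⟨h1, h2⟩

theorem Presentation.atp_eq_of_equitable
    (hcls : Equitable (graphVertices E.n K E.words) es E.vertexLists cls)
    {a a' : Tup V} (ha : a ∈ A.tuples) (ha' : a' ∈ A.tuples)
    (h : cls (E.vertex a) = cls (E.vertex a')) : A.atp a = A.atp a' := by
  classical
  ext R
  have h1 := (hcls _ (E.vertex_mem ha) _ (E.vertex_mem ha') h).1 _
    (List.mem_map.2 ⟨R, List.mem_finRange R, rfl⟩)
  rw [E.count_vertexLists, E.count_vertexLists] at h1
  split_ifs at h1 with h2 h3 h3
  · exact ⟨fun _ => h3, fun _ => h2⟩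
  · exact ⟨fun h => absurd h h2, fun h => absurd h h3⟩

theorem Presentation.stp_eq_of_equitable
    (hK : K = σ.maxArity + 1)
    (hes : (es : Multiset (ℕ × ℕ × ℕ)) = graphEdges E.n K E.words)
    (hcls : Equitable (graphVertices E.n K E.words) es E.vertexLists cls)
    {a a' : Tup V} (ha : a ∈ A.tuples) (ha' : a' ∈ A.tuples)
    (h : cls (E.vertex a) = cls (E.vertex a')) : stp a a = stp a' a' := by
  have hl := Structure.length_eq_of_atp ha (E.atp_eq_of_equitable hcls ha ha' h)
  have h1 := (hcls _ (E.vertex_mem ha) _ (E.vertex_mem ha') h).2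
  ext p
  have h2 := h1 (pairCode K p) Set.univ
  rw [Set.preimage_univ] at h2
  by_cases h3 : p.1 < a.1 ∧ p.2 < a.1
  · rw [← E.deg_pairCode hK hes ha h3.1 h3.2, h2,
      E.deg_pairCode hK hes ha' (hl ▸ h3.1) (hl ▸ h3.2)]
  · rw [E.mem_stp, E.mem_stp]
    constructor
    · exact fun h => absurd ⟨h.1, h.2.1⟩ h3
    · exact fun h => absurd (hl ▸ ⟨h.1, h.2.1⟩) h3

/-- Tuples of the same color have slices of the same color, which are equally often slices of tuples
of each color. -/
theorem Presentation.card_slice_eq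
    (hK : K = σ.maxArity + 1)
    (hes : (es : Multiset (ℕ × ℕ × ℕ)) = graphEdges E.n K E.words)
    (hcls : Equitable (graphVertices E.n K E.words) es E.vertexLists cls)
    {a a' : Tup V} (ha : a ∈ A.tuples) (ha' : a' ∈ A.tuples)
    (h : cls (E.vertex a) = cls (E.vertex a')) {f g : List ℕ} (hf : f.length = K)
    (hfa : ∀ x ∈ f, x < a.1) (hg : g.length = K) (hgK : ∀ x ∈ g, x < K) (c : ℕ)
    [DecidablePred fun b => cls (E.vertex b) = c ∧ (∀ x ∈ g, x < b.1) ∧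
      slice (E.word b) g = slice (E.word a) f]
    [DecidablePred fun b => cls (E.vertex b) = c ∧ (∀ x ∈ g, x < b.1) ∧
      slice (E.word b) g = slice (E.word a') f] :
    (A.tuples.filter fun b => cls (E.vertex b) = c ∧ (∀ x ∈ g, x < b.1) ∧
      slice (E.word b) g = slice (E.word a) f).card =
    (A.tuples.filter fun b => cls (E.vertex b) = c ∧ (∀ x ∈ g, x < b.1) ∧
      slice (E.word b) g = slice (E.word a') f).card := by
  classical
  have hK1 : 1 < K := hK ▸ σ.one_lt
  have hl := Structure.length_eq_of_atp ha (E.atp_eq_of_equitable hcls ha ha' h)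
  have hfa' : ∀ x ∈ f, x < a'.1 := hl ▸ hfa
  have h1 : cls (key E.n (slice (E.word a) f)) = cls (key E.n (slice (E.word a') f)) := by
    have h2 := (hcls _ (E.vertex_mem ha) _ (E.vertex_mem ha') h).2 (code K f)
      {cls (key E.n (slice (E.word a) f))}
    rw [E.deg_code hK hes ha hf hfa, E.deg_code hK hes ha' hf hfa', if_pos (by simp)] at h2
    split_ifs at h2 with h3
    exact (Set.mem_singleton_iff.1 h3).symm
  have h2 := (hcls _ (E.slice_mem ha hK hf hfa) _ (E.slice_mem ha' hK hf hfa') h1).2 (code K g)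
    {c}
  have key : ∀ x ∈ A.tuples, (∀ y ∈ f, y < x.1) → deg es (code K g) (cls ⁻¹' {c})
      (key E.n (slice (E.word x) f)) = (A.tuples.filter fun b => cls (E.vertex b) = c ∧
        (∀ y ∈ g, y < b.1) ∧ slice (E.word b) g = slice (E.word x) f).card := by
    intro x hx hfx
    rw [deg_slice hes, E.sum_words, Finset.card_filter]
    · refine Finset.sum_congr rfl fun b hb => ?_
      have hbK := A.arity_pos_le hb
      rw [List.countP_congr (q := fun g' => g' == g && decide (cls (E.vertex b) = c ∧
        slice (E.word b) g = slice (E.word x) f))]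
      · split_ifs with h3
        · simp only [h3, and_self, decide_true, Bool.and_true]
          refine List.count_eq_one_of_mem (nodup_indexLists _ _) ?_
          rw [E.length_word, mem_indexLists (by omega)]
          exact ⟨hg, h3.2.1⟩
        · rw [List.countP_eq_zero]
          intro g' hg'
          rw [E.length_word, mem_indexLists (by omega)] at hg'
          simp only [Bool.and_eq_true, beq_iff_eq, decide_eq_true_eq]
          rintro ⟨rfl, h4, h5⟩
          exact h3 ⟨h4, hg'.2, h5⟩
      · intro g' hg'
        rw [E.length_word, mem_indexLists (by omega)] at hg'
        simp only [decide_eq_true_eq, Bool.and_eq_true, beq_iff_eq]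
        constructor
        · rintro ⟨h3, h4, h5⟩
          have := code_inj hK1 hg'.1 (fun y hy => (hg'.2 y hy).trans (by omega)) hg hgK h4
          subst this
          exact ⟨rfl, h5, key_inj (slice_lt (E.word_lt b) (by rw [E.length_word]; exact hg'.2))
            (slice_lt (E.word_lt x) (by rwa [E.length_word])) h3⟩
        · rintro ⟨rfl, h3, h4⟩
          exact ⟨by rw [h4], rfl, h3⟩
    · intro l hl he
      obtain ⟨b, hb, rfl⟩ := Presentation.mem_words.1 hl
      exact E.slice_ne_vertex hK x hb hf hfx he
  rw [key a ha hfa, key a' ha' hfa'] at h2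
  convert h2

/-- Two tuples of the same color have equally many tuples of each color in each relation to
them. -/
theorem Presentation.card_stp_eq
    (hK : K = σ.maxArity + 1)
    (hes : (es : Multiset (ℕ × ℕ × ℕ)) = graphEdges E.n K E.words)
    (hcls : Equitable (graphVertices E.n K E.words) es E.vertexLists cls)
    {a a' : Tup V} (ha : a ∈ A.tuples) (ha' : a' ∈ A.tuples)
    (h : cls (E.vertex a) = cls (E.vertex a')) (c : ℕ) (τ : Set (ℕ × ℕ)) (hτ : τ.Nonempty)
    [DecidablePred fun b => cls (E.vertex b) = c ∧ stp a b = τ]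
    [DecidablePred fun b => cls (E.vertex b) = c ∧ stp a' b = τ] :
    (A.tuples.filter fun b => cls (E.vertex b) = c ∧ stp a b = τ).card =
      (A.tuples.filter fun b => cls (E.vertex b) = c ∧ stp a' b = τ).card := by
  classical
  have hatp := E.atp_eq_of_equitable hcls ha ha' h
  have hl := Structure.length_eq_of_atp ha hatp
  have hstp := E.stp_eq_of_equitable hK hes hcls ha ha' h
  have haK := A.arity_pos_le ha
  let U : Finset (ℕ × ℕ) := Finset.range K ×ˢ Finset.range K
  let s : Tup V → Tup V → Finset (ℕ × ℕ) := fun x b => U.filter fun p => p ∈ stp x b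
  have hs : ∀ x ∈ A.tuples, ∀ b ∈ A.tuples, ∀ p, p ∈ s x b ↔ p ∈ stp x b := by
    intro x hx b hb p
    have h1 := A.arity_pos_le hx
    have h2 := A.arity_pos_le hb
    simp only [s, U, Finset.mem_filter, Finset.mem_product, Finset.mem_range, and_iff_right_iff_imp]
    intro hp
    rw [E.mem_stp] at hp
    omega
  have hsτ : ∀ x ∈ A.tuples, ∀ b ∈ A.tuples, ∀ ρ : Finset (ℕ × ℕ), s x b = ρ ↔ stp x b = ρ := by
    intro x hx b hb ρ
    rw [Finset.ext_iff, Set.ext_iff]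
    exact forall_congr' fun p => by rw [hs x hx b hb p, Finset.mem_coe]
  let T := A.tuples.filter fun b => cls (E.vertex b) = c
  -- inclusion of a set of pairs means that two slices agree
  have hsub : ∀ ρ ⊆ U, ρ.Nonempty →
      (T.filter fun b => ρ ⊆ s a b).card = (T.filter fun b => ρ ⊆ s a' b).card := by
    rintro ρ hρ ⟨⟨i0, j0⟩, h0⟩
    have hρK : ∀ p ∈ ρ, p.1 < K ∧ p.2 < K := by
      intro p hp
      simpa only [U, Finset.mem_product, Finset.mem_range] using hρ hp
    by_cases hcons : (∀ p ∈ ρ, p.1 < a.1) ∧ ∀ p ∈ ρ, ∀ p' ∈ ρ, p.2 = p'.2 →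
        (p.1, p'.1) ∈ stp a a
    swap
    · -- a set of pairs that relates a position to unequal entries is never included
      have hemp : ∀ x ∈ A.tuples, x.1 = a.1 → stp x x = stp a a →
          T.filter (fun b => ρ ⊆ s x b) = ∅ := by
        intro x hx hxl hxs
        rw [Finset.filter_eq_empty_iff]
        intro b hb hsb
        have hb' := (Finset.mem_filter.1 hb).1
        have hm : ∀ p ∈ ρ, p ∈ stp x b := fun p hp => (hs x hx b hb' p).1 (hsb hp)
        refine hcons ⟨fun p hp => ?_, fun p hp p' hp' hpp => ?_⟩
        · have := (E.mem_stp x b p).1 (hm p hp)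
          omega
        · have h1 := (E.mem_stp x b p).1 (hm p hp)
          have h2 := (E.mem_stp x b p').1 (hm p' hp')
          rw [← hxs, E.mem_stp]
          exact ⟨h1.1, h2.1, by rw [h1.2.2, h2.2.2, hpp]⟩
      rw [hemp a ha rfl rfl, hemp a' ha' hl.symm hstp.symm]
    obtain ⟨hc1, hc2⟩ := hcons
    have hex : ∀ j, ∃ p ∈ ρ, (∃ i, (i, j) ∈ ρ) → p.2 = j := by
      intro j
      by_cases hj : ∃ i, (i, j) ∈ ρ
      · obtain ⟨i, hi⟩ := hj
        exact ⟨_, hi, fun _ => rfl⟩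
      · exact ⟨_, h0, fun h => absurd h hj⟩
    choose pr hpr hpr2 using hex
    let f : List ℕ := (List.range K).map fun t => (pr t).1
    let g : List ℕ := (List.range K).map fun t => (pr t).2
    have hfl : f.length = K := by simp [f]
    have hgl : g.length = K := by simp [g]
    have hf : ∀ x ∈ f, x < a.1 := by
      intro x hx
      obtain ⟨t, _, rfl⟩ := List.mem_map.1 hx
      exact hc1 _ (hpr t)
    have hg : ∀ x ∈ g, x < K := by
      intro x hx
      obtain ⟨t, _, rfl⟩ := List.mem_map.1 hx
      exact (hρK _ (hpr t)).2
    have hzip : ∀ P : ℕ × ℕ → Prop, (∀ p ∈ f.zip g, P p) ↔ ∀ t < K, P (pr t) := by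
      intro P
      simp only [f, g, List.zip_map', List.mem_map, List.mem_range, forall_exists_index, and_imp,
        forall_apply_eq_imp_iff₂]
    have key : ∀ x ∈ A.tuples, x.1 = a.1 → stp x x = stp a a →
        (T.filter fun b => ρ ⊆ s x b).card = (A.tuples.filter fun b => cls (E.vertex b) = c ∧
          (∀ y ∈ g, y < b.1) ∧ slice (E.word b) g = slice (E.word x) f).card := by
      intro x hx hxl hxs
      rw [Finset.filter_filter]
      congr 1
      refine Finset.filter_congr fun b hb => and_congr_right fun _ => ?_
      rw [E.slice_eq_iff (hfl.trans hgl.symm) (by rwa [hxl]), hzip]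
      constructor
      · intro hsb t _
        exact (hs x hx b hb _).1 (hsb (hpr t))
      · rintro hall ⟨i, j⟩ hp
        have hjK := (hρK _ hp).2
        have h1 := hall j hjK
        have h2 := hpr2 j ⟨i, hp⟩
        have h3 := hc2 _ hp _ (hpr j) h2.symm
        rw [hs x hx b hb]
        rw [← hxs, E.mem_stp] at h3
        rw [E.mem_stp, h2] at h1
        rw [E.mem_stp]
        exact ⟨h3.1, h1.2.1, h3.2.2.trans h1.2.2⟩
    rw [key a ha rfl rfl, key a' ha' hl.symm hstp.symm]
    exact E.card_slice_eq hK hes hcls ha ha' h hfl hf hgl hg c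
  by_cases hfin : ∃ ρ : Finset (ℕ × ℕ), ρ ⊆ U ∧ (ρ : Set (ℕ × ℕ)) = τ
  · obtain ⟨ρ, hρ, rfl⟩ := hfin
    have h1 := card_filter_eq_of_card_filter_subset (s := s a) (s' := s a')
      (fun b _ => Finset.filter_subset _ _) (fun b _ => Finset.filter_subset _ _) hsub hρ
      (Finset.coe_nonempty.1 hτ)
    simp only [T, Finset.filter_filter] at h1
    rw [Finset.filter_congr (q := fun b => cls (E.vertex b) = c ∧ stp a b = ρ) fun b hb =>
      and_congr_right fun _ => hsτ a ha b hb ρ, Finset.filter_congr (q := fun b =>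
        cls (E.vertex b) = c ∧ stp a' b = ρ) fun b hb =>
      and_congr_right fun _ => hsτ a' ha' b hb ρ] at h1
    convert h1
  · have hemp : ∀ x ∈ A.tuples, ∀ b ∈ A.tuples, ¬ (cls (E.vertex b) = c ∧ stp x b = τ) := by
      rintro x hx b hb ⟨_, h2⟩
      refine hfin ⟨s x b, Finset.filter_subset _ _, ?_⟩
      rw [← h2]
      exact ((hsτ x hx b hb _).1 rfl).symm
    rw [Finset.filter_false_of_mem (hemp a ha), Finset.filter_false_of_mem (hemp a' ha')]

/-- Equitable colorings of the graph refine all colorings of Relational Color Refinement. -/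
theorem Presentation.color_eq_of_equitable
    (hK : K = σ.maxArity + 1)
    (hes : (es : Multiset (ℕ × ℕ × ℕ)) = graphEdges E.n K E.words)
    (hcls : Equitable (graphVertices E.n K E.words) es E.vertexLists cls) (i : ℕ)
    {a a' : Tup V} (ha : a ∈ A.tuples) (ha' : a' ∈ A.tuples)
    (h : cls (E.vertex a) = cls (E.vertex a')) : A.color i a = A.color i a' := by
  classical
  induction i generalizing a a' with
  | zero =>
    exact Prod.ext (E.atp_eq_of_equitable hcls ha ha' h)
      (E.stp_eq_of_equitable hK hes hcls ha ha' h)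
  | succ i ih =>
    refine Prod.ext (ih ha ha' h) ?_
    let col : ℕ → Color σ i := fun c => A.color i
      (if hc : ∃ b ∈ A.tuples, cls (E.vertex b) = c then hc.choose else ⟨0, Fin.elim0⟩)
    have hcol : ∀ b ∈ A.tuples, A.color i b = col (cls (E.vertex b)) := by
      intro b hb
      have hc : ∃ b' ∈ A.tuples, cls (E.vertex b') = cls (E.vertex b) := ⟨b, hb, rfl⟩
      simp only [col, dif_pos hc]
      exact ih hb hc.choose_spec.1 hc.choose_spec.2.symm
    have h1 : ∀ x ∈ A.tuples,
        ((A.tuples.filter fun b => (stp x b).Nonempty).val.map fun b =>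
          (stp x b, A.color i b)) =
        ((A.tuples.filter fun b => (stp x b).Nonempty).val.map fun b =>
          (stp x b, cls (E.vertex b))).map fun p => (p.1, col p.2) := by
      intro x hx
      rw [Multiset.map_map]
      refine Multiset.map_congr rfl fun b hb => ?_
      simp only [Function.comp]
      rw [hcol b (Finset.mem_filter.1 hb).1]
    have h2 : ((A.tuples.filter fun b => (stp a b).Nonempty).val.map fun b =>
          (stp a b, cls (E.vertex b))) =
        ((A.tuples.filter fun b => (stp a' b).Nonempty).val.map fun b =>
          (stp a' b, cls (E.vertex b))) := by
      ext ⟨τ, c⟩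
      have h3 : ∀ x : Tup V, Multiset.count (τ, c)
          ((A.tuples.filter fun b => (stp x b).Nonempty).val.map fun b =>
            (stp x b, cls (E.vertex b))) =
          ((A.tuples.filter fun b => (stp x b).Nonempty).filter fun b =>
            (τ, c) = (stp x b, cls (E.vertex b))).card := fun x => Multiset.count_map ..
      rw [h3, h3, Finset.filter_filter, Finset.filter_filter]
      by_cases hτ : τ.Nonempty
      · have h4 := E.card_stp_eq hK hes hcls ha ha' h c τ hτ
        have h5 : ∀ x b : Tup V, ((stp x b).Nonempty ∧ (τ, c) = (stp x b, cls (E.vertex b))) ↔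
            (cls (E.vertex b) = c ∧ stp x b = τ) := by
          intro x b
          rw [Prod.mk.injEq]
          constructor
          · rintro ⟨_, rfl, rfl⟩
            exact ⟨rfl, rfl⟩
          · rintro ⟨rfl, rfl⟩
            exact ⟨hτ, rfl, rfl⟩
        simp only [h5]
        exact h4
      · have h5 : ∀ x b : Tup V, ¬ ((stp x b).Nonempty ∧
            (τ, c) = (stp x b, cls (E.vertex b))) := by
          rintro x b ⟨h6, h7⟩
          rw [Prod.mk.injEq] at h7
          exact hτ (h7.1 ▸ h6)
        simp only [h5]
    have h3 := h1 a ha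
    have h4 := h1 a' ha'
    rw [h2, ← h4] at h3
    simp only [Structure.color]
    convert h3

end refinement

theorem Structure.isStable_stableRound (A : Structure σ V) : A.IsStable A.stableRound := by
  classical
  exact Nat.find_spec A.exists_isStable

/-- The coarsest equitable coloring of the graph is equivalent to the stable coloring. -/
theorem Presentation.stableColor_iff {K : ℕ} (hK : K = σ.maxArity + 1) {es : List (ℕ × ℕ × ℕ)}
    (hes : (es : Multiset (ℕ × ℕ × ℕ)) = graphEdges E.n K E.words) {cls : ℕ → ℕ}
    (hcls : Equitable (graphVertices E.n K E.words) es E.vertexLists cls)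
    (hcoarse : ∀ {α : Type} (h : ℕ → α),
      Equitable (graphVertices E.n K E.words) es E.vertexLists h →
      ∀ u ∈ graphVertices E.n K E.words, ∀ u' ∈ graphVertices E.n K E.words,
        h u = h u' → cls u = cls u')
    {a a' : Tup V} (ha : a ∈ A.tuples) (ha' : a' ∈ A.tuples) :
    cls (E.vertex a) = cls (E.vertex a') ↔ A.stableColor a = A.stableColor a' := by
  constructor
  · exact E.color_eq_of_equitable hK hes hcls _ ha ha'
  · intro h
    refine hcoarse _ (E.graphColor_equitable hK A.isStable_stableRound hes) _ (E.vertex_mem ha) _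
      (E.vertex_mem ha') ?_
    rw [E.graphColor_vertex K _ ha, E.graphColor_vertex K _ ha']
    exact congrArg _ h

end coloring

/-! ### Frames -/

/-- Only the listed variables and arrays may differ. -/
structure Frame (vs : List Var) (as : List Arr) (s s' : St) : Prop where
  raw : s'.raw = s.raw
  v : ∀ x, x ∉ vs → s'.v x = s.v x
  a : ∀ A, A ∉ as → s'.a A = s.a A

theorem Frame.refl (vs : List Var) (as : List Arr) (s : St) : Frame vs as s s :=
  ⟨rfl, fun _ _ => rfl, fun _ _ => rfl⟩

theorem Frame.trans {vs : List Var} {as : List Arr} {s s' s'' : St}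
    (h : Frame vs as s s') (h' : Frame vs as s' s'') : Frame vs as s s'' where
  raw := h'.raw.trans h.raw
  v x hx := (h'.v x hx).trans (h.v x hx)
  a A hA := (h'.a A hA).trans (h.a A hA)

theorem Frame.mono {vs vs' : List Var} {as as' : List Arr} {s s' : St}
    (h : Frame vs as s s') (hv : vs ⊆ vs') (ha : as ⊆ as') : Frame vs' as' s s' where
  raw := h.raw
  v x hx := h.v x fun hm => hx (hv hm)
  a A hA := h.a A fun hm => hA (ha hm)

/-- The operation writes only to the listed variables and arrays. -/
def Op.Only (vs : List Var) (as : List Arr) : Op → Prop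
  | .set x _ | .copy x _ | .addc x _ _ | .subc x _ _ | .add x _ _ | .sub x _ _ | .ld x _ _
  | .rld x _ => x ∈ vs
  | .st A _ _ => A ∈ as
  | .rst _ _ => False

/-- The command writes only to the listed variables and arrays. -/
def Cmd.Only (vs : List Var) (as : List Arr) : Cmd → Prop
  | .skip => True
  | .op o => o.Only vs as
  | .seq c d => c.Only vs as ∧ d.Only vs as
  | .ite _ c d => c.Only vs as ∧ d.Only vs as
  | .loop _ c => c.Only vs as

instance Op.decidableOnly (vs : List Var) (as : List Arr) (o : Op) : Decidable (o.Only vs as) := by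
  cases o <;> unfold Op.Only <;> infer_instance

instance Cmd.decidableOnly (vs : List Var) (as : List Arr) : (c : Cmd) → Decidable (c.Only vs as)
  | .skip => .isTrue trivial
  | .op o => Op.decidableOnly vs as o
  | .seq c d => @instDecidableAnd _ _ (decidableOnly vs as c) (decidableOnly vs as d)
  | .ite _ c d => @instDecidableAnd _ _ (decidableOnly vs as c) (decidableOnly vs as d)
  | .loop _ c => decidableOnly vs as c

theorem Cmd.Only.mono {vs vs' : List Var} {as as' : List Arr} {c : Cmd} (h : c.Only vs as)
    (hv : vs ⊆ vs') (ha : as ⊆ as') : c.Only vs' as' := by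
  induction c with
  | skip => trivial
  | op o => cases o <;> first | exact hv h | exact ha h | exact h
  | seq _ _ h1 h2 => exact ⟨h1 h.1, h2 h.2⟩
  | ite _ _ _ h1 h2 => exact ⟨h1 h.1, h2 h.2⟩
  | loop _ _ h1 => exact h1 h

theorem Op.Only.frame {vs : List Var} {as : List Arr} {o : Op} (h : o.Only vs as) (s : St) :
    Frame vs as s (o.app s) := by
  have hv : ∀ {x : Var} (n : ℕ), x ∈ vs → ∀ y, y ∉ vs → Function.update s.v x n y = s.v y := by
    intro x n hx y hy
    refine Function.update_of_ne ?_ _ _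
    rintro rfl
    exact hy hx
  cases o with
  | st A y z =>
    refine ⟨rfl, fun _ _ => rfl, fun B hB => Function.update_of_ne ?_ _ _⟩
    rintro rfl
    exact hB h
  | rst y z => exact absurd h id
  | _ => exact ⟨rfl, hv _ h, fun _ _ => rfl⟩

theorem IExec.frame {G L : ℕ} {vs : List Var} {as : List Arr} {c : Cmd} {s s' : St}
    (h : IExec G L c s s') (hc : c.Only vs as) : Frame vs as s s' := by
  induction h with
  | skip s => exact Frame.refl vs as s
  | op o s _ => exact Op.Only.frame hc s
  | seq _ _ h1 h2 => exact (h1 hc.1).trans (h2 hc.2)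
  | ite_true _ _ h => exact ⟨(h hc.1).raw, (h hc.1).v, (h hc.1).a⟩
  | ite_false _ _ h => exact ⟨(h hc.2).raw, (h hc.2).v, (h hc.2).a⟩
  | loop_true _ _ _ h1 h2 =>
    exact Frame.trans ⟨(h1 hc).raw, (h1 hc).v, (h1 hc).a⟩ (h2 hc)
  | loop_false _ => exact ⟨rfl, fun _ _ => rfl, fun _ _ => rfl⟩

theorem wp.frame {G L : ℕ} {vs : List Var} {as : List Arr} {c : Cmd} {Q : St → Prop} {s : St}
    (h : wp G L c Q s) (hc : c.Only vs as) :
    wp G L c (fun s' => Q s' ∧ Frame vs as s s') s := by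
  obtain ⟨s', h1, h2⟩ := h
  exact ⟨s', h1, h2, h1.frame hc⟩

/-! ### The program for refinement rounds -/

/-- The partition that is stored in the arrays. -/
def St.part (s : St) : Part :=
  ⟨s.a .ord, s.a .pos, s.a .cls, s.a .cst, s.a .cen, s.a .nxt, s.a .cq, s.v .fresh⟩

/-- The elapsed time, together with the time that is set aside for the visits to the existing
classes in the main loop. -/
def St.cost (s : St) : ℕ := s.tick + 20 * s.v .fresh

/-- The variables that a move may change. -/
def moveVars : List Var := [.cl, .dl, .bd, .pv, .wv, .t1, .fresh]

/-- The variables that the traversal of a list of edges may change. -/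
def chainVars : List Var := moveVars ++ [.vtx, .ed, .t2]

/-- The variables that a round may change. -/
def sourcesVars : List Var := chainVars ++ [.ix, .start]

/-- The variables that a refinement may change. -/
def refineVars : List Var := sourcesVars ++ [.lab]

/-- The arrays that a move may change. -/
def partArrs : List Arr := [.ord, .pos, .cls, .cst, .cen, .nxt, .cq]

/-- Moves the vertex `vtx` in the round that begins with `start`. -/
def moveCmd : Cmd :=
  .seq (ops [.ld .cl .cls .vtx, .ld .dl .nxt .cl])
    (.seq (.ite (.lt .dl .start)
      (ops [.ld .bd .cst .cl, .st .cst .fresh .bd, .st .cen .fresh .bd, .ld .t1 .cq .cl,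
        .st .cq .fresh .t1, .st .nxt .cl .fresh, .set .t1 0, .st .nxt .fresh .t1,
        .addc .fresh .fresh 1]) .skip)
      (ops [.ld .bd .cst .cl, .ld .dl .nxt .cl, .ld .pv .pos .vtx, .ld .wv .ord .bd,
        .st .ord .pv .wv, .st .ord .bd .vtx, .st .pos .wv .pv, .st .pos .vtx .bd,
        .st .cls .vtx .dl, .addc .t1 .bd 1, .st .cst .cl .t1, .st .cen .dl .t1]))

theorem moveCmd_only : moveCmd.Only moveVars partArrs := by decide

theorem Part.move_fresh_le (start : ℕ) (P : Part) (u : ℕ) :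
    (P.move start u).fresh ≤ P.fresh + 1 := by
  simp only [Part.move, Part.shift, Part.ensure]
  split_ifs <;> simp

theorem wp_move {G L : ℕ} {s : St} (hb : s.v .base = L) :
    wp G L moveCmd (fun s' => (s'.part = s.part.move (s.v .start) (s.v .vtx) ∧
      s'.cost ≤ s.cost + 44) ∧ Frame moveVars partArrs s s') s := by
  refine wp.frame ?_ moveCmd_only
  suffices h : wp G L moveCmd (fun s' => s'.part = s.part.move (s.v .start) (s.v .vtx) ∧
      s'.tick ≤ s.tick + 24) s by
    refine h.mono ?_
    rintro s' ⟨h1, h2⟩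
    refine ⟨h1, ?_⟩
    have h3 := Part.move_fresh_le (s.v .start) s.part (s.v .vtx)
    rw [← h1] at h3
    simp only [St.part] at h3
    unfold St.cost
    omega
  have hcen : ∀ (s1 : St), s1.v .base = L → s1.v .cl = s1.a .cls (s1.v .vtx) →
      wp G L (ops [.ld .bd .cst .cl, .ld .dl .nxt .cl, .ld .pv .pos .vtx, .ld .wv .ord .bd,
        .st .ord .pv .wv, .st .ord .bd .vtx, .st .pos .wv .pv, .st .pos .vtx .bd,
        .st .cls .vtx .dl, .addc .t1 .bd 1, .st .cst .cl .t1, .st .cen .dl .t1])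
        (fun s' => s'.part = s1.part.shift (s1.v .vtx) ∧ s'.tick = s1.tick + 12) s1 := by
    intro s1 hb1 hc1
    refine wp_ops ?_ ⟨?_, ?_⟩
    · simp [OpsOk, Op.Ok, Op.app, hb1]
    · simp [Op.app, St.part, Part.shift, hc1]
    · simp [Op.app]
  refine wp_seq (wp_ops (by simp [OpsOk, Op.Ok, Op.app, hb]) ?_)
  refine wp_seq (wp_ite (fun ht => ?_) fun ht => ?_)
  · refine wp_ops (by simp [OpsOk, Op.Ok, Op.app, St.step, hb]) ?_
    refine (hcen _ (by simp [Op.app, St.step, hb]) (by simp [Op.app, St.step])).mono ?_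
    rintro s' ⟨h1, h3⟩
    constructor
    · have ht' : s.part.nxt (s.part.cls (s.v .vtx)) < s.v .start := by
        simpa [Cond.True, Op.app, St.part] using ht
      rw [h1, Part.move, Part.ensure, if_pos ht']
      simp [Op.app, St.part, St.step]
    · rw [h3]
      simp [Op.app, St.step]
  · refine wp_skip ?_
    refine (hcen _ (by simp [Op.app, St.step, hb]) (by simp [Op.app, St.step])).mono ?_
    rintro s' ⟨h1, h3⟩
    constructor
    · have ht' : ¬ s.part.nxt (s.part.cls (s.v .vtx)) < s.v .start := by
        simpa [Cond.True, Op.app, St.part] using ht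
      rw [h1, Part.move, Part.ensure, if_neg ht']
      simp [Op.app, St.part, St.step]
    · rw [h3]
      simp [Op.app, St.step]

/-- The linked list of edges that begins with the edge `e` has the given sources and labels. -/
def Chain (enx esrc elbl : ℕ → ℕ) : ℕ → List (ℕ × ℕ) → Prop
  | e, [] => e = 0
  | e, p :: l => e ≠ 0 ∧ esrc e = p.1 ∧ elbl e = p.2 ∧ Chain enx esrc elbl (enx e) l

/-- The arrays hold the edges `es` as linked lists, one for each target. -/
def St.HasEdges (s : St) (es : List (ℕ × ℕ × ℕ)) : Prop :=
  ∀ v, Chain (s.a .enx) (s.a .esrc) (s.a .elbl) (s.a .head v) (inEdges es v)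

theorem St.HasEdges.of_frame {vs : List Var} {as : List Arr} {s s' : St} {es : List (ℕ × ℕ × ℕ)}
    (h : s.HasEdges es) (hf : Frame vs as s s')
    (has : ∀ A ∈ as, A ≠ .enx ∧ A ≠ .esrc ∧ A ≠ .elbl ∧ A ≠ .head) : s'.HasEdges es := by
  intro v
  rw [hf.a .enx (fun h => (has _ h).1 rfl), hf.a .esrc (fun h => (has _ h).2.1 rfl),
    hf.a .elbl (fun h => (has _ h).2.2.1 rfl), hf.a .head (fun h => (has _ h).2.2.2 rfl)]
  exact h v

/-- Moves the sources of the edges with label `lab` in the linked list that begins with `ed`. -/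
def chainCmd : Cmd :=
  .loop (.nz .ed) (.seq (ops [.ld .t2 .elbl .ed])
    (.seq (.ite (.eq .t2 .lab) (.seq (ops [.ld .vtx .esrc .ed]) moveCmd) .skip)
      (ops [.ld .ed .enx .ed])))

theorem chainCmd_only : chainCmd.Only chainVars partArrs := by decide

/-- Moves the sources of the edges with label `lab` into the vertices in the buffer. -/
def sourcesCmd : Cmd :=
  .seq (ops [.copy .start .fresh, .set .ix 0])
    (.loop (.lt .ix .bn) (.seq (ops [.ld .t2 .buf .ix, .ld .ed .head .t2])
      (.seq chainCmd (ops [.addc .ix .ix 1]))))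

theorem sourcesCmd_only : sourcesCmd.Only sourcesVars partArrs := by decide

/-- Refines the partition with respect to the vertices in the buffer. -/
def refineCmd : Cmd :=
  .seq (ops [.set .lab 0])
    (.loop (.lt .lab .nlab) (.seq sourcesCmd (ops [.addc .lab .lab 1])))

theorem refineCmd_only : refineCmd.Only refineVars partArrs := by decide

theorem wp_chain {G L : ℕ} {s : St} {l : List (ℕ × ℕ)} (hb : s.v .base = L)
    (hl : Chain (s.a .enx) (s.a .esrc) (s.a .elbl) (s.v .ed) l) :
    wp G L chainCmd (fun s' => (s'.part =
      ((l.filter (·.2 = s.v .lab)).map (·.1)).foldl (Part.move (s.v .start)) s.part ∧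
      s'.cost ≤ s.cost + 49 * l.length + 1) ∧ Frame chainVars partArrs s s') s := by
  refine wp.frame ?_ chainCmd_only
  induction l generalizing s with
  | nil =>
    simp only [Chain] at hl
    exact wp_loop_false (by simp [Cond.True, hl])
      ⟨by simp [St.part, St.step], by simp [St.cost, St.step]; omega⟩
  | cons p l ih =>
    obtain ⟨h1, h2, h3, h4⟩ := hl
    refine wp_loop_true (by simpa [Cond.True] using h1) ?_
    refine wp_seq (wp_ops (by simp [OpsOk, Op.Ok, St.step, hb]) ?_)
    refine wp_seq (wp_ite (fun ht => ?_) fun ht => ?_)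
    · have ht' : p.2 = s.v .lab := by simpa [Cond.True, Op.app, St.step, h3] using ht
      refine wp_seq (wp_ops (by simp [OpsOk, Op.Ok, Op.app, St.step, hb]) ?_)
      refine (wp_move (by simp [Op.app, St.step, hb])).mono ?_
      rintro s1 ⟨⟨k1, k2⟩, k3⟩
      have e1 := k3.v .base (by decide)
      have e2 := k3.v .ed (by decide)
      have e3 := k3.v .lab (by decide)
      have e4 := k3.v .start (by decide)
      have a1 := k3.a .enx (by decide)
      have a2 := k3.a .esrc (by decide)
      have a3 := k3.a .elbl (by decide)
      simp [Op.app, St.step, St.cost, St.part, hb, h2] at e1 e2 e3 e4 a1 a2 a3 k1 k2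
      refine wp_ops (by simp [OpsOk, Op.Ok, e1]) ?_
      refine (ih (by simp [Op.app, e1]) (by simp [Op.app, e2, a1, a2, a3, h4])).mono ?_
      rintro s2 ⟨m1, m2⟩
      simp [Op.app, St.cost, St.part] at m1 m2
      refine ⟨?_, ?_⟩
      · simp [St.part, m1, e3, e4, ht', k1]
      · simp [St.cost]; omega
    · have ht' : ¬ p.2 = s.v .lab := by simpa [Cond.True, Op.app, St.step, h3] using ht
      refine wp_skip (wp_ops (by simp [OpsOk, Op.Ok, Op.app, St.step, hb]) ?_)
      refine (ih (by simp [Op.app, St.step, hb]) (by simp [Op.app, St.step, h4])).mono ?_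
      rintro s2 ⟨m1, m2⟩
      simp [Op.app, St.cost, St.part, St.step] at m1 m2
      refine ⟨?_, ?_⟩
      · simp [St.part, m1, ht']
      · simp [St.cost]; omega

/-- The state keeps the vertices of the list `l` in the buffer. -/
def St.Buffer (s : St) (l : List ℕ) : Prop :=
  s.v .bn = l.length ∧ ∀ i, (h : i < l.length) → s.a .buf i = l[i]

theorem wp_sources {G L : ℕ} {s : St} {es : List (ℕ × ℕ × ℕ)} {l : List ℕ} (hb : s.v .base = L)
    (he : s.HasEdges es) (hl : s.Buffer l) :
    wp G L sourcesCmd (fun s' => (s'.part = s.part.round (sources es l (s.v .lab)) ∧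
      s'.cost ≤ s.cost + 54 * (l.map (weight es)).sum + 3) ∧ Frame sourcesVars partArrs s s') s := by
  refine wp.frame ?_ sourcesCmd_only
  refine wp_seq (wp_ops (by simp [OpsOk, Op.Ok]) ?_)
  refine (wp_for (fun k s' => k ≤ l.length ∧ s'.v .ix = l.length - k ∧
    (sources es (l.drop (l.length - k)) (s.v .lab)).foldl (Part.move s.part.fresh) s'.part =
      s.part.round (sources es l (s.v .lab)) ∧
    s'.cost + 54 * ((l.drop (l.length - k)).map (weight es)).sum ≤
      s.cost + 54 * (l.map (weight es)).sum + 2 ∧ s'.v .start = s.v .fresh ∧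
    Frame sourcesVars partArrs s s') (n := l.length) ?_ ?_ ?_)
  · refine ⟨le_rfl, by simp [Op.app], ?_, ?_, by simp [Op.app], ?_⟩
    · simp [Op.app, St.part, Part.round]
    · simp [Op.app, St.cost]; omega
    · exact IExec.frame (G := G) (L := L) (c := ops [.copy .start .fresh, .set .ix 0])
        (.seq (.op _ _ trivial) (.seq (.op _ _ trivial) (.skip _)))
        ⟨by decide, by decide, trivial⟩
  · rintro k s1 ⟨hk, h1, h2, h3, h5, h4⟩
    have hlt : l.length - (k + 1) < l.length := by omega
    have e1 := h4.v .base (by decide)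
    have e2 := h4.v .bn (by decide)
    have e3 := h4.v .lab (by decide)
    have a1 := h4.a .buf (by decide)
    have a2 := h4.a .head (by decide)
    have hE : s1.HasEdges es := he.of_frame h4 (by decide)
    have hd : l.drop (l.length - (k + 1)) = l[l.length - (k + 1)] :: l.drop (l.length - k) := by
      rw [List.drop_eq_getElem_cons hlt]
      congr 2
      omega
    refine ⟨by simp [Cond.True, h1, e2, hl.1]; omega, ?_⟩
    have key := wp.frame (vs := sourcesVars) (as := partArrs)
      (G := G) (L := L) (c := (.seq (ops [.ld .t2 .buf .ix, .ld .ed .head .t2])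
      (.seq chainCmd (ops [.addc .ix .ix 1])))) (s := s1.step) (Q := fun s' => s'.v .ix = l.length - k ∧
      (sources es (l.drop (l.length - k)) (s.v .lab)).foldl (Part.move s.part.fresh) s'.part =
      s.part.round (sources es l (s.v .lab)) ∧
      s'.cost + 54 * ((l.drop (l.length - k)).map (weight es)).sum ≤
      s.cost + 54 * (l.map (weight es)).sum + 2 ∧ s'.v .start = s.v .fresh) ?_ ⟨⟨by decide, by decide, trivial⟩,
        chainCmd_only.mono (List.subset_append_left chainVars [.ix, .start]) (List.Subset.refl _), by decide, trivial⟩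
    · refine key.mono ?_
      rintro s2 ⟨⟨m1, m2, m3, m4⟩, m5⟩
      exact ⟨by omega, m1, m2, m3, m4, h4.trans ⟨m5.raw, m5.v, m5.a⟩⟩
    refine wp_seq (wp_ops (by simp [OpsOk, Op.Ok, Op.app, St.step, e1, hb]) ?_)
    refine wp_seq ((wp_chain (l := inEdges es l[l.length - (k + 1)]) (by simp [Op.app, St.step, e1, hb]) ?_).mono ?_)
    · have := hE l[l.length - (k + 1)]
      simpa [Op.app, St.step, h1, a1, hl.2 _ hlt] using this
    rintro s2 ⟨⟨m1, m2⟩, m3⟩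
    have f1 := m3.v .ix (by decide)
    have f2 := m3.v .start (by decide)
    simp [Op.app, St.step, St.cost, St.part, e3, h5] at f1 f2 m1 m2
    refine wp_ops (by simp [OpsOk, Op.Ok]) ⟨?_, ?_, ?_, ?_⟩
    · simp [Op.app, f1, h1]; omega
    · rw [← h2, hd]
      simp [Op.app, St.part, sources, m1]
    · rw [hd] at h3
      simp [Op.app, St.cost, weight] at h3 ⊢
      omega
    · simp [Op.app, f2]
  · rintro s1 ⟨hk, h1, h2, h3, h5, h4⟩
    have e2 := h4.v .bn (by decide)
    refine ⟨by simp [Cond.True, h1, e2, hl.1], ?_, ?_⟩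
    · simpa [sources, St.part, St.step] using h2
    · simp [St.cost, St.step] at h3 ⊢
      omega

theorem wp_refine {G L : ℕ} {s : St} {es : List (ℕ × ℕ × ℕ)} {l : List ℕ} (hb : s.v .base = L)
    (he : s.HasEdges es) (hl : s.Buffer l) :
    wp G L refineCmd (fun s' => (s'.part = Part.refine es (s.v .nlab) s.part l ∧
      s'.cost ≤ s.cost + s.v .nlab * (54 * (l.map (weight es)).sum + 5) + 2) ∧
      Frame refineVars partArrs s s') s := by
  refine wp.frame ?_ refineCmd_only
  refine wp_seq (wp_ops (by simp [OpsOk, Op.Ok]) ?_)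
  refine (wp_for (fun k s' => k ≤ s.v .nlab ∧ s'.v .lab = s.v .nlab - k ∧
    s'.part = ((List.range (s.v .nlab - k)).map (sources es l)).foldl Part.round s.part ∧
    s'.cost ≤ s.cost + (s.v .nlab - k) * (54 * (l.map (weight es)).sum + 5) + 1 ∧
    Frame refineVars partArrs s s') (n := s.v .nlab) ?_ ?_ ?_)
  · refine ⟨le_rfl, by simp [Op.app], ?_, ?_, ?_⟩
    · simp [Op.app, St.part]
    · simp [Op.app, St.cost]; omega
    · exact IExec.frame (G := G) (L := L) (c := ops [.set .lab 0])
        (.seq (.op _ _ trivial) (.skip _)) ⟨by decide, trivial⟩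
  · rintro k s1 ⟨hk, h1, h2, h3, h4⟩
    have e1 := h4.v .base (by decide)
    have e2 := h4.v .bn (by decide)
    have e3 := h4.v .nlab (by decide)
    have a1 := h4.a .buf (by decide)
    have hE : s1.HasEdges es := he.of_frame h4 (by decide)
    have hB : s1.Buffer l := by
      unfold St.Buffer
      rw [e2, a1]
      exact hl
    refine ⟨by simp [Cond.True, h1, e3]; omega, ?_⟩
    refine wp_seq ((wp_sources (s := s1.step) (e1.trans hb) hE hB).mono ?_)
    rintro s2 ⟨⟨m1, m2⟩, m3⟩
    have f1 := m3.v .lab (by decide)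
    simp [St.step, St.cost, h1] at f1 m1 m2
    obtain ⟨j, hj⟩ : ∃ j, s.v .nlab - k = j + 1 := ⟨s.v .nlab - k - 1, by omega⟩
    have hj' : s.v .nlab - (k + 1) = j := by omega
    rw [hj'] at h1 h2 h3 m1 f1
    rw [hj]
    refine wp_ops (by simp [OpsOk, Op.Ok]) ⟨by omega, ?_, ?_, ?_, ?_⟩
    · simp [Op.app, f1]
    · rw [List.range_succ, List.map_append, List.foldl_append, ← h2]
      simpa [Op.app, St.part] using m1
    · simp [Op.app, St.cost] at h3 ⊢
      rw [add_mul]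
      omega
    · refine (h4.trans (s' := s1) ((⟨m3.raw, m3.v, m3.a⟩ : Frame sourcesVars partArrs s1 s2).mono
        (List.subset_append_left _ _) (List.Subset.refl _))).trans ?_
      exact Op.Only.frame (o := .addc .lab .lab 1) (by decide) s2
  · rintro s1 ⟨hk, h1, h2, h3, h4⟩
    have e2 := h4.v .nlab (by decide)
    refine ⟨by simp [Cond.True, h1, e2], ?_, ?_⟩
    · simpa [Part.refine, St.part, St.step] using h2
    · simp [St.cost, St.step] at h3 ⊢
      omega

/-! ### The main loop -/

section classes

variable {X : Finset ℕ} {N : ℕ} {es : List (ℕ × ℕ × ℕ)} {ls : List (List ℕ)} {S : Blocks}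

/-- A class lies within a block. -/
theorem Blocks.Inv.class_within (h : S.Inv X N es ls) {q i : ℕ} (hq : q < S.qf)
    (hi : S.qlo q ≤ i) (hi' : i < S.qhi q) :
    S.P.cls (S.P.ord i) < S.P.fresh ∧ S.P.cq (S.P.cls (S.P.ord i)) = q ∧
      S.qlo q ≤ S.P.cst (S.P.cls (S.P.ord i)) ∧ S.P.cst (S.P.cls (S.P.ord i)) ≤ i ∧
      i < S.P.cen (S.P.cls (S.P.ord i)) ∧ S.P.cen (S.P.cls (S.P.ord i)) ≤ S.qhi q := by
  obtain ⟨h1, h2⟩ := h.blk q hq i hi hi'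
  have hX := h.good.ord_mem i h1
  have hc := h.good.cls_lt _ hX
  have h3 := h.good.cst_le _ hX
  have h4 := h.good.lt_cen _ hX
  rw [h.good.pos_ord i h1] at h3 h4
  set c := S.P.cls (S.P.ord i) with hcdef
  have key : ∀ j, S.P.cst c ≤ j → j < S.P.cen c → S.qlo q ≤ j ∧ j < S.qhi q := by
    intro j hj hj'
    obtain ⟨k1, k2⟩ := h.good.blk c hc j hj hj'
    have k3 := h.mem _ (h.good.ord_mem j k1)
    rw [h.good.pos_ord j k1] at k3
    have k4 : S.blockOf (S.P.ord j) = q := by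
      rw [← h2]
      simp only [Blocks.blockOf, k2, ← hcdef]
    rwa [k4] at k3
  have k1 := (key (S.P.cst c) le_rfl (by omega)).1
  have k2 := (key (S.P.cen c - 1) (by omega) (by omega)).2
  exact ⟨hc, h2, k1, h3, h4, by omega⟩

/-- A block is simple if its first class fills it. -/
theorem Blocks.Inv.simple (h : S.Inv X N es ls) {q : ℕ} (hq : q < S.qf)
    (hc : S.qhi q ≤ S.P.cen (S.P.cls (S.P.ord (S.qlo q)))) : S.Simple X q := by
  obtain ⟨h1, -, h3, h4, -, -⟩ := h.class_within hq le_rfl (h.lt q hq)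
  have key : ∀ u ∈ X, S.blockOf u = q → S.P.cls u = S.P.cls (S.P.ord (S.qlo q)) := by
    intro u hu hq'
    have k := h.mem u hu
    rw [hq'] at k
    rw [← h.good.ord_pos u hu]
    exact (h.good.blk _ h1 _ (by omega) (by omega)).2
  intro u hu u' hu' huq hu'q
  rw [key u hu huq, key u' hu' hu'q]

/-- If the first class of a block does not fill the block and is not larger than the last class, then
it can be split off. -/
theorem Blocks.Inv.splitsInto (h : S.Inv X N es ls) {q c d : ℕ} (hq : q < S.qf)
    (hc : c = S.P.cls (S.P.ord (S.qlo q))) (hd : d = S.P.cls (S.P.ord (S.qhi q - 1)))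
    (hlt : S.P.cen c < S.qhi q) :
    S.P.cst c = S.qlo q ∧ S.P.cen d = S.qhi q ∧
    (S.P.cen c - S.qlo q ≤ S.qhi q - S.P.cst d → S.SplitsInto c q (S.P.cen c) (S.qhi q)) ∧
    (¬ S.P.cen c - S.qlo q ≤ S.qhi q - S.P.cst d → S.SplitsInto d q (S.qlo q) (S.P.cst d)) := by
  have h0 := h.lt q hq
  obtain ⟨c1, c2, c3, c4, c5, c6⟩ := h.class_within hq le_rfl h0
  obtain ⟨d1, d2, d3, d4, d5, d6⟩ := h.class_within hq (i := S.qhi q - 1) (by omega) (by omega)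
  rw [← hc] at c1 c2 c3 c4 c5 c6
  rw [← hd] at d1 d2 d3 d4 d5 d6
  have hcd : S.P.cen c ≤ S.P.cst d := by
    by_contra hcon
    have k1 := (h.good.blk c c1 (S.P.cst d) (by omega) (by omega)).2
    have k2 := (h.good.blk d d1 (S.P.cst d) (by omega) (by omega)).2
    have : c = d := k1.symm.trans k2
    rw [this] at hlt
    omega
  refine ⟨by omega, by omega, fun hs => ⟨hq, c1, c2, by omega, hlt, fun i => by omega, by omega,
    by omega⟩, fun hs => ⟨hq, d1, d2, by omega, by omega, fun i => by omega, by omega, by omega⟩⟩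

end classes

/-- The partition and the blocks that are stored in the arrays. -/
def St.blocks (s : St) : Blocks := ⟨s.part, s.a .qlo, s.a .qhi, s.v .qfresh⟩

/-- Puts the vertices at the positions from `lo` to `hi - 1` into the buffer. -/
def fillCmd : Cmd :=
  .seq (ops [.set .bn 0])
    (.loop (.lt .lo .hi)
      (ops [.ld .t1 .ord .lo, .st .buf .bn .t1, .addc .bn .bn 1, .addc .lo .lo 1]))

theorem wp_fill {G L : ℕ} {s : St} (hb : s.v .base = L) :
    wp G L fillCmd (fun s' => (s'.Buffer ((List.range' (s.v .lo) (s.v .hi - s.v .lo)).map (s.a .ord)) ∧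
      s'.cost ≤ s.cost + 5 * (s.v .hi - s.v .lo) + 2) ∧ Frame [.bn, .lo, .t1] [.buf] s s') s := by
  refine wp_seq (wp_ops (by simp [OpsOk, Op.Ok]) ?_)
  refine wp_for (fun k s' => k ≤ s.v .hi - s.v .lo ∧ s'.v .bn = s.v .hi - s.v .lo - k ∧
    s'.v .lo = s.v .lo + s'.v .bn ∧ (∀ i < s'.v .bn, s'.a .buf i = s.a .ord (s.v .lo + i)) ∧
    s'.cost ≤ s.cost + 5 * s'.v .bn + 1 ∧ Frame [.bn, .lo, .t1] [.buf] s s')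
    (n := s.v .hi - s.v .lo) ?_ ?_ ?_
  · refine ⟨le_rfl, by simp [Op.app], by simp [Op.app], by simp [Op.app],
      by simp [Op.app, St.cost]; omega, ?_⟩
    exact Op.Only.frame (o := .set .bn 0) (by decide) s
  · rintro k s1 ⟨hk, h1, h2, h3, h4, h5⟩
    have e1 := h5.v .base (by decide)
    have e2 := h5.v .hi (by decide)
    have a1 := h5.a .ord (by decide)
    refine ⟨by simp only [Cond.True]; omega, ?_⟩
    have key := wp.frame (G := G) (L := L) (vs := [.bn, .lo, .t1]) (as := [.buf]) (s := s1.step)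
      (c := ops [.ld .t1 .ord .lo, .st .buf .bn .t1, .addc .bn .bn 1, .addc .lo .lo 1])
      (Q := fun s' => s'.v .bn = s1.v .bn + 1 ∧ s'.v .lo = s1.v .lo + 1 ∧
        s'.a .buf = Function.update (s1.a .buf) (s1.v .bn) (s.a .ord (s1.v .lo)) ∧
        s'.cost = s1.cost + 5)
      (wp_ops (by simp [OpsOk, Op.Ok, Op.app, St.step, e1, hb])
        ⟨by simp [Op.app, St.step], by simp [Op.app, St.step], by simp [Op.app, St.step, a1],
          by simp [Op.app, St.step, St.cost]; omega⟩) (by decide)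
    refine key.mono ?_
    rintro s2 ⟨⟨m1, m2, m3, m4⟩, m5⟩
    refine ⟨by omega, by omega, by omega, fun i hi => ?_, by omega,
      h5.trans (s' := s1) ⟨m5.raw, m5.v, m5.a⟩⟩
    rw [m3, Function.update_apply]
    split_ifs with hi'
    · rw [h2, hi']
    · exact h3 i (by omega)
  · rintro s1 ⟨hk, h1, h2, h3, h4, h5⟩
    have e2 := h5.v .hi (by decide)
    refine ⟨by simp only [Cond.True]; omega, ⟨⟨?_, ?_⟩, ?_⟩, h5.raw, h5.v, h5.a⟩
    · simp [St.step, h1]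
    · intro i hi
      simp at hi ⊢
      exact h3 i (by omega)
    · simp [St.step, St.cost] at h4 ⊢
      omega

/-- Reads the bounds of the block `blk`, its first class and the end of it. -/
def peekCmd : Cmd :=
  ops [.ld .lo .qlo .blk, .ld .hi .qhi .blk, .ld .t1 .ord .lo, .ld .cl .cls .t1, .ld .ce .cen .cl]

/-- The variables describe the block `blk`. -/
structure St.Peek (s : St) : Prop where
  lo : s.v .lo = s.a .qlo (s.v .blk)
  hi : s.v .hi = s.a .qhi (s.v .blk)
  cl : s.v .cl = s.a .cls (s.a .ord (s.v .lo))
  ce : s.v .ce = s.a .cen (s.v .cl)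

theorem wp_peek {G L : ℕ} {s : St} (hb : s.v .base = L) :
    wp G L peekCmd (fun s' => (s'.Peek ∧ s'.cost = s.cost + 5) ∧
      Frame [.lo, .hi, .t1, .cl, .ce] [] s s') s := by
  refine wp.frame (wp_ops (by simp [OpsOk, Op.Ok, Op.app, hb]) ⟨⟨?_, ?_, ?_, ?_⟩, ?_⟩) (by decide)
  · simp [Op.app]
  · simp [Op.app]
  · simp [Op.app]
  · simp [Op.app]
  · simp [Op.app, St.cost]
    omega

/-- Splits the smaller one of the first and the last class off the block `blk`, and refines the
partition with respect to it. -/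
def splitCmd : Cmd :=
  seqs [ops [.subc .t1 .hi 1, .ld .t1 .ord .t1, .ld .dl .cls .t1, .ld .bd .cst .dl,
      .sub .t2 .ce .lo, .sub .t3 .hi .bd],
    .ite (.le .t2 .t3) (ops [.st .qlo .blk .ce, .copy .hi .ce])
      (ops [.st .qhi .blk .bd, .copy .lo .bd, .copy .cl .dl]),
    ops [.st .qlo .qfresh .lo, .st .qhi .qfresh .hi, .st .cq .cl .qfresh,
      .addc .qfresh .qfresh 1],
    fillCmd, refineCmd, peekCmd]

/-- The variables that a split may change. -/
def splitVars : List Var := refineVars ++ [.lo, .hi, .ce, .bn, .qfresh, .t3]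

/-- The variables that the main loop may change. -/
def mainVars : List Var := splitVars ++ [.work, .blk]

/-- The arrays that the main loop may change. -/
def mainArrs : List Arr := partArrs ++ [.qlo, .qhi, .buf]

section

variable {X : Finset ℕ} {N nl : ℕ} {es : List (ℕ × ℕ × ℕ)} {ls : List (List ℕ)} {G L : ℕ} {s : St}

theorem le_sum_weight (l : List ℕ) : l.length ≤ (l.map (weight es)).sum := by
  induction l with
  | nil => simp
  | cons v l ih =>
    simp only [List.map_cons, List.sum_cons, List.length_cons, weight]
    omega

/-- The second half of a split. -/
theorem wp_split_aux (hb : s.v .base = L) (he : s.HasEdges es) {c : ℕ} (hc : s.v .cl = c)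
    (hlo : s.v .lo = s.a .cst c) (hhi : s.v .hi = s.a .cen c) :
    wp G L (seqs [ops [.st .qlo .qfresh .lo, .st .qhi .qfresh .hi, .st .cq .cl .qfresh,
      .addc .qfresh .qfresh 1], fillCmd, refineCmd, peekCmd])
      (fun s' => s'.blocks = ⟨Part.refine es (s.v .nlab)
          { s.part with cq := Function.update s.part.cq c (s.v .qfresh) } (s.part.members c),
          Function.update (s.a .qlo) (s.v .qfresh) (s.part.cst c),
          Function.update (s.a .qhi) (s.v .qfresh) (s.part.cen c), s.v .qfresh + 1⟩ ∧
        s'.Peek ∧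
        s'.cost ≤ s.cost + s.v .nlab * (54 * ((s.part.members c).map (weight es)).sum + 5) +
          5 * ((s.part.members c).map (weight es)).sum + 13) s := by
  refine wp_seqs_cons (wp_ops (by simp [OpsOk, Op.Ok, Op.app, hb]) ?_)
  refine wp_seqs_cons ((wp_fill (by simp [Op.app, hb])).mono ?_)
  rintro s1 ⟨⟨k1, k2⟩, k3⟩
  have hE : s1.HasEdges es := St.HasEdges.of_frame
    (St.HasEdges.of_frame he (IExec.frame (G := G) (L := L) (vs := mainVars) (as := mainArrs)
      (c := ops [.st .qlo .qfresh .lo, .st .qhi .qfresh .hi, .st .cq .cl .qfresh,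
      .addc .qfresh .qfresh 1]) (.seq (.op _ _ hb) (.seq (.op _ _ hb) (.seq (.op _ _ hb) (.seq (.op _ _ trivial)
        (.skip _))))) (by decide)) (by decide)) k3 (by decide)
  have hm : (List.map (s.a .ord) (List.range' (s.v .lo) (s.v .hi - s.v .lo))) = s.part.members c := by
    rw [hlo, hhi]
    rfl
  have hlen : s.v .hi - s.v .lo ≤ ((s.part.members c).map (weight es)).sum := by
    have := le_sum_weight (es := es) (s.part.members c)
    rw [← hm] at this ⊢
    simpa using this
  have e1 := k3.v .base (by decide)
  have e2 := k3.v .nlab (by decide)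
  have e3 := k3.v .qfresh (by decide)
  have e4 := k3.v .fresh (by decide)
  have a1 := k3.a .qlo (by decide)
  have a2 := k3.a .qhi (by decide)
  have hp : s1.part = { s.part with cq := Function.update s.part.cq c (s.v .qfresh) } := by
    simp only [St.part]
    rw [k3.a .ord (by decide), k3.a .pos (by decide), k3.a .cls (by decide), k3.a .cst (by decide),
      k3.a .cen (by decide), k3.a .nxt (by decide), k3.a .cq (by decide), e4]
    simp [Op.app, hc]
  simp [Op.app, St.cost] at e1 e2 e3 a1 a2 k1 k2
  rw [hm] at k1
  refine wp_seqs_cons ((wp_refine (e1.trans hb) hE k1).mono ?_)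
  rintro s2 ⟨⟨m1, m2⟩, m3⟩
  have f1 := m3.v .base (by decide)
  have f2 := m3.v .qfresh (by decide)
  have f3 := m3.a .qlo (by decide)
  have f4 := m3.a .qhi (by decide)
  refine wp_seqs_cons ((wp_peek (f1.trans (e1.trans hb))).mono ?_)
  rintro s3 ⟨⟨n1, n2⟩, n3⟩
  refine wp_seqs_nil ⟨?_, n1, ?_⟩
  · simp only [St.blocks]
    have : s3.part = s2.part := by
      simp only [St.part]
      rw [n3.a .ord (by decide), n3.a .pos (by decide), n3.a .cls (by decide),
        n3.a .cst (by decide), n3.a .cen (by decide), n3.a .nxt (by decide), n3.a .cq (by decide),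
        n3.v .fresh (by decide)]
    rw [this, m1, e2, hp, n3.a .qlo (by decide), n3.a .qhi (by decide), n3.v .qfresh (by decide),
      f3, f4, a1, a2, f2, e3, hlo, hhi]
    rfl
  · rw [e2] at m2
    unfold St.cost at m2 n2 ⊢
    omega

theorem wp_split (hb : s.v .base = L) (he : s.HasEdges es) (hI : s.blocks.Inv X N es ls)
    (hblk : s.v .blk < s.v .qfresh) (hs : s.Peek) (hlt : s.v .ce < s.v .hi)
    (hnl : 0 < s.v .nlab) :
    wp G L splitCmd (fun s' => (∃ c lo hi, s.blocks.SplitsInto c (s.v .blk) lo hi ∧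
      s'.blocks = s.blocks.split es (s.v .nlab) c (s.v .blk) lo hi ∧
      s'.Peek ∧ s'.cost + 1 ≤ s.cost +
        100 * (s.v .nlab * (((s.blocks.P.members c).map (weight es)).sum))) ∧
      Frame splitVars mainArrs s s') s := by
  refine wp.frame ?_ (by decide)
  obtain ⟨p1, p2, p3, p4⟩ := hI.splitsInto (q := s.v .blk) hblk (c := s.v .cl) (by
    rw [hs.cl, hs.lo]; rfl) rfl (by rw [hs.ce, hs.hi] at hlt; exact hlt)
  set d := s.blocks.P.cls (s.blocks.P.ord (s.blocks.qhi (s.v .blk) - 1)) with hd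
  have hd' : s.a .cls (s.a .ord (s.a .qhi (s.v .blk) - 1)) = d := rfl
  have harith : ∀ {c lo hi}, s.blocks.SplitsInto c (s.v .blk) lo hi → ∀ {k : ℕ},
      k ≤ s.cost + s.v .nlab * (54 * ((s.part.members c).map (weight es)).sum + 5) +
          5 * ((s.part.members c).map (weight es)).sum + 23 →
      k + 1 ≤ s.cost +
        100 * (s.v .nlab * (((s.blocks.P.members c).map (weight es)).sum)) := by
    intro c lo hi h k hk
    have h1 := le_sum_weight (es := es) (s.part.members c)
    have h2 : 1 ≤ (s.part.members c).length := by
      have := h.ne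
      simp only [Part.members, List.length_map, List.length_range']
      change s.part.cst c < s.part.cen c at this
      omega
    have h3 : s.blocks.P = s.part := rfl
    rw [h3]
    generalize ((s.part.members c).map (weight es)).sum = W at *
    nlinarith [Nat.mul_le_mul hnl (h2.trans h1), Nat.mul_le_mul hnl (le_refl W),
      Nat.mul_le_mul (le_refl (s.v .nlab)) (h2.trans h1)]
  refine wp_seqs_cons (wp_ops (by simp [OpsOk, Op.Ok, Op.app, hb]) ?_)
  refine wp_seqs_cons (wp_ite (fun ht => ?_) fun ht => ?_)
  · refine wp_ops (by simp [OpsOk, Op.Ok, Op.app, St.step, hb]) ?_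
    simp [Cond.True, Op.app, hs.hi, hs.lo, hs.ce, hd'] at ht
    have hS := p3 (Nat.sub_le_of_le_add ht)
    refine (wp_split_aux (c := s.v .cl) (es := es) ?_ (fun v => by simpa [Op.app, St.step] using he v) ?_ ?_ ?_).mono ?_
    · simp [Op.app, St.step, hb]
    · simp [Op.app, St.step]
    · simp [Op.app, St.step, hs.lo]
      exact p1.symm
    · simp [Op.app, St.step, hs.ce]
    rintro s' ⟨k1, k2, k3⟩
    refine ⟨_, _, _, hS, ?_, k2, harith hS (k3.trans ?_)⟩
    · rw [k1]
      simp [Op.app, St.step, Blocks.split, St.blocks, St.part, hs.ce]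
    · simp [Op.app, St.step, St.cost, St.part]
      omega
  · refine wp_ops (by simp [OpsOk, Op.Ok, Op.app, St.step, hb]) ?_
    simp [Cond.True, Op.app, hs.hi, hs.lo, hs.ce, hd'] at ht
    have hS := p4 (not_le.2 (Nat.lt_sub_of_add_lt ht))
    refine (wp_split_aux (c := d) (es := es) ?_ (fun v => by simpa [Op.app, St.step] using he v) ?_ ?_ ?_).mono ?_
    · simp [Op.app, St.step, hb]
    · simp [Op.app, St.step, hs.hi, hd']
    · simp [Op.app, St.step, hs.hi, hd']
    · simp [Op.app, St.step, hs.hi]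
      exact p2.symm
    rintro s' ⟨k1, k2, k3⟩
    refine ⟨_, _, _, hS, ?_, k2, harith hS (k3.trans ?_)⟩
    · rw [k1]
      simp [Op.app, St.step, Blocks.split, St.blocks, St.part, hs.hi, hd']
    · simp [Op.app, St.step, St.cost, St.part]
      omega

/-- The main loop: visits all classes, and splits the block of the visited class until it is
simple. -/
def mainCmd : Cmd :=
  .seq (ops [.set .work 0]) (.loop (.lt .work .fresh)
    (seqs [ops [.ld .blk .cq .work], peekCmd, .loop (.lt .ce .hi) splitCmd,
      ops [.addc .work .work 1]]))

/-- The main loop turns the initial partition into one that is equitable. -/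
theorem wp_main (hb : s.v .base = L) (hed : s.HasEdges es) (hI : s.blocks.Inv X N es ls)
    (he : ∀ e ∈ es, e.1 ∈ X ∧ e.2.1 < s.v .nlab ∧ e.2.2 ∈ X) (hq : s.v .qfresh = 1)
    (hnl : 0 < s.v .nlab) (hpos : 0 < s.v .fresh) :
    wp G L mainCmd (fun s' => (s'.blocks.Inv X N es ls ∧ Equitable X es ls (s'.a .cls) ∧
      s'.tick ≤ s.cost + 100 * (s.v .nlab * s.blocks.pot X es) + 2) ∧
      Frame mainVars mainArrs s s') s := by
  refine wp.frame ?_ (by decide)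
  obtain ⟨T, hT⟩ : ∃ T, T = s.cost + 100 * (s.v .nlab * s.blocks.pot X es) + 1 := ⟨_, rfl⟩
  refine wp_seq (wp_ops (by simp [OpsOk, Op.Ok]) ?_)
  refine wp_while (fun s' => s'.v .work ≤ s'.v .fresh ∧ s'.blocks.Inv X N es ls ∧
    (∀ q < s'.v .qfresh, s'.blocks.Simple X q ∨ s'.blocks.Pending (s'.v .work) q) ∧
    s'.cost + 100 * (s.v .nlab * s'.blocks.pot X es) ≤ T + 20 * s'.v .work ∧
    Frame mainVars mainArrs s s') (T := T) ?_ ?_ ?_ ?_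
  · refine ⟨by simp [Op.app], ?_, ?_, ?_, Op.Only.frame (o := .set .work 0) (by decide) s⟩
    · simpa [Op.app, St.blocks, St.part] using hI
    · intro q hq'
      refine .inr ⟨0, by simp [Op.app], by simpa [Op.app, St.blocks, St.part] using hpos, ?_⟩
      have h1 := hI.cq_lt 0 hpos
      simp [Op.app, St.blocks, St.part, hq] at h1 hq' ⊢
      omega
    · simp [Op.app, St.cost, St.blocks, St.part, hT]
      omega
  · rintro s1 ⟨h1, h2, h3, h4, h5⟩
    unfold St.cost at h4
    omega
  · rintro s1 ⟨h1, h2, h3, h4, h5⟩ ht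
    have e1 : s1.v .base = L := (h5.v .base (by decide)).trans hb
    have e2 := h5.v .nlab (by decide)
    have hed1 : s1.HasEdges es := hed.of_frame h5 (by decide)
    have hw : s1.v .work < s1.v .fresh := ht
    have hblk : s1.a .cq (s1.v .work) < s1.v .qfresh := h2.cq_lt _ hw
    refine wp.mono (Q := fun s' => ((s'.v .work ≤ s'.v .fresh ∧ s'.blocks.Inv X N es ls ∧
      (∀ q < s'.v .qfresh, s'.blocks.Simple X q ∨ s'.blocks.Pending (s'.v .work) q) ∧
      s'.cost + 100 * (s.v .nlab * s'.blocks.pot X es) ≤ T + 20 * s'.v .work)) ∧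
      Frame mainVars mainArrs s1.step s') (wp.frame ?_ (by decide)) ?_
    swap
    · rintro s' ⟨⟨k1, k2, k3, k4⟩, k5⟩
      exact ⟨k1, k2, k3, k4, h5.trans (s' := s1) ⟨k5.raw, k5.v, k5.a⟩⟩
    refine wp_seqs_cons (wp_ops (by simp [OpsOk, Op.Ok, St.step, e1]) ?_)
    refine wp_seqs_cons ((wp_peek (by simp [Op.app, St.step, e1])).mono ?_)
    rintro s2 ⟨⟨m1, m2⟩, m3⟩
    have hb2 : s2.blocks = s1.blocks := by
      simp only [St.blocks, St.part]
      rw [m3.a .ord (by decide), m3.a .pos (by decide), m3.a .cls (by decide),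
        m3.a .cst (by decide), m3.a .cen (by decide), m3.a .nxt (by decide), m3.a .cq (by decide),
        m3.a .qlo (by decide), m3.a .qhi (by decide), m3.v .fresh (by decide),
        m3.v .qfresh (by decide)]
      simp [Op.app, St.step]
    have f1 := m3.v .work (by decide)
    have f2 := m3.v .blk (by decide)
    have f3 := m3.v .base (by decide)
    have f4 := m3.v .nlab (by decide)
    simp [Op.app, St.step, St.cost] at f1 f2 f3 f4 m2
    have hed2 : s2.HasEdges es := St.HasEdges.of_frame
      (fun v => by simpa [Op.app, St.step] using hed1 v) m3 (by decide)
    refine wp_seqs_cons (wp_while (fun s' => s'.v .work = s1.v .work ∧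
      s'.v .blk < s'.v .qfresh ∧ s1.v .work + 1 ≤ s'.v .fresh ∧
      s'.blocks.Inv X N es ls ∧ s'.Peek ∧
      (∀ q < s'.v .qfresh, q ≠ s'.v .blk → s'.blocks.Simple X q ∨
        s'.blocks.Pending (s1.v .work + 1) q) ∧
      s'.cost + 100 * (s.v .nlab * s'.blocks.pot X es) ≤ T + 20 * s'.v .work + 10 ∧
      s'.v .base = L ∧ s'.v .nlab = s.v .nlab ∧ s'.HasEdges es)
      (T := T + 20 * s1.v .work + 10) ?_ ?_ ?_ ?_)
    · have hfr : s2.v .fresh = s1.v .fresh := congrArg (fun b => b.P.fresh) hb2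
      have hqf : s2.v .qfresh = s1.v .qfresh := congrArg (fun b => b.qf) hb2
      refine ⟨f1, ?_, by omega, by rwa [hb2], m1, ?_, ?_, f3.trans e1, f4.trans e2, hed2⟩
      · rw [f2, hqf]
        exact hblk
      · intro q hq' hne
        rw [hb2]
        refine (h3 q (by omega)).imp id ?_
        rintro ⟨c, c1, c2, c3⟩
        refine ⟨c, ?_, c2, c3⟩
        rcases Nat.lt_or_ge (s1.v .work) c with hc | hc
        · exact hc
        · have hc' : c = s1.v .work := by omega
          rw [hc'] at c3
          exact absurd (c3.symm.trans f2.symm) hne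
      · rw [hb2, f1]
        simp only [St.cost] at h4 ⊢
        omega
    · rintro s3 ⟨n1, n2, n3, n4, n5, n6, n7, n8, n9, n10⟩
      unfold St.cost at n7
      omega
    · rintro s3 ⟨n1, n2, n3, n4, n5, n6, n7, n8, n9, n10⟩ ht'
      have hp : s3.step.Peek := ⟨n5.lo, n5.hi, n5.cl, n5.ce⟩
      refine (wp_split (s := s3.step) n8 n10 n4 n2 hp ht' (by simpa [St.step, n9] using hnl)).mono ?_
      rintro s4 ⟨⟨c, lo, hi, p1, p2, p3, p4⟩, p5⟩
      have g1 := p5.v .base (by decide)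
      have g2 := p5.v .nlab (by decide)
      have g3 := p5.v .work (by decide)
      have g4 := p5.v .blk (by decide)
      change s4.v .base = s3.v .base at g1
      change s4.v .nlab = s3.v .nlab at g2
      change s4.v .work = s3.v .work at g3
      change s4.v .blk = s3.v .blk at g4
      change s3.blocks.SplitsInto c (s3.v .blk) lo hi at p1
      change s4.blocks = s3.blocks.split es (s3.v .nlab) c (s3.v .blk) lo hi at p2
      change s4.cost + 1 ≤ s3.step.cost + 100 * (s3.v .nlab *
        ((s3.blocks.P.members c).map (weight es)).sum) at p4
      rw [n9] at p2 p4
      have hIs := n4.split p1 he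
      have hqf : s4.v .qfresh = s3.v .qfresh + 1 := congrArg (fun b => b.qf) p2
      have hfr : s3.v .fresh ≤ s4.v .fresh := by
        have hG : Part.Good X N { s3.blocks.P with
            cq := Function.update s3.blocks.P.cq c s3.blocks.qf } :=
          ⟨n4.good.pos_lt, n4.good.ord_pos, n4.good.ord_mem, n4.good.pos_ord, n4.good.cls_lt,
            n4.good.cst_le, n4.good.lt_cen, n4.good.le, n4.good.blk, n4.good.nxt_lt⟩
        have h := (hG.refine he (n4.good.members_nodup p1.c_lt)).2.1.fresh_le
        exact h.trans_eq (congrArg (fun b => b.P.fresh) p2).symm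
      have hpot := Blocks.split_pot n4 p1 he
      refine ⟨by omega, by omega, by omega, p2 ▸ hIs, p3, ?_, ?_, by rw [g1, n8], by rw [g2, n9],
        n10.of_frame (s := s3.step) p5 (by decide)⟩
      · intro q hq' hne
        rw [p2]
        exact Blocks.split_pending n4 p1 he n3 n6 (lt_of_lt_of_eq hq' hqf)
          (fun h => hne (h.trans g4.symm))
      · have k1 := Nat.mul_le_mul_left (s.v .nlab) hpot
        rw [mul_add] at k1
        rw [p2, g3]
        have k2 : s3.step.cost = s3.cost + 1 := by
          simp only [St.step, St.cost]
          omega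
        rw [k2] at p4
        omega
    · rintro s3 ⟨n1, n2, n3, n4, n5, n6, n7, n8, n9, n10⟩ ht'
      refine wp_seqs_cons (wp_ops (by simp [OpsOk, Op.Ok]) ?_)
      refine wp_seqs_nil ⟨?_, ?_, ?_, ?_⟩
      · simp [Op.app, St.step]
        omega
      · simpa [Op.app, St.step, St.blocks, St.part] using n4
      · intro q hq'
        by_cases hne : q = s3.v .blk
        · left
          rw [hne]
          refine n4.simple (q := s3.v .blk) n2 ?_
          simp only [Cond.True, not_lt] at ht'
          rw [n5.hi, n5.ce, n5.cl, n5.lo] at ht'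
          exact ht'
        · have h := n6 q hq' hne
          rw [← n1] at h
          exact h
      · simp [Op.app, St.step, St.blocks, St.part, St.cost] at n7 ⊢
        omega
  · rintro s1 ⟨h1, h2, h3, h4, h5⟩ ht
    refine ⟨h2, ?_, ?_⟩
    · refine h2.equitable (fun e hm => (he e hm).2.2) fun q hq => (h3 q hq).resolve_right ?_
      rintro ⟨c, c1, c2, -⟩
      simp only [Cond.True, not_lt] at ht
      exact absurd c2 (not_lt.2 (ht.trans c1))
    · simp [St.step, St.cost] at h4 ⊢
      rw [hT] at h4
      simp only [St.cost] at h4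
      omega

end

/-! ### Reading the input -/

/-- The cells from `p` on hold the list `l`. -/
def Reads (raw : ℕ → ℕ) (p : ℕ) (l : List ℕ) : Prop := ∀ i, (h : i < l.length) → raw (p + i) = l[i]

theorem Reads.cons {raw : ℕ → ℕ} {p x : ℕ} {l : List ℕ} (h : Reads raw p (x :: l)) :
    raw p = x ∧ Reads raw (p + 1) l := by
  refine ⟨h 0 (by simp), fun i hi => ?_⟩
  have := h (i + 1) (by simpa using hi)
  rw [add_assoc, add_comm 1 i]
  simpa using this

theorem Reads.append {raw : ℕ → ℕ} {p : ℕ} {l l' : List ℕ} (h : Reads raw p (l ++ l')) :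
    Reads raw p l ∧ Reads raw (p + l.length) l' := by
  constructor
  · intro i hi
    rw [h i (by rw [List.length_append]; omega), List.getElem_append_left hi]
  · intro i hi
    rw [add_assoc, h (l.length + i) (by rw [List.length_append]; omega)]
    simp

/-- The part of the input word that describes relations, given by their arities and tuples. -/
def relWord (rels : List (ℕ × List (List ℕ))) : List ℕ :=
  rels.flatMap fun r => r.2.length :: r.2.flatten

theorem Cmd.only_seqs {α : Type*} {vs : List Var} {as : List Arr} {f : α → Cmd} {l : List α}
    (h : ∀ x ∈ l, (f x).Only vs as) : (seqs (l.map f)).Only vs as := by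
  induction l with
  | nil => trivial
  | cons x l ih => exact ⟨h x (by simp), ih fun y hy => h y (by simp [hy])⟩

/-- Finds the end of the input, given the arities. -/
def scanCmd (ars : List ℕ) : Cmd :=
  .seq (ops [.set .ptr 1])
    (.seq (seqs (ars.map fun m => .seq (ops [.rld .cnt .ptr, .addc .ptr .ptr 1])
      (.loop (.nz .cnt) (ops [.addc .ptr .ptr m, .subc .cnt .cnt 1]))))
      (ops [.copy .base .ptr]))

theorem scanCmd_only (ars : List ℕ) : (scanCmd ars).Only [.ptr, .cnt, .base] [] :=
  ⟨by decide, Cmd.only_seqs fun m _ => by simp [Cmd.Only, Op.Only, ops], by decide⟩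

/-- The loop that skips `j` tuples of arity `m`. -/
theorem wp_skip_tuples {G L : ℕ} (m : ℕ) {j : ℕ} {s : St} (h : s.v .cnt = j) :
    wp G L (.loop (.nz .cnt) (ops [.addc .ptr .ptr m, .subc .cnt .cnt 1]))
      (fun s' => s'.v .ptr = s.v .ptr + j * m ∧ s'.raw = s.raw ∧
        s'.tick = s.tick + 3 * j + 1) s := by
  induction j generalizing s with
  | zero => exact wp_loop_false (by simp [Cond.True, h]) ⟨by simp [St.step], rfl, by simp [St.step]⟩
  | succ j ih =>
    refine wp_loop_true (by simp [Cond.True, h]) (wp_ops (by simp [OpsOk, Op.Ok]) ?_)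
    refine (ih (by simp [Op.app, St.step, h])).mono ?_
    rintro s' ⟨h1, h2, h3⟩
    refine ⟨?_, ?_, ?_⟩
    · rw [h1]
      simp [Op.app, St.step]
      ring
    · rw [h2]
      simp [Op.app, St.step]
    · rw [h3]
      simp [Op.app, St.step]
      omega

theorem length_flatten_of_forall {m : ℕ} {l : List (List ℕ)} (h : ∀ a ∈ l, a.length = m) :
    l.flatten.length = l.length * m := by
  induction l with
  | nil => simp
  | cons a l ih =>
    rw [List.flatten_cons, List.length_append, h a (by simp), ih fun b hb => h b (by simp [hb]),
      List.length_cons]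
    ring

theorem length_relWord (rels : List (ℕ × List (List ℕ))) :
    (relWord rels).length = (rels.map fun r => 1 + r.2.flatten.length).sum := by
  simp [relWord, List.length_flatMap, add_comm]

theorem length_le_relWord {rels : List (ℕ × List (List ℕ))}
    (hm : ∀ r ∈ rels, 0 < r.1 ∧ ∀ a ∈ r.2, a.length = r.1) :
    (rels.flatMap (·.2)).length ≤ (relWord rels).length := by
  induction rels with
  | nil => simp
  | cons r rels ih =>
    have h1 := ih fun r hr => hm r (by simp [hr])
    obtain ⟨h2, h3⟩ := hm r (by simp)
    have h4 : r.2.length ≤ r.2.length * r.1 := Nat.le_mul_of_pos_right _ h2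
    have h5 := length_flatten_of_forall h3
    simp only [relWord, List.flatMap_cons, List.length_append, List.length_cons] at h1 ⊢
    omega

theorem wp_scan {G L : ℕ} {rels : List (ℕ × List (List ℕ))} {s : St}
    (hr : Reads s.raw 1 (relWord rels)) (hm : ∀ r ∈ rels, 0 < r.1 ∧ ∀ a ∈ r.2, a.length = r.1)
    (hL : 1 + (relWord rels).length = L) :
    wp G L (scanCmd (rels.map (·.1))) (fun s' => (s'.v .base = L ∧ s'.tick ≤ s.tick + 3 * L) ∧
      Frame [.ptr, .cnt, .base] [] s s') s := by
  refine wp.frame ?_ (scanCmd_only _)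
  refine wp_seq (wp_ops (by simp [OpsOk, Op.Ok]) (wp_seq ?_))
  rw [List.map_map]
  refine wp_seqs_map (fun rest s' => Reads s'.raw (s'.v .ptr) (relWord rest) ∧
    (∀ r ∈ rest, 0 < r.1 ∧ ∀ a ∈ r.2, a.length = r.1) ∧
    s'.v .ptr + (relWord rest).length = L ∧ s'.tick + 1 ≤ s.tick + 3 * s'.v .ptr) ?_ ?_ ?_
  · refine ⟨by simpa [Op.app] using hr, hm, by simp [Op.app, hL], by simp [Op.app]⟩
  · rintro ⟨m, ts⟩ rest s1 ⟨h1, h2, h3, h4⟩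
    obtain ⟨hm0, hmt⟩ := h2 (m, ts) (by simp)
    have hw : relWord ((m, ts) :: rest) = ts.length :: (ts.flatten ++ relWord rest) := by
      simp [relWord]
    rw [hw] at h1 h3
    obtain ⟨k1, k2⟩ := h1.cons
    have k3 := k2.append.2
    have hlen := length_flatten_of_forall hmt
    simp only at hlen
    simp only [List.length_cons, List.length_append] at h3
    refine wp_seq (wp_ops (by simp [OpsOk, Op.Ok]; omega) ?_)
    refine (wp_skip_tuples m (j := ts.length) (by simp [Op.app, k1])).mono ?_
    rintro s2 ⟨m1, m2, m3⟩
    simp [Op.app] at m1 m2 m3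
    rw [hlen] at k3 h3
    refine ⟨?_, fun r hr => h2 r (by simp [hr]), by omega, ?_⟩
    · rw [m1, m2]
      exact k3
    · have : ts.length ≤ ts.length * m := Nat.le_mul_of_pos_right _ hm0
      omega
  · rintro s1 ⟨h1, h2, h3, h4⟩
    have h5 : s1.v .ptr = L := by simpa [relWord] using h3
    refine wp_ops (by simp [OpsOk, Op.Ok]) ⟨by simp [Op.app, h5], ?_⟩
    simp [Op.app]
    omega

/-- The table of the multiples of the powers of `n + 1`. -/
structure St.Table (s : St) (n K : ℕ) : Prop where
  n1 : s.v .n1 = n + 1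
  pw : ∀ i < K, ∀ d ≤ n, s.a .pw (i * (n + 1) + d) = d * (n + 1) ^ i

/-- Computes the table of the multiples of the powers of `n + 1`. -/
def tableCmd (K : ℕ) : Cmd :=
  .seq (ops [.set .ptr 0, .rld .n1 .ptr, .addc .n1 .n1 1, .set .pow 1, .set .row 0])
    (seqs ((List.range K).map fun _ => .seq (ops [.set .acc 0, .copy .cnt .n1])
      (.seq (.loop (.nz .cnt) (ops [.st .pw .row .acc, .add .acc .acc .pow, .addc .row .row 1,
        .subc .cnt .cnt 1])) (ops [.copy .pow .acc]))))

theorem tableCmd_only (K : ℕ) :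
    (tableCmd K).Only [.ptr, .n1, .pow, .row, .acc, .cnt] [.pw] :=
  ⟨by decide, Cmd.only_seqs fun m _ => by decide⟩

theorem wp_table {G L n K : ℕ} {s : St} (hL : 0 < L) (hb : s.v .base = L) (hn : s.raw 0 = n)
    (hG : (n + 1) ^ K ≤ G) :
    wp G L (tableCmd K) (fun s' => (s'.Table n K ∧ s'.tick ≤ s.tick + 5 + K * (5 * n + 9)) ∧
      Frame [.ptr, .n1, .pow, .row, .acc, .cnt] [.pw] s s') s := by
  refine wp.frame ?_ (tableCmd_only _)
  refine wp_seq (wp_ops (by simp [OpsOk, Op.Ok, Op.app, hL]) ?_)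
  refine wp_seqs_map (fun rest s' => ∃ j, j + rest.length = K ∧ s'.v .base = L ∧ s'.v .n1 = n + 1 ∧
    s'.v .pow = (n + 1) ^ j ∧ s'.v .row = j * (n + 1) ∧
    (∀ i < j, ∀ d ≤ n, s'.a .pw (i * (n + 1) + d) = d * (n + 1) ^ i) ∧
    s'.tick = s.tick + 5 + j * (5 * n + 9)) ?_ ?_ ?_
  · exact ⟨0, by simp, by simp [Op.app, hb], by simp [Op.app, hn], by simp [Op.app],
      by simp [Op.app], by simp, by simp [Op.app]⟩
  · rintro x rest s1 ⟨j, h1, h2, h3, h4, h5, h6, h7⟩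
    rw [List.length_cons] at h1
    refine wp_seq (wp_ops (by simp [OpsOk, Op.Ok]) (wp_seq ?_))
    refine wp_for (fun k s' => k ≤ n + 1 ∧ s'.v .cnt = k ∧ s'.v .base = L ∧ s'.v .n1 = n + 1 ∧
      s'.v .pow = (n + 1) ^ j ∧ s'.v .row = j * (n + 1) + (n + 1 - k) ∧
      s'.v .acc = (n + 1 - k) * (n + 1) ^ j ∧
      (∀ i < j, ∀ d ≤ n, s'.a .pw (i * (n + 1) + d) = d * (n + 1) ^ i) ∧
      (∀ d, d + k < n + 1 → s'.a .pw (j * (n + 1) + d) = d * (n + 1) ^ j) ∧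
      s'.tick = s1.tick + 2 + (n + 1 - k) * 5) (n := n + 1) ?_ ?_ ?_
    · refine ⟨le_rfl, by simp [Op.app, h3], by simp [Op.app, h2], by simp [Op.app, h3],
        by simp [Op.app, h4], by simp [Op.app, h5], by simp [Op.app], by simpa [Op.app] using h6,
        fun d hd => by omega, by simp [Op.app]⟩
    · rintro k s2 ⟨k1, k2, k3, k4, k5, k6, k7, k8, k9, k10⟩
      refine ⟨by simp [Cond.True, k2], wp_ops ?_ ?_⟩
      · simp only [OpsOk, Op.Ok, Op.app, St.step, k3, k5, k7]
        refine ⟨trivial, ?_, trivial, trivial, trivial⟩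
        have h : (n + 1) ^ (j + 1) ≤ (n + 1) ^ K := Nat.pow_le_pow_right (by omega) (by omega)
        rw [pow_succ] at h
        have h' : (n + 1 - (k + 1) + 1) * (n + 1) ^ j ≤ (n + 1) * (n + 1) ^ j :=
          Nat.mul_le_mul_right _ (by omega)
        rw [add_mul] at h'
        nlinarith
      · have e1 : n + 1 - k = n + 1 - (k + 1) + 1 := by omega
        refine ⟨by omega, by simp [Op.app, St.step, k2], by simp [Op.app, St.step, k3],
          by simp [Op.app, St.step, k4], by simp [Op.app, St.step, k5], ?_, ?_, ?_, ?_, ?_⟩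
        · simp [Op.app, St.step, k6]
          omega
        · rw [e1, add_mul]
          simp [Op.app, St.step, k7, k5]
        · intro i hi d hd
          have h : i * (n + 1) + d ≠ s2.v .row := by
            rw [k6]
            have : (i + 1) * (n + 1) ≤ j * (n + 1) := Nat.mul_le_mul_right _ hi
            rw [add_mul] at this
            omega
          simp [Op.app, St.step, h, k8 i hi d hd]
        · intro d hd
          rcases Nat.lt_or_ge (d + (k + 1)) (n + 1) with hd' | hd'
          · have h : j * (n + 1) + d ≠ s2.v .row := by omega
            simp [Op.app, St.step, h, k9 d hd']
          · have h : j * (n + 1) + d = s2.v .row := by omega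
            have h' : d = n + 1 - (k + 1) := by omega
            rw [h]
            simp [Op.app, St.step, k7, h']
        · rw [e1]
          simp [Op.app, St.step, k10]
          omega
    · rintro s2 ⟨k1, k2, k3, k4, k5, k6, k7, k8, k9, k10⟩
      refine ⟨by simp [Cond.True, k2], wp_ops (by simp [OpsOk, Op.Ok]) ?_⟩
      refine ⟨j + 1, by omega, by simp [Op.app, St.step, k3], by simp [Op.app, St.step, k4], ?_, ?_,
        ?_, ?_⟩
      · simp [Op.app, St.step, k7, pow_succ]
        ring
      · simp [Op.app, St.step, k6]
        ring
      · intro i hi d hd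
        rcases Nat.lt_succ_iff_lt_or_eq.1 hi with hi' | rfl
        · simpa [Op.app, St.step] using k8 i hi' d hd
        · simpa [Op.app, St.step] using k9 d (by omega)
      · simp [Op.app, St.step, k10, h7]
        ring
  · rintro s1 ⟨j, h1, h2, h3, h4, h5, h6, h7⟩
    have hj : j = K := by simpa using h1
    subst hj
    exact ⟨⟨h3, h6⟩, h7.le⟩

/-- Computes the key of the list of the entries at the positions `f` of the tuple at `src`. -/
def keyCmd (f : List ℕ) : Cmd :=
  .seq (ops [.set .acc 0, .set .row 1])
    (seqs (f.map fun i => ops [.addc .t1 .src i, .rld .t1 .t1, .add .t1 .t1 .row, .ld .t1 .pw .t1,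
      .add .acc .acc .t1, .add .row .row .n1]))

theorem keyCmd_only (f : List ℕ) : (keyCmd f).Only [.acc, .row, .t1] [] :=
  ⟨by decide, Cmd.only_seqs fun i _ => by simp [Cmd.Only, Op.Only, ops]⟩

theorem key_append (n : ℕ) (l : List ℕ) (x : ℕ) :
    key n (l ++ [x]) = key n l + (x + 1) * (n + 1) ^ l.length := by
  simp [key, Nat.ofDigits_append, mul_comm]

theorem key_lt {n : ℕ} {l : List ℕ} (h : ∀ x ∈ l, x < n) : key n l < (n + 1) ^ l.length ∨ n = 0 := by
  rcases Nat.eq_zero_or_pos n with rfl | hn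
  · exact .inr rfl
  · left
    have := Nat.ofDigits_lt_base_pow_length (b := n + 1) (l := l.map (· + 1)) (by omega) (by
      simpa using h)
    simpa [key] using this

theorem wp_key {G L n K : ℕ} {s : St} {a f : List ℕ} (hb : s.v .base = L) (ht : s.Table n K)
    (hr : Reads s.raw (s.v .src) a) (hL : s.v .src + a.length ≤ L) (ha : ∀ x ∈ a, x < n)
    (hf : ∀ x ∈ f, x < a.length) (hK : f.length ≤ K) (hG : (n + 1) ^ K + (K + 1) * (n + 1) ≤ G) :
    wp G L (keyCmd f) (fun s' => (s'.v .acc = key n (slice a f) ∧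
      s'.tick = s.tick + 2 + 6 * f.length) ∧ Frame [.acc, .row, .t1] [] s s') s := by
  refine wp.frame ?_ (keyCmd_only _)
  refine wp_seq (wp_ops (by simp [OpsOk, Op.Ok]) ?_)
  refine wp_seqs_map (fun rest s' => ∃ g, g ++ rest = f ∧ s'.v .acc = key n (slice a g) ∧
    s'.v .row = g.length * (n + 1) + 1 ∧ s'.tick = s.tick + 2 + 6 * g.length ∧
    Frame [.acc, .row, .t1] [] s s') ?_ ?_ ?_
  · refine ⟨[], rfl, by simp [Op.app, slice, key], by simp [Op.app], by simp [Op.app], ?_⟩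
    exact IExec.frame (G := G) (L := L) (c := ops [.set .acc 0, .set .row 1])
      (.seq (.op _ _ trivial) (.seq (.op _ _ trivial) (.skip _))) (by decide)
  · rintro i rest s1 ⟨g, h1, h2, h3, h4, h5⟩
    have hi : i < a.length := hf i (by rw [← h1]; simp)
    have hx : a.getD i 0 < n := by
      rw [List.getD_eq_getElem _ _ hi]
      exact ha _ (List.getElem_mem _)
    have e1 := h5.v .base (by decide)
    have e2 := h5.v .src (by decide)
    have e3 := h5.v .n1 (by decide)
    have a1 := h5.a .pw (by decide)
    have hg : g.length + 1 + rest.length = f.length := by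
      rw [← h1]
      simp
      omega
    have hraw : s1.raw (s1.v .src + i) = a.getD i 0 := by
      rw [h5.raw, e2, hr i hi, List.getD_eq_getElem _ _ hi]
    have hidx : a.getD i 0 + (g.length * (n + 1) + 1) = g.length * (n + 1) + (a.getD i 0 + 1) := by
      omega
    have hpw : s1.a .pw (a.getD i 0 + (g.length * (n + 1) + 1)) =
        (a.getD i 0 + 1) * (n + 1) ^ g.length := by
      rw [a1, hidx, ht.pw _ (by omega) _ (by omega)]
    have hkey : key n (slice a g) + (a.getD i 0 + 1) * (n + 1) ^ g.length =
        key n (slice a (g ++ [i])) := by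
      have : slice a (g ++ [i]) = slice a g ++ [a.getD i 0] := by simp [slice]
      rw [this, key_append, length_slice]
    have hle : key n (slice a (g ++ [i])) ≤ (n + 1) ^ K := by
      have h := (key_lt (n := n) (l := slice a (g ++ [i])) (slice_lt ha fun x hx => hf x (by
        rw [← h1]
        simp at hx ⊢
        tauto))).resolve_right (by omega)
      rw [length_slice] at h
      refine h.le.trans (Nat.pow_le_pow_right (by omega) ?_)
      simp
      omega
    have hrow : (g.length + 1) * (n + 1) ≤ K * (n + 1) := Nat.mul_le_mul_right _ (by omega)
    rw [add_mul] at hrow hG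
    have key : wp G L (ops [.addc .t1 .src i, .rld .t1 .t1, .add .t1 .t1 .row, .ld .t1 .pw .t1,
      .add .acc .acc .t1, .add .row .row .n1]) (fun s' =>
        s'.v .acc = RCR.key n (slice a (g ++ [i])) ∧
        s'.v .row = (g ++ [i]).length * (n + 1) + 1 ∧
        s'.tick = s.tick + 2 + 6 * (g ++ [i]).length) s1 := by
      refine wp_ops ?_ ⟨?_, ?_, ?_⟩
      · simp [OpsOk, Op.Ok, Op.app, e1, hb, -List.getD_eq_getElem?_getD, hraw, h3, hpw, h2, hkey,
          e3, ht.n1]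
        omega
      · simp [Op.app, -List.getD_eq_getElem?_getD, hraw, h3, hpw, h2, hkey]
      · simp [Op.app, h3, e3, ht.n1]
        ring
      · simp [Op.app, h4]
        ring
    refine (key.frame (vs := [.acc, .row, .t1]) (as := []) (by simp [Cmd.Only, Op.Only, ops])).mono ?_
    rintro s2 ⟨⟨m1, m2, m3⟩, m4⟩
    exact ⟨g ++ [i], by simpa using h1, m1, m2, m3, h5.trans m4⟩
  · rintro s1 ⟨g, h1, h2, h3, h4, h5⟩
    rw [List.append_nil] at h1
    exact ⟨h1 ▸ h2, h1 ▸ h4⟩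

/-! ### Building the graph -/

/-- The arrays hold the vertices `X`, in the order of their discovery, and the edges `es`, of which
those with numbers above `edges` are unused. -/
structure St.Store (s : St) (X : Finset ℕ) (es : List (ℕ × ℕ × ℕ)) : Prop where
  seen : ∀ v, s.a .seen v ≠ 0 ↔ v ∈ X
  size : s.v .size = X.card
  ord_mem : ∀ i < X.card, s.a .ord i ∈ X
  pos_ord : ∀ i < X.card, s.a .pos (s.a .ord i) = i
  pos_lt : ∀ v ∈ X, s.a .pos v < X.card
  ord_pos : ∀ v ∈ X, s.a .ord (s.a .pos v) = v
  edges : s.HasEdges es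
  head_le : ∀ v, s.a .head v ≤ s.v .edges
  enx_le : ∀ e ≤ s.v .edges, s.a .enx e ≤ s.v .edges

theorem St.Store.of_frame {vs : List Var} {as : List Arr} {s s' : St} {X : Finset ℕ}
    {es : List (ℕ × ℕ × ℕ)} (h : s.Store X es) (hf : Frame vs as s s')
    (hv : .size ∉ vs ∧ .edges ∉ vs) (ha : ∀ A ∈ as, A ≠ .seen ∧ A ≠ .ord ∧ A ≠ .pos ∧ A ≠ .enx ∧
      A ≠ .esrc ∧ A ≠ .elbl ∧ A ≠ .head) : s'.Store X es := by
  have h1 := hf.a .seen fun hm => (ha _ hm).1 rfl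
  have h2 := hf.a .ord fun hm => (ha _ hm).2.1 rfl
  have h3 := hf.a .pos fun hm => (ha _ hm).2.2.1 rfl
  have h4 := hf.a .enx fun hm => (ha _ hm).2.2.2.1 rfl
  have h5 := hf.a .head fun hm => (ha _ hm).2.2.2.2.2.2 rfl
  have h6 := hf.v _ hv.1
  have h7 := hf.v _ hv.2
  refine ⟨?_, ?_, ?_, ?_, ?_, ?_, h.edges.of_frame hf fun A hA => (ha A hA).2.2.2, ?_, ?_⟩
  · rw [h1]; exact h.seen
  · rw [h6]; exact h.size
  · rw [h2]; exact h.ord_mem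
  · rw [h2, h3]; exact h.pos_ord
  · rw [h3]; exact h.pos_lt
  · rw [h2, h3]; exact h.ord_pos
  · rw [h5, h7]; exact h.head_le
  · rw [h4, h7]; exact h.enx_le

/-- Adds the vertex `acc`, unless it is there. -/
def addVertexCmd : Cmd :=
  .seq (ops [.ld .t1 .seen .acc])
    (.ite (.nz .t1) .skip (ops [.set .t1 1, .st .seen .acc .t1, .st .ord .size .acc,
      .st .pos .acc .size, .addc .size .size 1]))

theorem wp_addVertex {G L : ℕ} {s : St} {X : Finset ℕ} {es : List (ℕ × ℕ × ℕ)}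
    (hb : s.v .base = L) (h : s.Store X es) :
    wp G L addVertexCmd (fun s' => (s'.Store (insert (s.v .acc) X) es ∧ s'.tick ≤ s.tick + 7) ∧
      Frame [.t1, .size] [.seen, .ord, .pos] s s') s := by
  refine wp.frame ?_ (by decide)
  refine wp_seq (wp_ops (by simp [OpsOk, Op.Ok, hb]) (wp_ite (fun ht => ?_) fun ht => ?_))
  · have hm : s.v .acc ∈ X := by
      rw [← h.seen]
      simpa [Cond.True, Op.app] using ht
    rw [Finset.insert_eq_of_mem hm]
    refine wp_skip ⟨?_, by simp [Op.app, St.step]⟩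
    have hf : Frame [.t1] [] s (Op.app s (.ld .t1 .seen .acc)) := Op.Only.frame (by decide) s
    exact h.of_frame (vs := [.t1]) (as := []) ⟨hf.raw, hf.v, hf.a⟩ (by decide) (by decide)
  · have hm : s.v .acc ∉ X := by
      rw [← h.seen]
      simpa [Cond.True, Op.app] using ht
    have hc : (insert (s.v .acc) X).card = X.card + 1 := Finset.card_insert_of_notMem hm
    refine wp_ops (by simp [OpsOk, Op.Ok, Op.app, St.step, hb]) ⟨⟨?_, ?_, ?_, ?_, ?_, ?_, ?_, ?_, ?_⟩,
      by simp [Op.app, St.step]⟩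
    · intro v
      simp only [Finset.mem_insert, ← h.seen]
      by_cases hv : v = s.v .acc <;> simp [Op.app, St.step, hv]
    · simp [Op.app, St.step, hc, h.size]
    · intro i hi
      by_cases hv : i = X.card
      · simp [Op.app, St.step, hv, h.size]
      · have := h.ord_mem i (by omega)
        simp [Op.app, St.step, hv, h.size, this]
    · intro i hi
      by_cases hv : i = X.card
      · simp [Op.app, St.step, hv, h.size]
      · have h1 := h.ord_mem i (by omega)
        have h2 := h.pos_ord i (by omega)
        have h3 : s.a .ord i ≠ s.v .acc := fun h => hm (h ▸ h1)
        simp [Op.app, St.step, hv, h.size, h2, h3]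
    · intro v hv
      rw [hc]
      by_cases hv' : v = s.v .acc
      · simp [Op.app, St.step, hv', h.size]
      · have h1 := h.pos_lt v ((Finset.mem_insert.1 hv).resolve_left hv')
        simp [Op.app, St.step, hv']
        omega
    · intro v hv
      by_cases hv' : v = s.v .acc
      · simp [Op.app, St.step, hv', h.size]
      · have hvX := (Finset.mem_insert.1 hv).resolve_left hv'
        have h1 := h.pos_lt v hvX
        have h2 := h.ord_pos v hvX
        have h3 : s.a .pos v ≠ X.card := by omega
        simp [Op.app, St.step, hv', h.size, h2, h3]
    · intro v
      simpa [Op.app, St.step] using h.edges v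
    · simpa [Op.app, St.step] using h.head_le
    · simpa [Op.app, St.step] using h.enx_le

/-- Adds an edge from `x` to `y` with label `l`. -/
def addEdgeCmd (x : Var) (l : ℕ) (y : Var) : Cmd :=
  ops [.addc .edges .edges 1, .st .esrc .edges x, .set .t1 l, .st .elbl .edges .t1,
    .ld .t1 .head y, .st .enx .edges .t1, .st .head y .edges]

theorem addEdgeCmd_only (x : Var) (l : ℕ) (y : Var) :
    (addEdgeCmd x l y).Only [.edges, .t1] [.esrc, .elbl, .enx, .head] := by
  simp [addEdgeCmd, ops, Cmd.Only, Op.Only]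

/-- A linked list does not change if only cells that it does not use are changed. -/
theorem Chain.congr {enx esrc elbl enx' esrc' elbl' : ℕ → ℕ} {m : ℕ} (hm : ∀ e ≤ m, enx e ≤ m)
    (h1 : ∀ e ≤ m, enx' e = enx e) (h2 : ∀ e ≤ m, esrc' e = esrc e) (h3 : ∀ e ≤ m, elbl' e = elbl e)
    {e : ℕ} {l : List (ℕ × ℕ)} (he : e ≤ m) (h : Chain enx esrc elbl e l) :
    Chain enx' esrc' elbl' e l := by
  induction l generalizing e with
  | nil => exact h
  | cons p l ih =>
    refine ⟨h.1, (h2 e he).trans h.2.1, (h3 e he).trans h.2.2.1, ?_⟩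
    rw [h1 e he]
    exact ih (hm e he) h.2.2.2

/-- The new edge becomes the head of the linked list of its target, and its number was not in use. -/
theorem wp_addEdge {G L : ℕ} {s : St} {X : Finset ℕ} {es : List (ℕ × ℕ × ℕ)}
    (hb : s.v .base = L) (h : s.Store X es) {x y : Var} {l : ℕ} (hx : x ≠ .t1 ∧ x ≠ .edges)
    (hy : y ≠ .t1 ∧ y ≠ .edges) :
    wp G L (addEdgeCmd x l y) (fun s' => (s'.Store X ((s.v x, l, s.v y) :: es) ∧
      s'.tick = s.tick + 7) ∧ Frame [.edges, .t1] [.esrc, .elbl, .enx, .head] s s') s := by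
  refine wp.frame ?_ (addEdgeCmd_only x l y)
  refine wp_ops (by simp [OpsOk, Op.Ok, Op.app, hb]) ⟨⟨?_, ?_, ?_, ?_, ?_, ?_, ?_, ?_, ?_⟩,
    by simp [Op.app]⟩
  · simpa [Op.app] using h.seen
  · simpa [Op.app] using h.size
  · simpa [Op.app] using h.ord_mem
  · simpa [Op.app] using h.pos_ord
  · simpa [Op.app] using h.pos_lt
  · simpa [Op.app] using h.ord_pos
  · intro v
    have hc : ∀ v, Chain (Function.update (s.a .enx) (s.v .edges + 1) (s.a .head (s.v y)))
        (Function.update (s.a .esrc) (s.v .edges + 1) (s.v x))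
        (Function.update (s.a .elbl) (s.v .edges + 1) l) (s.a .head v) (inEdges es v) := by
      intro v
      have hne : ∀ e ≤ s.v .edges, e ≠ s.v .edges + 1 := fun e he => by omega
      exact Chain.congr h.enx_le (fun e he => Function.update_of_ne (hne e he) _ _)
        (fun e he => Function.update_of_ne (hne e he) _ _)
        (fun e he => Function.update_of_ne (hne e he) _ _) (h.head_le v) (h.edges v)
    by_cases hv : v = s.v y
    · have hin : inEdges ((s.v x, l, s.v y) :: es) v = (s.v x, l) :: inEdges es v := by
        simp [inEdges, hv]
      rw [hin]
      refine ⟨?_, ?_, ?_, ?_⟩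
      · simp [Op.app, hv, hy]
      · simp [Op.app, hv, hx, hy]
      · simp [Op.app, hv, hy]
      · have := hc v
        simpa [Op.app, hv, hx, hy] using this
    · have hin : inEdges ((s.v x, l, s.v y) :: es) v = inEdges es v := by
        simp [inEdges, Ne.symm hv]
      rw [hin]
      have := hc v
      simpa [Op.app, hv, hx, hy] using this
  · intro v
    have := h.head_le v
    by_cases hv : v = s.v y
    · simp [Op.app, hy, hv]
    · simp [Op.app, hy, hv]
      omega
  · intro e he
    by_cases hv : e = s.v .edges + 1
    · have := h.head_le (s.v y)
      simp [Op.app, hy, hv]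
      omega
    · have := h.enx_le e (by simp [Op.app] at he; omega)
      simp [Op.app, hv]
      omega

/-- The variable `src` has the address of the tuple `a`. -/
structure St.AtTuple (s : St) (n K L : ℕ) (a : List ℕ) : Prop where
  base : s.v .base = L
  table : s.Table n K
  reads : Reads s.raw (s.v .src) a
  le : s.v .src + a.length ≤ L

theorem St.AtTuple.of_frame {vs : List Var} {as : List Arr} {s s' : St} {n K L : ℕ} {a : List ℕ}
    (h : s.AtTuple n K L a) (hf : Frame vs as s s')
    (hv : .base ∉ vs ∧ .n1 ∉ vs ∧ .src ∉ vs) (ha : .pw ∉ as) : s'.AtTuple n K L a := by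
  have h1 := hf.v _ hv.1
  have h2 := hf.v _ hv.2.1
  have h3 := hf.v _ hv.2.2
  have h4 := hf.a _ ha
  refine ⟨h1.trans h.base, ⟨h2.trans h.table.n1, ?_⟩, ?_, ?_⟩
  · rw [h4]; exact h.table.pw
  · rw [h3, hf.raw]; exact h.reads
  · rw [h3]; exact h.le

/-- The variables that adding vertices and edges may change. -/
def graphVars : List Var := [.acc, .row, .t1, .t2, .size, .edges, .skey]

/-- The arrays that adding vertices and edges may change. -/
def graphArrs : List Arr := [.seen, .ord, .pos, .head, .esrc, .elbl, .enx]

/-- Adds the slice of a tuple that is given by the positions `f`, and its edges. -/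
def addSliceCmd (K : ℕ) (f : List ℕ) : Cmd :=
  seqs [keyCmd f, ops [.copy .skey .acc], addVertexCmd, addEdgeCmd .key (code K f) .skey,
    addEdgeCmd .skey (code K f) .key]

theorem addSliceCmd_only (K : ℕ) (f : List ℕ) : (addSliceCmd K f).Only graphVars graphArrs :=
  ⟨(keyCmd_only f).mono (by decide) (by decide), by decide, by decide,
    (addEdgeCmd_only _ _ _).mono (by decide) (by decide),
    (addEdgeCmd_only _ _ _).mono (by decide) (by decide), trivial⟩

/-- Adds the loop at a tuple for a pair of positions, if its entries there are equal. -/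
def addLoopCmd (K : ℕ) (p : ℕ × ℕ) : Cmd :=
  .seq (ops [.addc .t1 .src p.1, .rld .t1 .t1, .addc .t2 .src p.2, .rld .t2 .t2])
    (.ite (.eq .t1 .t2) (addEdgeCmd .key (pairCode K p) .key) .skip)

theorem addLoopCmd_only (K : ℕ) (p : ℕ × ℕ) : (addLoopCmd K p).Only graphVars graphArrs :=
  ⟨by simp [Cmd.Only, ops, Op.Only, graphVars],
    (addEdgeCmd_only _ _ _).mono (by decide) (by decide), trivial⟩

section

variable {G L n K : ℕ} {s : St} {a : List ℕ} {X : Finset ℕ} {es : List (ℕ × ℕ × ℕ)}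

theorem wp_addSlice (hs : s.AtTuple n K L a) (hk : s.v .key = key n a) (h : s.Store X es)
    (ha : ∀ x ∈ a, x < n) (hG : (n + 1) ^ K + (K + 1) * (n + 1) ≤ G) {f : List ℕ}
    (hf : ∀ x ∈ f, x < a.length) (hfK : f.length = K) :
    wp G L (addSliceCmd K f) (fun s' => (∃ es' : List (ℕ × ℕ × ℕ), (es' : Multiset (ℕ × ℕ × ℕ)) =
        ↑(sliceEdges n K a f) + ↑es ∧ s'.Store (insert (key n (slice a f)) X) es' ∧
        s'.tick ≤ s.tick + (6 * K + 24)) ∧ Frame graphVars graphArrs s s') s := by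
  refine wp.frame ?_ (addSliceCmd_only K f)
  refine wp_seqs_cons ((wp_key hs.base hs.table hs.reads hs.le ha hf hfK.le hG).mono ?_)
  rintro s1 ⟨⟨h1, h2⟩, h3⟩
  have b1 := h3.v .base (by decide)
  have k1 := h3.v .key (by decide)
  have h4 := h.of_frame h3 (by decide) (by decide)
  refine wp_seqs_cons (wp_ops (by simp [OpsOk, Op.Ok]) ?_)
  have h4' : (List.foldl Op.app s1 [.copy .skey .acc]).Store X es :=
    h4.of_frame (Op.Only.frame (vs := [.skey]) (as := []) (o := .copy .skey .acc) (by decide) s1)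
      (by decide) (by decide)
  refine wp_seqs_cons ((wp_addVertex (by simp [Op.app, b1, hs.base]) h4').mono ?_)
  rintro s2 ⟨⟨m1, m2⟩, m3⟩
  have b2 := m3.v .base (by decide)
  have k2 := m3.v .key (by decide)
  have l2 := m3.v .skey (by decide)
  simp [Op.app] at m1 m2 b2 k2 l2
  have hb2 : s2.v .base = L := by rw [b2, b1, hs.base]
  refine wp_seqs_cons ((wp_addEdge hb2 m1 (by decide) (by decide)).mono ?_)
  rintro s3 ⟨⟨n1, n2⟩, n3⟩
  have b3 := n3.v .base (by decide)
  have k3 := n3.v .key (by decide)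
  have l3 := n3.v .skey (by decide)
  refine wp_seqs_cons ((wp_addEdge (b3.trans hb2) n1 (by decide) (by decide)).mono ?_)
  rintro s4 ⟨⟨p1, p2⟩, p3⟩
  have e1 : s3.v .key = key n a := by rw [k3, k2, k1, hk]
  have e2 : s3.v .skey = key n (slice a f) := by rw [l3, l2, h1]
  rw [e1, e2, ← k3, ← l3, e1, e2, h1] at p1
  refine wp_seqs_nil ⟨_, ?_, p1, by omega⟩
  rw [sliceEdges, Multiset.coe_add]
  exact Multiset.coe_eq_coe.2 (List.Perm.swap _ _ _)

theorem wp_addLoop (hs : s.AtTuple n K L a) (hk : s.v .key = key n a) (h : s.Store X es)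
    {p : ℕ × ℕ} (hp1 : p.1 < a.length) (hp2 : p.2 < a.length) :
    wp G L (addLoopCmd K p) (fun s' => (∃ es' : List (ℕ × ℕ × ℕ), (es' : Multiset (ℕ × ℕ × ℕ)) =
        ↑(loopEdges n K a p) + ↑es ∧ s'.Store X es' ∧
        s'.tick ≤ s.tick + 12) ∧ Frame graphVars graphArrs s s') s := by
  refine wp.frame ?_ (addLoopCmd_only K p)
  have hl := hs.le
  have r1 : s.raw (s.v .src + p.1) = a.getD p.1 0 := by
    rw [hs.reads p.1 hp1, List.getD_eq_getElem _ _ hp1]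
  have r2 : s.raw (s.v .src + p.2) = a.getD p.2 0 := by
    rw [hs.reads p.2 hp2, List.getD_eq_getElem _ _ hp2]
  have hS : (List.foldl Op.app s [.addc .t1 .src p.1, .rld .t1 .t1, .addc .t2 .src p.2,
      .rld .t2 .t2]).step.Store X es :=
    h.of_frame (vs := [.t1, .t2]) (as := []) ⟨by simp [Op.app, St.step], by
      intro x hx
      simp at hx
      simp [Op.app, St.step, hx], by simp [Op.app, St.step]⟩ (by decide) (by decide)
  refine wp_seq (wp_ops (by simp [OpsOk, Op.Ok, Op.app]; omega) (wp_ite (fun ht => ?_) fun ht => ?_))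
  · simp [Cond.True, Op.app, -List.getD_eq_getElem?_getD, r1, r2] at ht
    refine (wp_addEdge (by simp [Op.app, St.step, hs.base]) hS (by decide) (by decide)).mono ?_
    rintro s1 ⟨⟨h1, h2⟩, h3⟩
    simp only [Op.app, St.step, List.foldl_cons, List.foldl_nil, ne_eq, reduceCtorEq,
      not_false_eq_true, Function.update_of_ne, hk] at h1 h2
    refine ⟨_, ?_, h1, by omega⟩
    rw [loopEdges, if_pos ht]
    rfl
  · simp [Cond.True, Op.app, -List.getD_eq_getElem?_getD, r1, r2] at ht
    refine wp_skip ⟨es, ?_, hS, by simp [Op.app, St.step]⟩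
    rw [loopEdges, if_neg ht]
    simp

/-- Adds a tuple of arity `m`, with its slices and edges. -/
noncomputable def addTupleCmd (K m : ℕ) : Cmd :=
  .seq addVertexCmd (.seq (seqs ((indexLists K m).map (addSliceCmd K)))
    (seqs ((indexPairs m).map (addLoopCmd K))))

theorem addTupleCmd_only (K m : ℕ) : (addTupleCmd K m).Only graphVars graphArrs :=
  ⟨by decide, Cmd.only_seqs fun f _ => addSliceCmd_only K f,
    Cmd.only_seqs fun p _ => addLoopCmd_only K p⟩

/-- A bound on the time that it takes to add a tuple. -/
def tupleCost (K : ℕ) : ℕ := 7 + K ^ K * (6 * K + 24) + K ^ 2 * 12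

theorem wp_addTuple (hs : s.AtTuple n K L a) (hk : s.v .key = key n a) (hk' : s.v .acc = key n a)
    (h : s.Store X es) (ha : ∀ x ∈ a, x < n) (haK : a.length < K)
    (hG : (n + 1) ^ K + (K + 1) * (n + 1) ≤ G) :
    wp G L (addTupleCmd K a.length) (fun s' => (∃ es' : List (ℕ × ℕ × ℕ), (es' : Multiset (ℕ × ℕ × ℕ)) =
        ↑(edgesOf n K a) + ↑es ∧ s'.Store (verticesOf n K a ∪ X) es' ∧
        s'.tick ≤ s.tick + tupleCost K) ∧ Frame graphVars graphArrs s s') s := by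
  refine wp.frame ?_ (addTupleCmd_only K _)
  refine wp_seq ((wp_addVertex hs.base h).mono ?_)
  rintro s1 ⟨⟨h1, h2⟩, h3⟩
  rw [hk'] at h1
  have hs1 := hs.of_frame h3 (by decide) (by decide)
  have hk1 := (h3.v .key (by decide)).trans hk
  refine wp_seq (wp_seqs_map (fun rest s' => (∀ f ∈ rest, f ∈ indexLists K a.length) ∧
    ∃ (X' : Finset ℕ) (es' : List (ℕ × ℕ × ℕ)), s'.Store X' es' ∧
      X' ∪ (rest.map fun f => key n (slice a f)).toFinset = verticesOf n K a ∪ X ∧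
      (es' : Multiset (ℕ × ℕ × ℕ)) + ↑(rest.flatMap (sliceEdges n K a)) =
        ↑((indexLists K a.length).flatMap (sliceEdges n K a)) + ↑es ∧
      s'.tick + rest.length * (6 * K + 24) ≤ s1.tick + (indexLists K a.length).length * (6 * K + 24) ∧
      s'.AtTuple n K L a ∧ s'.v .key = key n a) ?_ ?_ ?_)
  · refine ⟨fun f hf => hf, _, es, h1, ?_, ?_, le_rfl, hs1, hk1⟩
    · ext v
      simp only [verticesOf, Finset.mem_union, Finset.mem_insert]
      tauto
    · rw [add_comm]
  · rintro f rest s2 ⟨hr, X', es', k1, k2, k3, k4, k5, k6⟩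
    have hf := (mem_indexLists haK.le).1 (hr f (by simp))
    refine (wp_addSlice k5 k6 k1 ha hG hf.2 hf.1).mono ?_
    rintro s3 ⟨⟨es'', m1, m2, m3⟩, m4⟩
    refine ⟨fun f hf => hr f (by simp [hf]), _, es'', m2, ?_, ?_, ?_,
      k5.of_frame m4 (by decide) (by decide), (m4.v .key (by decide)).trans k6⟩
    · rw [← k2]
      ext v
      simp only [Finset.mem_union, Finset.mem_insert, List.map_cons, List.toFinset_cons]
      tauto
    · rw [← k3, m1, List.flatMap_cons, ← Multiset.coe_add]
      abel
    · rw [List.length_cons, add_mul] at k4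
      omega
  rintro s2 ⟨-, X', es', k1, k2, k3, k4, k5, k6⟩
  have hX' : X' = verticesOf n K a ∪ X := by simpa using k2
  subst hX'
  refine wp_seqs_map (fun rest s' => (∀ p ∈ rest, p ∈ indexPairs a.length) ∧
    ∃ es'' : List (ℕ × ℕ × ℕ), s'.Store (verticesOf n K a ∪ X) es'' ∧
      (es'' : Multiset (ℕ × ℕ × ℕ)) + ↑(rest.flatMap (loopEdges n K a)) =
        ↑((indexPairs a.length).flatMap (loopEdges n K a)) + ↑es' ∧
      s'.tick + rest.length * 12 ≤ s2.tick + (indexPairs a.length).length * 12 ∧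
      s'.AtTuple n K L a ∧ s'.v .key = key n a) ?_ ?_ ?_
  · exact ⟨fun p hp => hp, es', k1, add_comm _ _, le_rfl, k5, k6⟩
  · rintro p rest s3 ⟨hr, es'', m1, m2, m3, m4, m5⟩
    have hp := hr p (by simp)
    have hp := List.pair_mem_product.1
      (show (p.1, p.2) ∈ List.range a.length ×ˢ List.range a.length from hp)
    rw [List.mem_range, List.mem_range] at hp
    refine (wp_addLoop m4 m5 m1 hp.1 hp.2).mono ?_
    rintro s4 ⟨⟨es3, n1, n2, n3⟩, n4⟩
    refine ⟨fun f hf => hr f (by simp [hf]), es3, n2, ?_, ?_,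
      m4.of_frame n4 (by decide) (by decide), (n4.v .key (by decide)).trans m5⟩
    · rw [← m2, n1, List.flatMap_cons, ← Multiset.coe_add]
      abel
    · rw [List.length_cons] at m3
      omega
  · rintro s3 ⟨-, es'', m1, m2, m3, m4, m5⟩
    refine ⟨es'', ?_, m1, ?_⟩
    · simp only [List.flatMap_nil, Multiset.coe_nil, add_zero] at m2 k3
      rw [m2, k3, edgesOf, ← Multiset.coe_add]
      abel
    · have c1 := Nat.mul_le_mul_right (6 * K + 24) (length_indexLists_le K a.length)
      have c2 : (indexPairs a.length).length ≤ K ^ 2 := by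
        change (List.range a.length ×ˢ List.range a.length).length ≤ K ^ 2
        rw [List.length_product, List.length_range]
        nlinarith
      simp only [List.length_nil, zero_mul, add_zero] at k4 m3
      unfold tupleCost
      omega

end

section

variable {G L n K : ℕ} {s : St}

theorem slice_range (a : List ℕ) : slice a (List.range a.length) = a := by
  refine List.ext_getElem (by simp [slice]) fun i h1 h2 => ?_
  simp [slice, h2]

theorem key_mem_graphVertices {ts : Finset (List ℕ)} (hts : ∀ b ∈ ts, b.length < K ∧ ∀ x ∈ b, x < n)
    {a : List ℕ} (ha : a.length < K) (ha' : ∀ x ∈ a, x < n) :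
    key n a ∈ graphVertices n K ts ↔ a ∈ ts := by
  simp only [graphVertices, Finset.mem_biUnion, verticesOf, Finset.mem_insert, List.mem_toFinset,
    List.mem_map]
  constructor
  · rintro ⟨b, hb, h | ⟨f, hf, h⟩⟩
    · rwa [key_inj ha' (hts b hb).2 h]
    · rw [mem_indexLists (hts b hb).1.le] at hf
      have h1 := key_inj (slice_lt (hts b hb).2 hf.2) ha' h
      have h2 := length_slice b f
      rw [h1, hf.1] at h2
      omega
  · exact fun h => ⟨a, h, .inl rfl⟩

/-- The tuples in `l` have been read: the graph of the tuples has been built, and the keys of the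
tuples have been listed. -/
structure St.Listed (s : St) (n K : ℕ) (l : List (List ℕ)) : Prop where
  store : ∃ es : List (ℕ × ℕ × ℕ), (es : Multiset (ℕ × ℕ × ℕ)) = graphEdges n K l.toFinset ∧
    s.Store (graphVertices n K l.toFinset) es
  li : s.v .li = l.length
  tl : Reads (s.a .tl) 0 (l.map (key n))

/-- The variables that reading tuples may change. -/
def listVars : List Var := graphVars ++ [.ptr, .src, .key, .li]

/-- The arrays that reading tuples may change. -/
def listArrs : List Arr := graphArrs ++ [.tl]

/-- Reads a tuple of arity `m`, and adds it to the graph unless it has been read before. -/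
noncomputable def listTupleCmd (K m : ℕ) : Cmd :=
  seqs [ops [.copy .src .ptr], keyCmd (List.range m),
    ops [.copy .key .acc, .addc .ptr .ptr m, .st .tl .li .acc, .addc .li .li 1, .ld .t1 .seen .key],
    .ite (.nz .t1) .skip (addTupleCmd K m)]

theorem listTupleCmd_only (K m : ℕ) : (listTupleCmd K m).Only listVars listArrs :=
  ⟨by decide, (keyCmd_only _).mono (by decide) (by decide),
    by simp [ops, Cmd.Only, Op.Only, listVars, graphVars, listArrs],
    ⟨trivial, (addTupleCmd_only K m).mono (by decide) (by decide)⟩, trivial⟩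

/-- The tuples in `l` are sequences of less than `K` numbers below `n`. -/
def Valid (n K : ℕ) (l : List (List ℕ)) : Prop := ∀ a ∈ l, 0 < a.length ∧ a.length < K ∧ ∀ x ∈ a, x < n

theorem wp_listTuple {l : List (List ℕ)} {a : List ℕ} (hb : s.v .base = L) (ht : s.Table n K)
    (hr : Reads s.raw (s.v .ptr) a) (hL : s.v .ptr + a.length ≤ L) (hl : s.Listed n K l)
    (hv : Valid n K (l ++ [a])) (hG : (n + 1) ^ K + (K + 1) * (n + 1) ≤ G) :
    wp G L (listTupleCmd K a.length) (fun s' => (s'.Listed n K (l ++ [a]) ∧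
      s'.v .ptr = s.v .ptr + a.length ∧
      s'.tick + tupleCost K * l.toFinset.card ≤
        s.tick + 9 + 6 * a.length + tupleCost K * (l ++ [a]).toFinset.card) ∧
      Frame listVars listArrs s s') s := by
  refine wp.frame ?_ (listTupleCmd_only K _)
  obtain ⟨-, haK, han⟩ := hv a (by simp)
  have hvl : ∀ b ∈ l.toFinset, b.length < K ∧ ∀ x ∈ b, x < n := fun b hb =>
    (hv b (by simp [List.mem_toFinset.1 hb])).2
  obtain ⟨⟨es, hes, hS⟩, hli, htl⟩ := hl
  have hins : (l ++ [a]).toFinset = insert a l.toFinset := by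
    ext b
    simp
  have hf0 : Frame [.src] [] s (Op.app s (.copy .src .ptr)) := Op.Only.frame (by decide) s
  have hA : (Op.app s (.copy .src .ptr)).AtTuple n K L a := by
    refine ⟨by simp [Op.app, hb], ⟨by simp [Op.app, ht.n1], by simpa [Op.app] using ht.pw⟩, ?_, ?_⟩
    · simpa [Op.app] using hr
    · simpa [Op.app] using hL
  refine wp_seqs_cons (wp_ops (by simp [OpsOk, Op.Ok]) ?_)
  refine wp_seqs_cons ((wp_key hA.base hA.table hA.reads hA.le han (f := List.range a.length)
    (by simp) (by simpa using haK.le) hG).mono ?_)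
  rintro s1 ⟨⟨h1, h2⟩, h3⟩
  rw [slice_range] at h1
  rw [List.length_range] at h2
  have hS1 := (hS.of_frame hf0 (by decide) (by decide)).of_frame h3 (by decide) (by decide)
  have hA1 := hA.of_frame h3 (by decide) (by decide)
  have e1 := h3.v .ptr (by decide)
  have e2 := h3.v .li (by decide)
  have e3 := h3.a .tl (by decide)
  simp [Op.app] at e1 e2 e3 h2
  set o : List Op := [.copy .key .acc, .addc .ptr .ptr a.length, .st .tl .li .acc, .addc .li .li 1,
    .ld .t1 .seen .key] with ho
  have hf2 : Frame [.key, .ptr, .li, .t1] [.tl] s1 (o.foldl Op.app s1) := by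
    refine ⟨by simp [ho, Op.app], fun x hx => ?_, fun A hA => ?_⟩
    · simp at hx
      simp [ho, Op.app, hx]
    · simp at hA
      simp [ho, Op.app, hA]
  have hS2 := hS1.of_frame hf2 (by decide) (by decide)
  have hA2 := hA1.of_frame hf2 (by decide) (by decide)
  have k1 : (o.foldl Op.app s1).v .key = key n a := by simp [ho, Op.app, h1]
  have k2 : (o.foldl Op.app s1).v .acc = key n a := by simp [ho, Op.app, h1]
  have k3 : (o.foldl Op.app s1).v .ptr = s.v .ptr + a.length := by simp [ho, Op.app, e1]
  have k4 : (o.foldl Op.app s1).v .li = (l ++ [a]).length := by simp [ho, Op.app, e2, hli]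
  have k5 : Reads ((o.foldl Op.app s1).a .tl) 0 ((l ++ [a]).map (key n)) := by
    intro i hi
    simp only [List.length_map, List.length_append, List.length_singleton] at hi
    by_cases hil : i = l.length
    · subst hil
      simp [ho, Op.app, e2, hli, h1]
    · have h := htl i (by simp; omega)
      rw [zero_add] at h
      rw [List.getElem_map, List.getElem_append_left (by omega)]
      simpa [ho, Op.app, e2, hli, hil, e3] using h
  have k6 : (o.foldl Op.app s1).v .t1 = s1.a .seen (key n a) := by simp [ho, Op.app, h1]
  have k7 : (o.foldl Op.app s1).tick = s1.tick + 5 := by simp [ho, Op.app]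
  refine wp_seqs_cons (wp_ops (by simp [ho, OpsOk, Op.Ok, Op.app, hA1.base]) ?_)
  clear_value o
  have hseen := hS1.seen (key n a)
  rw [key_mem_graphVertices hvl haK han] at hseen
  refine wp_seqs_cons (wp_ite (fun hc => ?_) fun hc => ?_)
  · have hm : a ∈ l.toFinset := hseen.1 (k6 ▸ hc)
    have hins' : (l ++ [a]).toFinset = l.toFinset := by rw [hins, Finset.insert_eq_of_mem hm]
    refine wp_skip (wp_seqs_nil ⟨⟨⟨es, ?_, ?_⟩, k4, k5⟩, k3, ?_⟩)
    · rw [hins', hes]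
    · rw [hins']
      exact hS2.of_frame (vs := []) (as := []) ⟨rfl, fun _ _ => rfl, fun _ _ => rfl⟩ (by decide)
        (by decide)
    · rw [hins']
      simp only [St.step]
      omega
  · have hm : a ∉ l.toFinset := fun hm => hc (by
      simp only [Cond.True, k6]
      exact hseen.2 hm)
    refine (wp_addTuple (s := (o.foldl Op.app s1).step) ⟨hA2.base, ⟨hA2.table.n1, hA2.table.pw⟩, hA2.reads, hA2.le⟩
      k1 k2
      (hS2.of_frame (vs := []) (as := []) ⟨rfl, fun _ _ => rfl, fun _ _ => rfl⟩ (by decide)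
        (by decide)) han haK hG).mono ?_
    rintro s3 ⟨⟨es', m1, m2, m3⟩, m4⟩
    refine wp_seqs_nil ⟨⟨⟨es', ?_, ?_⟩, (m4.v .li (by decide)).trans k4, ?_⟩,
      (m4.v .ptr (by decide)).trans k3, ?_⟩
    · rw [m1, hins, hes, graphEdges, graphEdges, Finset.sum_insert hm]
    · rw [hins, graphVertices, Finset.biUnion_insert]
      exact m2
    · rw [m4.a .tl (by decide)]
      exact k5
    · rw [hins, Finset.card_insert_of_notMem hm, mul_add]
      simp only [St.step] at m3
      omega

theorem Valid.append {l l' : List (List ℕ)} : Valid n K (l ++ l') ↔ Valid n K l ∧ Valid n K l' := by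
  simp only [Valid, List.mem_append]
  exact ⟨fun h => ⟨fun a ha => h a (.inl ha), fun a ha => h a (.inr ha)⟩,
    fun h a ha => ha.elim (h.1 a) (h.2 a)⟩

/-- Reads `cnt` tuples of arity `m`. -/
noncomputable def listTuplesCmd (K m : ℕ) : Cmd :=
  .loop (.nz .cnt) (.seq (listTupleCmd K m) (ops [.subc .cnt .cnt 1]))

theorem wp_listTuples {m : ℕ} {l ts : List (List ℕ)} (hb : s.v .base = L) (ht : s.Table n K)
    (hc : s.v .cnt = ts.length) (hm : ∀ a ∈ ts, a.length = m)
    (hr : Reads s.raw (s.v .ptr) ts.flatten) (hL : s.v .ptr + ts.flatten.length ≤ L)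
    (hl : s.Listed n K l) (hv : Valid n K (l ++ ts)) (hG : (n + 1) ^ K + (K + 1) * (n + 1) ≤ G) :
    wp G L (listTuplesCmd K m) (fun s' => s'.Listed n K (l ++ ts) ∧
      s'.v .ptr = s.v .ptr + ts.flatten.length ∧
      s'.tick + tupleCost K * l.toFinset.card ≤
        s.tick + 1 + 17 * ts.flatten.length + tupleCost K * (l ++ ts).toFinset.card ∧
      s'.v .base = L ∧ s'.Table n K ∧ s'.raw = s.raw) s := by
  induction ts generalizing s l with
  | nil =>
    refine wp_loop_false (by simp [Cond.True, hc]) ⟨?_, by simp [St.step], by simp [St.step], hb,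
      ⟨ht.n1, ht.pw⟩, rfl⟩
    rw [List.append_nil]
    obtain ⟨⟨es, h1, h2⟩, h3, h4⟩ := hl
    exact ⟨⟨es, h1, h2.of_frame (vs := []) (as := []) ⟨rfl, fun _ _ => rfl, fun _ _ => rfl⟩
      (by decide) (by decide)⟩, h3, h4⟩
  | cons a ts ih =>
    obtain rfl := hm a (by simp)
    rw [List.flatten_cons] at hr hL ⊢
    rw [List.length_append] at hL ⊢
    have hr' := hr.append
    rw [List.append_cons] at hv ⊢
    have hv' := Valid.append.1 hv
    have ha := (hv'.1 a (by simp)).1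
    refine wp_loop_true (by simp [Cond.True, hc]) (wp_seq ?_)
    obtain ⟨⟨es, h1, h2⟩, h3, h4⟩ := hl
    refine (wp_listTuple (s := s.step) hb ⟨ht.n1, ht.pw⟩ hr'.1 ?_ ⟨⟨es, h1, h2.of_frame (vs := [])
      (as := []) ⟨rfl, fun _ _ => rfl, fun _ _ => rfl⟩ (by decide) (by decide)⟩, h3, h4⟩ hv'.1 hG).mono ?_
    · change s.v .ptr + a.length ≤ L
      omega
    rintro s1 ⟨⟨k1, k2, k3⟩, k4⟩
    change s1.v .ptr = s.v .ptr + a.length at k2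
    simp only [St.step] at k3
    have b1 := (k4.v .base (by decide)).trans hb
    have c1 := (k4.v .cnt (by decide)).trans hc
    have n1 := (k4.v .n1 (by decide)).trans ht.n1
    have p1 := k4.a .pw (by decide)
    have r1 : s1.raw = s.raw := k4.raw
    have hfr : Frame [.cnt] [] s1 (Op.app s1 (.subc .cnt .cnt 1)) := Op.Only.frame (by decide) s1
    refine wp_ops (by simp [OpsOk, Op.Ok]) ?_
    refine (ih (s := Op.app s1 (.subc .cnt .cnt 1)) (l := l ++ [a]) ?_ ?_ ?_
      (fun b hb => hm b (by simp [hb])) ?_ ?_ ?_ hv).mono ?_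
    · simp [Op.app, b1]
    · refine ⟨by simp [Op.app, n1], ?_⟩
      simp only [Op.app, p1]
      exact ht.pw
    · simp [Op.app, c1]
    · simp only [Op.app, ne_eq, reduceCtorEq, not_false_eq_true, Function.update_of_ne, r1, k2]
      exact hr'.2
    · simp only [Op.app, ne_eq, reduceCtorEq, not_false_eq_true, Function.update_of_ne, k2]
      omega
    · obtain ⟨⟨es, h1, h2⟩, h3, h4⟩ := k1
      refine ⟨⟨es, h1, h2.of_frame hfr (by decide) (by decide)⟩, ?_, ?_⟩
      · rw [hfr.v .li (by decide), h3]
      · rw [hfr.a .tl (by decide)]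
        exact h4
    · rintro s2 ⟨m1, m2, m3, m4, m5, m6⟩
      refine ⟨m1, ?_, ?_, m4, m5, ?_⟩
      · rw [m2]
        simp [Op.app, k2]
        omega
      · simp only [Op.app] at m3
        omega
      · rw [m6]
        simp [Op.app, r1]

/-- Reads all tuples, given the arities of the relations. -/
noncomputable def readCmd (K : ℕ) (ars : List ℕ) : Cmd :=
  .seq (ops [.set .ptr 1]) (seqs (ars.map fun m =>
    .seq (ops [.rld .cnt .ptr, .addc .ptr .ptr 1]) (listTuplesCmd K m)))

theorem readCmd_only (K : ℕ) (ars : List ℕ) :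
    (readCmd K ars).Only (listVars ++ [.cnt]) listArrs :=
  ⟨by decide, Cmd.only_seqs fun m _ => ⟨by decide,
    (listTupleCmd_only K m).mono (by decide) (by decide), by decide⟩⟩

theorem St.Listed.of_frame {vs : List Var} {as : List Arr} {s s' : St} {l : List (List ℕ)}
    (h : s.Listed n K l) (hf : Frame vs as s s') (hv : .size ∉ vs ∧ .edges ∉ vs ∧ .li ∉ vs)
    (ha : ∀ A ∈ as, (A ≠ .seen ∧ A ≠ .ord ∧ A ≠ .pos ∧ A ≠ .enx ∧
      A ≠ .esrc ∧ A ≠ .elbl ∧ A ≠ .head) ∧ A ≠ .tl) : s'.Listed n K l := by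
  obtain ⟨⟨es, h1, h2⟩, h3, h4⟩ := h
  refine ⟨⟨es, h1, h2.of_frame hf ⟨hv.1, hv.2.1⟩ fun A hA => (ha A hA).1⟩,
    (hf.v _ hv.2.2).trans h3, ?_⟩
  rw [hf.a .tl fun hm => (ha _ hm).2 rfl]
  exact h4

/-- Reading the relations builds the graph. Repeated tuples cost only constant time per entry: the costs
of the slices are paid once for each of the distinct tuples. -/
theorem wp_read {rels : List (ℕ × List (List ℕ))} (hb : s.v .base = L) (ht : s.Table n K)
    (hr : Reads s.raw 1 (relWord rels)) (hm : ∀ r ∈ rels, ∀ a ∈ r.2, a.length = r.1)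
    (hL : 1 + (relWord rels).length = L) (hl : s.Listed n K [])
    (hv : Valid n K (rels.flatMap (·.2))) (hG : (n + 1) ^ K + (K + 1) * (n + 1) ≤ G) :
    wp G L (readCmd K (rels.map (·.1))) (fun s' => (s'.Listed n K (rels.flatMap (·.2)) ∧
      s'.tick ≤ s.tick + 17 * L + tupleCost K * (rels.flatMap (·.2)).toFinset.card) ∧
      Frame (listVars ++ [.cnt]) listArrs s s') s := by
  refine wp.frame ?_ (readCmd_only _ _)
  refine wp_seq (wp_ops (by simp [OpsOk, Op.Ok]) ?_)
  rw [List.map_map]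
  refine wp_seqs_map (fun rest s' => ∃ l, l ++ rest.flatMap (·.2) = rels.flatMap (·.2) ∧
    Reads s'.raw (s'.v .ptr) (relWord rest) ∧
    (∀ r ∈ rest, ∀ a ∈ r.2, a.length = r.1) ∧
    s'.v .ptr + (relWord rest).length = L ∧ s'.Listed n K l ∧ s'.v .base = L ∧ s'.Table n K ∧
    s'.tick ≤ s.tick + 17 * s'.v .ptr + tupleCost K * l.toFinset.card) ?_ ?_ ?_
  · have hf : Frame [.ptr] [] s (Op.app s (.set .ptr 1)) := Op.Only.frame (by decide) s
    refine ⟨[], rfl, ?_, hm, ?_, hl.of_frame hf (by decide) (by decide), ?_, ?_, ?_⟩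
    · simpa [Op.app] using hr
    · simpa [Op.app] using hL
    · simp [Op.app, hb]
    · exact ⟨by simp [Op.app, ht.n1], by simpa [Op.app] using ht.pw⟩
    · simp [Op.app]
  · rintro ⟨m, ts⟩ rest s1 ⟨l, h0, h1, h2, h3, h4, h5, h6, h7⟩
    have hw : relWord ((m, ts) :: rest) = ts.length :: (ts.flatten ++ relWord rest) := by
      simp [relWord]
    rw [hw] at h1 h3
    obtain ⟨k1, k2⟩ := h1.cons
    have k3 := k2.append
    simp only [List.length_cons, List.length_append] at h3
    rw [List.flatMap_cons, ← List.append_assoc] at h0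
    set s2 := [Op.rld .cnt .ptr, .addc .ptr .ptr 1].foldl Op.app s1 with hs2
    have hf : Frame [.cnt, .ptr] [] s1 s2 := by
      refine ⟨by simp [hs2, Op.app], fun x hx => ?_, fun A hA => by simp [hs2, Op.app]⟩
      simp at hx
      simp [hs2, Op.app, hx]
    have p2 : s2.v .ptr = s1.v .ptr + 1 := by simp [hs2, Op.app]
    have t2 : s2.tick = s1.tick + 2 := by simp [hs2, Op.app]
    have c2 : s2.v .cnt = ts.length := by simp [hs2, Op.app, k1]
    refine wp_seq (wp_ops (by simp [OpsOk, Op.Ok]; omega) ?_)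
    rw [← hs2]
    refine (wp_listTuples (ts := ts) (l := l) ((hf.v _ (by decide)).trans h5)
      ⟨(hf.v _ (by decide)).trans h6.n1, ?_⟩ c2 (h2 (m, ts) (by simp)) ?_ ?_
      (h4.of_frame hf (by decide) (by decide)) ?_ hG).mono ?_
    · rw [hf.a .pw (by decide)]
      exact h6.pw
    · rw [hf.raw, p2]
      exact k3.1
    · omega
    · rw [← h0] at hv
      exact (Valid.append.1 hv).1
    · rintro s3 ⟨m1, m2, m3, m4, m5, m6⟩
      refine ⟨l ++ ts, h0, ?_, fun r hr => h2 r (by simp [hr]), ?_, m1, m4, m5, ?_⟩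
      · rw [m6, m2, hf.raw, p2]
        exact k3.2
      · omega
      · omega
  · rintro s1 ⟨l, h0, h1, h2, h3, h4, h5, h6, h7⟩
    have h8 : s1.v .ptr = L := by simpa [relWord] using h3
    rw [List.flatMap_nil, List.append_nil] at h0
    subst h0
    refine ⟨h4, ?_⟩
    rw [h8] at h7
    exact h7

end

/-! ### The whole program -/

section

variable {G L n K : ℕ} {s : St}

/-- The loop of a round that moves `cnt` listed tuples of arity `m`. -/
def moveTuplesCmd (m : ℕ) : Cmd :=
  .loop (.nz .cnt) (seqs [ops [.ld .vtx .tl .li], moveCmd,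
    ops [.addc .li .li 1, .addc .ptr .ptr m, .subc .cnt .cnt 1]])

/-- Refines the partition with respect to the relations: in one round for each relation, the tuples
of the relation are moved. -/
def relationsCmd (ars : List ℕ) : Cmd :=
  .seq (ops [.set .ptr 1, .set .li 0]) (seqs (ars.map fun m =>
    .seq (ops [.rld .cnt .ptr, .addc .ptr .ptr 1, .copy .start .fresh]) (moveTuplesCmd m)))

/-- The variables that the refinement with respect to the relations may change. -/
def relationsVars : List Var := moveVars ++ [.vtx, .ptr, .li, .cnt, .start]

theorem relationsCmd_only (ars : List ℕ) : (relationsCmd ars).Only relationsVars partArrs :=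
  ⟨by decide, Cmd.only_seqs fun m _ => ⟨by decide, by decide, moveCmd_only.mono (by decide) (by decide),
    by simp [ops, Cmd.Only, Op.Only, relationsVars, moveVars], trivial⟩⟩

theorem wp_moveTuples (m : ℕ) {l : List ℕ} {s : St} (hb : s.v .base = L) (hc : s.v .cnt = l.length)
    (hl : Reads (s.a .tl) (s.v .li) l) :
    wp G L (moveTuplesCmd m) (fun s' => s'.part = l.foldl (Part.move (s.v .start)) s.part ∧
      s'.v .li = s.v .li + l.length ∧ s'.v .ptr = s.v .ptr + l.length * m ∧ s'.raw = s.raw ∧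
      s'.a .tl = s.a .tl ∧ s'.v .base = L ∧ s'.cost ≤ s.cost + 49 * l.length + 1) s := by
  induction l generalizing s with
  | nil =>
    refine wp_loop_false (by simp [Cond.True, hc]) ⟨by simp [St.part, St.step], by simp [St.step],
      by simp [St.step], rfl, rfl, hb, ?_⟩
    simp [St.step, St.cost]
    omega
  | cons u l ih =>
    obtain ⟨h1, h2⟩ := hl.cons
    refine wp_loop_true (by simp [Cond.True, hc]) ?_
    refine wp_seqs_cons (wp_ops (by simp [OpsOk, Op.Ok, St.step, hb]) ?_)
    refine wp_seqs_cons ((wp_move (by simp [Op.app, St.step, hb])).mono ?_)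
    rintro s1 ⟨⟨k1, k2⟩, k3⟩
    have e1 := k3.v .base (by decide)
    have e2 := k3.v .li (by decide)
    have e3 := k3.v .ptr (by decide)
    have e4 := k3.v .cnt (by decide)
    have e5 := k3.v .start (by decide)
    have e6 := k3.raw
    have e7 := k3.a .tl (by decide)
    simp [Op.app, St.step, St.cost, St.part, h1] at e1 e2 e3 e4 e5 e6 e7 k1 k2
    refine wp_seqs_cons (wp_ops (by simp [OpsOk, Op.Ok]) (wp_seqs_nil ?_))
    refine (ih (by simp [Op.app, e1, hb]) (by simp [Op.app, e4, hc]) ?_).mono ?_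
    · simpa [Op.app, e2, e7] using h2
    rintro s2 ⟨m1, m2, m3, m4, m5, m6, m7⟩
    simp [Op.app, St.cost, St.part, e2, e3, e5] at m1 m2 m3 m4 m5 m7
    refine ⟨?_, ?_, ?_, ?_, ?_, m6, ?_⟩
    · simp [St.part, m1, k1]
    · rw [m2, List.length_cons]
      omega
    · rw [m3, List.length_cons]
      ring
    · rw [m4, e6]
    · rw [m5, e7]
    · simp only [St.cost, List.length_cons]
      omega

theorem wp_relations {rels : List (ℕ × List (List ℕ))} (hb : s.v .base = L)
    (hr : Reads s.raw 1 (relWord rels)) (hm : ∀ r ∈ rels, 0 < r.1 ∧ ∀ a ∈ r.2, a.length = r.1)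
    (hL : 1 + (relWord rels).length = L)
    (htl : Reads (s.a .tl) 0 ((rels.flatMap (·.2)).map (key n))) :
    wp G L (relationsCmd (rels.map (·.1))) (fun s' =>
      (s'.part = (rels.map fun r => r.2.map (key n)).foldl Part.round s.part ∧
      s'.v .li = (rels.flatMap (·.2)).length ∧
      s'.cost ≤ s.cost + 50 * L) ∧
      Frame relationsVars partArrs s s') s := by
  refine wp.frame ?_ (relationsCmd_only _)
  refine wp_seq (wp_ops (by simp [OpsOk, Op.Ok]) ?_)
  rw [List.map_map]
  refine wp_seqs_map (fun rest s' =>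
    (rest.map fun r => r.2.map (key n)).foldl Part.round s'.part =
      (rels.map fun r => r.2.map (key n)).foldl Part.round s.part ∧
    Reads s'.raw (s'.v .ptr) (relWord rest) ∧
    (∀ r ∈ rest, 0 < r.1 ∧ ∀ a ∈ r.2, a.length = r.1) ∧
    s'.v .ptr + (relWord rest).length = L ∧ s'.v .base = L ∧
    Reads (s'.a .tl) (s'.v .li) ((rest.flatMap (·.2)).map (key n)) ∧
    s'.v .li + (rest.flatMap (·.2)).length = (rels.flatMap (·.2)).length ∧
    s'.cost ≤ s.cost + 50 * s'.v .ptr) ?_ ?_ ?_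
  · refine ⟨by simp [Op.app, St.part], by simpa [Op.app] using hr, hm, by simpa [Op.app] using hL,
      by simp [Op.app, hb], by simpa [Op.app] using htl, by simp [Op.app], ?_⟩
    simp [Op.app, St.cost]
    omega
  · rintro ⟨m, ts⟩ rest s1 ⟨h0, h1, h2, h3, h4, h5, h6, h7⟩
    have hw : relWord ((m, ts) :: rest) = ts.length :: (ts.flatten ++ relWord rest) := by
      simp [relWord]
    rw [hw] at h1 h3
    obtain ⟨k1, k2⟩ := h1.cons
    have k3 := k2.append
    obtain ⟨hm0, hmt⟩ := h2 (m, ts) (by simp)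
    have hlen := length_flatten_of_forall hmt
    simp only [List.length_cons, List.length_append] at h3 hlen hm0
    rw [List.flatMap_cons, List.map_append] at h5
    have h5' := h5.append
    rw [List.flatMap_cons, List.length_append] at h6
    rw [List.length_map] at h5'
    simp only at h6
    refine wp_seq (wp_ops (by simp [OpsOk, Op.Ok]; omega) ?_)
    refine (wp_moveTuples m (l := ts.map (key n)) (by simp [Op.app, h4]) (by simp [Op.app, k1])
      (by simpa [Op.app] using h5'.1)).mono ?_
    rintro s2 ⟨m1, m2, m3, m4, m5, m6, m7⟩
    simp [Op.app, St.cost] at m1 m2 m3 m4 m5 m7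
    refine ⟨?_, ?_, fun r hr => h2 r (by simp [hr]), ?_, m6, ?_, by omega, ?_⟩
    · rw [← h0, m1, List.map_cons, List.foldl_cons]
      congr 1
    · rw [m3, m4, ← hlen]
      exact k3.2
    · rw [m3, ← hlen]
      omega
    · rw [m2, m5]
      exact h5'.2
    · have : ts.length ≤ ts.length * m := Nat.le_mul_of_pos_right _ hm0
      unfold St.cost at h7 ⊢
      omega
  · rintro s1 ⟨h0, h1, h2, h3, h4, h5, h6, h7⟩
    have h8 : s1.v .ptr = L := by simpa [relWord] using h3
    rw [h8] at h7
    exact ⟨by simpa using h0, by simpa using h6, h7⟩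

/-- Writes the classes of the listed tuples to the first cells. -/
def outputCmd : Cmd :=
  .seq (ops [.set .ix 0]) (.loop (.lt .ix .li)
    (ops [.ld .t1 .tl .ix, .ld .t1 .cls .t1, .rst .ix .t1, .addc .ix .ix 1]))

theorem wp_output (hb : s.v .base = L) (hli : s.v .li ≤ L) :
    wp G L outputCmd (fun s' => (∀ i < s.v .li, s'.raw i = s.a .cls (s.a .tl i)) ∧
      s'.tick = s.tick + 5 * s.v .li + 2) s := by
  refine wp_seq (wp_ops (by simp [OpsOk, Op.Ok]) ?_)
  refine wp_for (fun k s' => k ≤ s.v .li ∧ s'.v .ix = s.v .li - k ∧ s'.v .li = s.v .li ∧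
    s'.v .base = L ∧ s'.a = s.a ∧ (∀ i < s'.v .ix, s'.raw i = s.a .cls (s.a .tl i)) ∧
    s'.tick = s.tick + 5 * s'.v .ix + 1) (n := s.v .li) ?_ ?_ ?_
  · exact ⟨le_rfl, by simp [Op.app], by simp [Op.app], by simp [Op.app, hb], by simp [Op.app],
      by simp [Op.app], by simp [Op.app]⟩
  · rintro k s1 ⟨h1, h2, h3, h4, h5, h6, h7⟩
    refine ⟨by simp only [Cond.True]; omega, wp_ops ?_ ⟨by omega, ?_, ?_, ?_, ?_, ?_, ?_⟩⟩
    · simp [OpsOk, Op.Ok, Op.app, St.step, h4]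
      omega
    · simp [Op.app, St.step]
      omega
    · simp [Op.app, St.step, h3]
    · simp [Op.app, St.step, h4]
    · simp [Op.app, St.step, h5]
    · intro i hi
      by_cases hi' : i = s1.v .ix
      · subst hi'
        simp [Op.app, St.step, h5]
      · simp [Op.app, St.step] at hi
        simpa [Op.app, St.step, hi'] using h6 i (by omega)
    · simp [Op.app, St.step]
      omega
  · rintro s1 ⟨h1, h2, h3, h4, h5, h6, h7⟩
    refine ⟨by simp only [Cond.True]; omega, fun i hi => h6 i (by omega), ?_⟩
    simp only [St.step]
    omega

end

section

variable {G L n K : ℕ} {s : St}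

/-- Starts with one class and one block, which contain all vertices. -/
def initCmd (nl : ℕ) : Cmd :=
  ops [.set .t1 0, .st .cen .t1 .size, .st .qhi .t1 .size, .set .fresh 1, .set .qfresh 1,
    .set .nlab nl]

/-- Computes the stable coloring of a graph that has been read. -/
def colorCmd (K : ℕ) (ars : List ℕ) : Cmd :=
  seqs [initCmd (K ^ K + K ^ 2), relationsCmd ars, ops [.set .lo 0, .copy .hi .size], fillCmd,
    refineCmd, mainCmd, outputCmd]

/-- The program for Relational Color Refinement, given the arities of the relations. -/
noncomputable def rcrCmd (K : ℕ) (ars : List ℕ) : Cmd :=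
  seqs [scanCmd ars, tableCmd K, readCmd K ars, colorCmd K ars]

theorem St.Store.good {X : Finset ℕ} {es : List (ℕ × ℕ × ℕ)} (h : s.Store X es)
    (hcls : ∀ u, s.a .cls u = 0) (hcst : ∀ u, s.a .cst u = 0) (hcen : s.a .cen 0 = X.card)
    (hnxt : ∀ u, s.a .nxt u = 0) (hfresh : s.v .fresh = 1) : s.part.Good X X.card := by
  refine ⟨h.pos_lt, h.ord_pos, h.ord_mem, h.pos_ord, ?_, ?_, ?_, ?_, ?_, ?_⟩
  · intro u _
    simp [St.part, hcls, hfresh]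
  · intro u _
    simp [St.part, hcst]
  · intro u hu
    simpa [St.part, hcls, hcen] using h.pos_lt u hu
  · intro c _
    simp [St.part, hcst]
  · intro c hc i _ hi
    simp only [St.part, hfresh, Nat.lt_one_iff] at hc
    subst hc
    simp only [St.part, hcen] at hi
    exact ⟨hi, by simp [St.part, hcls]⟩
  · intro c _
    simp [St.part, hnxt, hfresh]

/-- The time that coloring a graph with vertices `X` and edges `es` takes. -/
def colorCost (nl : ℕ) (X : Finset ℕ) (es : List (ℕ × ℕ × ℕ)) : ℕ :=
  5 * X.card + nl * (54 * (∑ v ∈ X, weight es v) + 5) +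
    100 * (nl * ((∑ v ∈ X, weight es v) * Nat.log 2 X.card))

/-- The output assigns to the listed tuples the classes of the coarsest coloring of the graph that
respects the relations and is equitable. -/
theorem wp_color {rels : List (ℕ × List (List ℕ))} {X : Finset ℕ} {es : List (ℕ × ℕ × ℕ)}
    (hb : s.v .base = L)
    (hr : Reads s.raw 1 (relWord rels)) (hm : ∀ r ∈ rels, 0 < r.1 ∧ ∀ a ∈ r.2, a.length = r.1)
    (hL : 1 + (relWord rels).length = L)
    (htl : Reads (s.a .tl) 0 ((rels.flatMap (·.2)).map (key n))) (h : s.Store X es)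
    (ha : ∀ A ∈ [Arr.cls, .cst, .nxt, .cq, .qlo], ∀ i, s.a A i = 0) (hX : 0 < X.card)
    (hls : ∀ l ∈ rels.map fun r => r.2.map (key n), ∀ u ∈ l, u ∈ X) (hK : 0 < K ^ K + K ^ 2)
    (he : ∀ e ∈ es, e.1 ∈ X ∧ e.2.1 < K ^ K + K ^ 2 ∧ e.2.2 ∈ X) :
    wp G L (colorCmd K (rels.map (·.1))) (fun s' => ∃ cls : ℕ → ℕ,
      Equitable X es (rels.map fun r => r.2.map (key n)) cls ∧
      (∀ {α : Type} (f : ℕ → α), Equitable X es (rels.map fun r => r.2.map (key n)) f →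
        ∀ u ∈ X, ∀ u' ∈ X, f u = f u' → cls u = cls u') ∧
      (∀ i, (hi : i < (rels.flatMap (·.2)).length) →
        s'.raw i = cls (key n (rels.flatMap (·.2))[i])) ∧
      s'.tick ≤ s.tick + 55 * L + 50 + colorCost (K ^ K + K ^ 2) X es) s := by
  have hlen : (rels.flatMap (·.2)).length ≤ L := by
    have := length_le_relWord hm
    omega
  set nl := K ^ K + K ^ 2 with hnl
  -- the initial classes and blocks
  have hf0 : Frame [.t1, .fresh, .qfresh, .nlab] [.cen, .qhi] s
      ([Op.set .t1 0, .st .cen .t1 .size, .st .qhi .t1 .size, .set .fresh 1, .set .qfresh 1,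
    .set .nlab nl].foldl Op.app s) := by
    refine ⟨by simp [Op.app], fun x hx => ?_, fun A hA => ?_⟩
    · simp at hx
      simp [Op.app, hx]
    · simp at hA
      simp [Op.app, hA]
  refine wp_seqs_cons (wp_ops (by simp [OpsOk, Op.Ok, Op.app, hb]) ?_)
  obtain ⟨s0, hs0⟩ : ∃ s0, s0 = [Op.set .t1 0, .st .cen .t1 .size, .st .qhi .t1 .size,
    .set .fresh 1, .set .qfresh 1, .set .nlab nl].foldl Op.app s := ⟨_, rfl⟩
  have c0 : s0.a .cen 0 = X.card := by simp [hs0, Op.app, h.size]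
  have c1 : s0.a .qhi 0 = X.card := by simp [hs0, Op.app, h.size]
  have c2 : s0.v .fresh = 1 := by simp [hs0, Op.app]
  have c3 : s0.v .qfresh = 1 := by simp [hs0, Op.app]
  have c4 : s0.v .nlab = nl := by simp [hs0, Op.app]
  have c5 : s0.cost = s.tick + 26 := by simp [hs0, Op.app, St.cost]
  rw [← hs0] at hf0 ⊢
  clear hs0
  have hb0 := (hf0.v .base (by decide)).trans hb
  have hS0 := h.of_frame hf0 (by decide) (by decide)
  have hz : ∀ A ∈ [Arr.cls, .cst, .nxt, .cq, .qlo], ∀ i, s0.a A i = 0 := by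
    intro A hA i
    rw [hf0.a A (by revert A; decide)]
    exact ha A hA i
  have hgood : s0.part.Good X X.card := hS0.good (hz _ (by decide)) (hz _ (by decide)) c0
    (hz _ (by decide)) c2
  -- the rounds for the relations
  have hr0 : Reads s0.raw 1 (relWord rels) := by rw [hf0.raw]; exact hr
  have htl0 : Reads (s0.a .tl) 0 ((rels.flatMap (·.2)).map (key n)) := by
    rw [hf0.a .tl (by decide)]; exact htl
  refine wp_seqs_cons ((wp_relations hb0 hr0 hm hL htl0).mono ?_)
  rintro s1 ⟨⟨h1, h2, h3⟩, hf1⟩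
  have hb1 := (hf1.v .base (by decide)).trans hb0
  have hfo : Frame [.lo, .hi] [] s1 ([Op.set .lo 0, .copy .hi .size].foldl Op.app s1) := by
    refine ⟨by simp [Op.app], fun x hx => ?_, fun A hA => by simp [Op.app]⟩
    simp at hx
    simp [Op.app, hx]
  refine wp_seqs_cons (wp_ops (by simp [OpsOk, Op.Ok]) ?_)
  refine wp_seqs_cons ((wp_fill ((hfo.v _ (by decide)).trans hb1)).mono ?_)
  rintro s2 ⟨⟨k1, k2⟩, hf2⟩
  have size1 : s1.v .size = X.card := by
    rw [hf1.v .size (by decide), hS0.size]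
  simp [Op.app, size1, St.cost] at k1 k2
  have hb2 := (hf2.v .base (by decide)).trans ((hfo.v _ (by decide)).trans hb1)
  have hE2 : s2.HasEdges es := (((hS0.edges.of_frame hf1 (by decide)).of_frame hfo
    (by decide)).of_frame hf2 (by decide))
  refine wp_seqs_cons ((wp_refine hb2 hE2 k1).mono ?_)
  rintro s3 ⟨⟨m1, m2⟩, hf3⟩
  have hpart : s2.part = s1.part := by
    simp only [St.part]
    rw [hf2.a .ord (by decide), hf2.a .pos (by decide), hf2.a .cls (by decide),
        hf2.a .cst (by decide), hf2.a .cen (by decide), hf2.a .nxt (by decide),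
        hf2.a .cq (by decide), hf2.v .fresh (by decide), hfo.a .ord (by decide),
        hfo.a .pos (by decide), hfo.a .cls (by decide), hfo.a .cst (by decide),
        hfo.a .cen (by decide), hfo.a .nxt (by decide), hfo.a .cq (by decide),
        hfo.v .fresh (by decide)]
  have hnl2 : s2.v .nlab = nl := by
    rw [hf2.v .nlab (by decide), hfo.v .nlab (by decide), hf1.v .nlab (by decide), c4]
  rw [hpart, h1, hnl2] at m1
  rw [hnl2] at m2
  -- the buffer holds all vertices
  set l := (List.range' 0 X.card).map (s1.a .ord) with hl
  have hgood1 : s1.part.Good X X.card := by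
    rw [h1]
    exact (hgood.rounds hls).1
  have hlX : ∀ v, v ∈ l ↔ v ∈ X := by
    intro v
    simp only [hl, List.mem_map, List.mem_range'_1, zero_add, zero_le, true_and]
    exact ⟨fun ⟨i, hi, h⟩ => h ▸ hgood1.ord_mem i hi,
      fun hv => ⟨_, hgood1.pos_lt v hv, hgood1.ord_pos v hv⟩⟩
  have hnd : l.Nodup := by
    refine List.Nodup.map_on ?_ List.nodup_range'
    intro i hi j hj hij
    simp only [List.mem_range'_1] at hi hj
    have e1 := hgood1.pos_ord i (by omega)
    have e2 := hgood1.pos_ord j (by omega)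
    change s1.part.ord i = s1.part.ord j at hij
    rw [← e1, ← e2, hij]
  have hqf3 : s3.v .qfresh = 1 := by
    rw [hf3.v .qfresh (by decide), hf2.v .qfresh (by decide), hfo.v .qfresh (by decide),
      hf1.v .qfresh (by decide), c3]
  have hqlo3 : s3.a .qlo = s0.a .qlo := by
    rw [hf3.a .qlo (by decide), hf2.a .qlo (by decide), hfo.a .qlo (by decide),
      hf1.a .qlo (by decide)]
  have hqhi3 : s3.a .qhi = s0.a .qhi := by
    rw [hf3.a .qhi (by decide), hf2.a .qhi (by decide), hfo.a .qhi (by decide),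
      hf1.a .qhi (by decide)]
  have hI := Blocks.inv_start (l := l) (nl := nl) hgood hX
    (fun u _ => hz .cls (by decide) u) c2 (hz .cq (by decide) 0) hls hnd hlX he
    (qlo := s0.a .qlo) (qhi := s0.a .qhi) (hz .qlo (by decide) 0) c1
  have hB3 : s3.blocks = ⟨((rels.map fun r => r.2.map (key n)).foldl Part.round s0.part).refine
      es nl l, s0.a .qlo, s0.a .qhi, 1⟩ := by
    simp only [St.blocks, m1, hqf3, hqlo3, hqhi3]
  rw [← hB3] at hI
  have hnl3 : s3.v .nlab = nl := (hf3.v .nlab (by decide)).trans hnl2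
  have hpos3 : 0 < s3.v .fresh := by
    obtain ⟨u, hu⟩ := Finset.card_pos.1 hX
    exact (Nat.zero_le _).trans_lt (hI.good.cls_lt u hu)
  refine wp_seqs_cons ((wp_main ((hf3.v _ (by decide)).trans hb2) (hE2.of_frame hf3 (by decide)) hI
    (by rwa [hnl3]) hqf3 (by rwa [hnl3]) hpos3).mono ?_)
  rintro s4 ⟨⟨n1, n2, n3⟩, hf4⟩
  have hli4 : s4.v .li = (rels.flatMap (·.2)).length := by
    rw [hf4.v .li (by decide), hf3.v .li (by decide), hf2.v .li (by decide),
      hfo.v .li (by decide), h2]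
  have htl4 : s4.a .tl = s0.a .tl := by
    rw [hf4.a .tl (by decide), hf3.a .tl (by decide), hf2.a .tl (by decide),
      hfo.a .tl (by decide), hf1.a .tl (by decide)]
  have hb4 : s4.v .base = L := by
    rw [hf4.v .base (by decide), hf3.v .base (by decide), hb2]
  refine wp_seqs_cons ((wp_output hb4 (by omega)).mono ?_)
  rintro s5 ⟨p1, p2⟩
  refine wp_seqs_nil ⟨s4.a .cls, n2, fun f hf => n1.coarse f hf, ?_, ?_⟩
  · intro i hi
    rw [p1 i (by omega), htl4]
    congr 1
    have := htl0 i (by simpa using hi)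
    simpa using this
  · have hpot : s3.blocks.pot X es = (∑ v ∈ X, weight es v) * Nat.log 2 X.card := by
      rw [Blocks.pot, Finset.sum_mul]
      refine Finset.sum_congr rfl fun v hv => ?_
      have h0 : s3.blocks.blockOf v = 0 := by
        have := hI.cq_lt _ (hI.good.cls_lt v hv)
        rw [hB3] at this ⊢
        exact Nat.lt_one_iff.1 this
      rw [h0, hB3]
      simp only [c1, hz .qlo (by decide) 0, Nat.sub_zero]
    have hw : (l.map (weight es)).sum = ∑ v ∈ X, weight es v := by
      rw [← List.sum_toFinset _ hnd]
      congr 1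
      ext v
      rw [List.mem_toFinset, hlX]
    rw [hpot, hnl3] at n3
    rw [hw] at m2
    unfold colorCost
    have hc1 : s1.cost = s1.tick + 20 * s1.v .fresh := rfl
    have hc2 : s2.cost = s2.tick + 20 * s2.v .fresh := rfl
    omega

/-- On a state that holds only the input, the program computes the coarsest equitable coloring of the
graph of the tuples. -/
theorem wp_rcr {rels : List (ℕ × List (List ℕ))} (hv0 : ∀ x, s.v x = 0) (ha0 : ∀ A i, s.a A i = 0)
    (ht : s.tick = 0) (hn : s.raw 0 = n)
    (hr : Reads s.raw 1 (relWord rels)) (hm : ∀ r ∈ rels, 0 < r.1 ∧ ∀ a ∈ r.2, a.length = r.1)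
    (hL : 1 + (relWord rels).length = L) (hK : 1 < K) (hv : Valid n K (rels.flatMap (·.2)))
    (hne : rels.flatMap (·.2) ≠ []) (hG : (n + 1) ^ K + (K + 1) * (n + 1) ≤ G) :
    wp G L (rcrCmd K (rels.map (·.1))) (fun s' => ∃ (es : List (ℕ × ℕ × ℕ)) (cls : ℕ → ℕ),
      (es : Multiset (ℕ × ℕ × ℕ)) = graphEdges n K (rels.flatMap (·.2)).toFinset ∧
      Equitable (graphVertices n K (rels.flatMap (·.2)).toFinset) es
        (rels.map fun r => r.2.map (key n)) cls ∧
      (∀ {α : Type} (f : ℕ → α), Equitable (graphVertices n K (rels.flatMap (·.2)).toFinset) es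
        (rels.map fun r => r.2.map (key n)) f →
        ∀ u ∈ graphVertices n K (rels.flatMap (·.2)).toFinset,
        ∀ u' ∈ graphVertices n K (rels.flatMap (·.2)).toFinset, f u = f u' → cls u = cls u') ∧
      (∀ i, (hi : i < (rels.flatMap (·.2)).length) →
        s'.raw i = cls (key n (rels.flatMap (·.2))[i])) ∧
      s'.tick ≤ 75 * L + 55 + K * (5 * n + 9) +
        tupleCost K * (rels.flatMap (·.2)).toFinset.card +
        colorCost (K ^ K + K ^ 2) (graphVertices n K (rels.flatMap (·.2)).toFinset) es) s := by
  refine wp_seqs_cons ((wp_scan hr hm hL).mono ?_)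
  rintro s1 ⟨⟨h1, h2⟩, hf1⟩
  refine wp_seqs_cons ((wp_table (n := n) (K := K) (by omega) h1 (by rw [hf1.raw, hn])
    (by omega)).mono ?_)
  rintro s2 ⟨⟨k1, k2⟩, hf2⟩
  have hr2 : Reads s2.raw 1 (relWord rels) := by rw [hf2.raw, hf1.raw]; exact hr
  have ha2 : ∀ A, A ≠ .pw → ∀ i, s2.a A i = 0 := by
    intro A hA i
    rw [hf2.a A (by simpa using hA), hf1.a A (by simp)]
    exact ha0 A i
  have hv2 : ∀ x, x ∉ [Var.ptr, .cnt, .base, .n1, .pow, .row, .acc] → s2.v x = 0 := by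
    intro x hx
    rw [hf2.v x (by simp at hx ⊢; tauto), hf1.v x (by simp at hx ⊢; tauto)]
    exact hv0 x
  have hb2 := (hf2.v .base (by decide)).trans h1
  have hl0 : s2.Listed n K [] := by
    refine ⟨⟨[], by simp [graphEdges], ?_⟩, hv2 .li (by decide), fun i hi => by simp at hi⟩
    have hX : graphVertices n K ([] : List (List ℕ)).toFinset = ∅ := by simp [graphVertices]
    rw [hX]
    refine ⟨fun v => by simp [ha2 .seen], hv2 .size (by decide), by simp, by simp, by simp, by simp,
      ?_, ?_, ?_⟩
    · intro v
      exact ha2 .head (by decide) v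
    · intro v
      rw [ha2 .head (by decide)]
      exact Nat.zero_le _
    · intro v _
      rw [ha2 .enx (by decide)]
      exact Nat.zero_le _
  refine wp_seqs_cons ((wp_read hb2 k1 hr2 (fun r hr => (hm r hr).2) hL hl0 hv hG).mono ?_)
  rintro s3 ⟨⟨⟨⟨es, hes, hS⟩, hli, htl⟩, m2⟩, hf3⟩
  set ts := (rels.flatMap (·.2)).toFinset with hts
  have hlen : ∀ a ∈ ts, a.length < K := fun a ha => (hv a (List.mem_toFinset.1 ha)).2.1
  have hvert : ∀ a ∈ ts, key n a ∈ graphVertices n K ts := fun a ha =>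
    Finset.mem_biUnion.2 ⟨a, ha, Finset.mem_insert_self _ _⟩
  refine wp_seqs_cons ((wp_color ((hf3.v .base (by decide)).trans hb2)
    (by rw [hf3.raw]; exact hr2) hm hL htl hS ?_ ?_ ?_ (by positivity)
    (fun e he => graph_edge_mem hes hK hlen he)).mono ?_)
  · intro A hA i
    rw [hf3.a A (by revert A; decide)]
    exact ha2 A (by rintro rfl; revert hA; decide) i
  · obtain ⟨a, ha⟩ := List.exists_mem_of_ne_nil _ hne
    exact Finset.card_pos.2 ⟨_, hvert a (List.mem_toFinset.2 ha)⟩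
  · intro l hl u hu
    obtain ⟨r, hr, rfl⟩ := List.mem_map.1 hl
    obtain ⟨a, ha, rfl⟩ := List.mem_map.1 hu
    exact hvert a (List.mem_toFinset.2 (List.mem_flatMap.2 ⟨r, hr, ha⟩))
  · rintro s4 ⟨cls, p1, p2, p3, p4⟩
    exact wp_seqs_nil ⟨es, cls, hes, p1, p2, p3, by omega⟩

end

/-! ### Time and space -/

section

variable {n K : ℕ} {ts : Finset (List ℕ)} {es : List (ℕ × ℕ × ℕ)}

theorem card_graphVertices_le : (graphVertices n K ts).card ≤ ts.card * (1 + K ^ K) := by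
  refine (Finset.card_biUnion_le).trans ?_
  rw [← smul_eq_mul, ← Finset.sum_const]
  refine Finset.sum_le_sum fun a _ => (Finset.card_insert_le _ _).trans ?_
  have h1 := List.toFinset_card_le ((indexLists K a.length).map fun f => key n (slice a f))
  rw [List.length_map] at h1
  have h2 := length_indexLists_le K a.length
  omega

theorem length_edgesOf_le {a : List ℕ} (ha : a.length < K) :
    (edgesOf n K a).length ≤ 2 * K ^ K + K ^ 2 := by
  have h1 : ∀ (l : List (List ℕ)), (l.flatMap (sliceEdges n K a)).length = 2 * l.length := by
    intro l
    induction l with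
    | nil => rfl
    | cons f l ih =>
      rw [List.flatMap_cons, List.length_append, ih, List.length_cons]
      simp [sliceEdges]
      ring
  have h2 : ∀ (l : List (ℕ × ℕ)), (l.flatMap (loopEdges n K a)).length ≤ l.length := by
    intro l
    induction l with
    | nil => simp
    | cons p l ih =>
      rw [List.flatMap_cons, List.length_append, List.length_cons]
      have : (loopEdges n K a p).length ≤ 1 := by
        unfold loopEdges
        split_ifs <;> simp
      omega
  have h3 := length_indexLists_le K a.length
  have h4 : (indexPairs a.length).length ≤ K ^ 2 := by
    change (List.range a.length ×ˢ List.range a.length).length ≤ K ^ 2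
    rw [List.length_product, List.length_range]
    nlinarith
  have h5 := h2 (indexPairs a.length)
  rw [edgesOf, List.length_append, h1]
  omega

theorem length_graphEdges_le (hes : (es : Multiset (ℕ × ℕ × ℕ)) = graphEdges n K ts)
    (hts : ∀ a ∈ ts, a.length < K) : es.length ≤ ts.card * (2 * K ^ K + K ^ 2) := by
  rw [← Multiset.coe_card, hes, graphEdges, Multiset.card_sum, ← smul_eq_mul, ← Finset.sum_const]
  exact Finset.sum_le_sum fun a ha => length_edgesOf_le (hts a ha)

theorem sum_weight_le (X : Finset ℕ) (es : List (ℕ × ℕ × ℕ)) :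
    ∑ v ∈ X, weight es v ≤ X.card + es.length := by
  have h : ∑ v ∈ X, (inEdges es v).length ≤ es.length := by
    simp only [inEdges, List.length_map]
    induction es with
    | nil => simp
    | cons e es ih =>
      have h1 : ∀ v, ((e :: es).filter (·.2.2 = v)).length =
          (if e.2.2 = v then 1 else 0) + (es.filter (·.2.2 = v)).length := by
        intro v
        rw [List.filter_cons]
        split_ifs <;> simp_all [add_comm]
      simp only [h1, Finset.sum_add_distrib, Finset.sum_ite_eq, List.length_cons]
      split_ifs <;> omega
  simp only [weight, Finset.sum_add_distrib, Finset.sum_const, smul_eq_mul, mul_one]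
  omega

/-- The logarithm of the number of vertices exceeds that of the number of tuples only by a factor that
depends on the arity. -/
theorem log_le {N q T : ℕ} (hq : 0 < q) (hN : N ≤ 2 * q * T) :
    Nat.log 2 N ≤ 3 * q * (Nat.log 2 T + 1) := by
  have h1 : N < 2 ^ (2 * q + (Nat.log 2 T + 1)) := by
    rw [pow_add]
    exact hN.trans_lt (Nat.mul_lt_mul'' Nat.lt_two_pow_self (Nat.lt_pow_succ_log_self (by omega) T))
  have h2 := Nat.log_lt_of_lt_pow' (b := 2) (by omega) h1
  nlinarith

/-- The costs of scanning, the table of powers, reading and coloring together. There are at most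
`T * (1 + K ^ K)` vertices and `T * (2 * K ^ K + K ^ 2)` edges, and each of the `K ^ K + K ^ 2` labels
is processed separately, which leads to the third power of `K ^ K`. -/
theorem total_cost_le {L T : ℕ} (hK : 1 < K) (hT : T = ts.card) (hpos : 0 < T) (hL : 0 < L)
    (hn : n ≤ K * T) (hes : (es : Multiset (ℕ × ℕ × ℕ)) = graphEdges n K ts)
    (hts : ∀ a ∈ ts, a.length < K) :
    75 * L + 55 + K * (5 * n + 9) + tupleCost K * T +
      colorCost (K ^ K + K ^ 2) (graphVertices n K ts) es ≤
    130 * L + 4000 * ((K ^ K) ^ 3 * (T * (Nat.log 2 T + 1))) := by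
  obtain ⟨q, hq⟩ : ∃ q, q = K ^ K := ⟨_, rfl⟩
  obtain ⟨l, hl⟩ : ∃ l, l = Nat.log 2 T + 1 := ⟨_, rfl⟩
  have hK2 : K ^ 2 ≤ q := hq ▸ Nat.pow_le_pow_right (by omega) hK
  have hKq : K ≤ q := le_trans (by nlinarith) hK2
  have hN := card_graphVertices_le (n := n) (K := K) (ts := ts)
  have hW := (sum_weight_le (graphVertices n K ts) es).trans
    (Nat.add_le_add hN (length_graphEdges_le hes hts))
  rw [← hT, ← hq] at hN hW
  unfold tupleCost colorCost
  rw [← hq, ← hl]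
  generalize (graphVertices n K ts).card = N at *
  generalize ∑ v ∈ graphVertices n K ts, weight es v = W at *
  have hq1 : 1 ≤ q := by omega
  have hl1 : 1 ≤ l := by omega
  have hN' : N ≤ 2 * q * T := by nlinarith
  have hW' : W ≤ 5 * q * T := by nlinarith
  have hlog := log_le (by omega) hN'
  rw [← hl] at hlog
  generalize Nat.log 2 N = e at *
  obtain ⟨Y, hY⟩ : ∃ Y, Y = q ^ 3 * (T * l) := ⟨_, rfl⟩
  rw [← hY]
  have hTl : T ≤ T * l := Nat.le_mul_of_pos_right _ hl1
  have y3 : q ^ 2 * T ≤ Y := hY ▸ Nat.mul_le_mul (Nat.pow_le_pow_right hq1 (by omega)) hTl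
  have y2 : q * T ≤ q ^ 2 * T := Nat.mul_le_mul_right _ (by nlinarith)
  have y1 : K ^ 2 * T ≤ q * T := Nat.mul_le_mul_right _ hK2
  have y0 : T ≤ q * T := Nat.le_mul_of_pos_left _ hq1
  have z1 : K * n ≤ K ^ 2 * T := by
    have := Nat.mul_le_mul_left K hn
    rw [← mul_assoc, ← pow_two] at this
    exact this
  have z2 : K ≤ K ^ 2 * T := le_trans (by nlinarith) (Nat.le_mul_of_pos_right _ hpos)
  have z3 : q * K * T ≤ q ^ 2 * T := Nat.mul_le_mul_right _ (by nlinarith)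
  have a1 : K * (5 * n + 9) ≤ 14 * (q * T) := by
    rw [mul_add]
    nlinarith
  have a2 : (7 + q * (6 * K + 24) + K ^ 2 * 12) * T ≤ 49 * (q ^ 2 * T) := by
    have : (7 + q * (6 * K + 24) + K ^ 2 * 12) * T =
      7 * T + 6 * (q * K * T) + 24 * (q * T) + 12 * (K ^ 2 * T) := by ring
    omega
  have a3 : (q + K ^ 2) * (54 * W + 5) ≤ 550 * (q ^ 2 * T) := by
    have h1 : q + K ^ 2 ≤ 2 * q := by omega
    have h2 : 54 * W + 5 ≤ 275 * (q * T) := by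
      have : 5 * q * T = 5 * (q * T) := by ring
      omega
    have := Nat.mul_le_mul h1 h2
    have h3 : 2 * q * (275 * (q * T)) = 550 * (q ^ 2 * T) := by ring
    omega
  have a4 : 100 * ((q + K ^ 2) * (W * e)) ≤ 3000 * Y := by
    have h1 : q + K ^ 2 ≤ 2 * q := by omega
    have := Nat.mul_le_mul h1 (Nat.mul_le_mul hW' hlog)
    have h3 : 2 * q * (5 * q * T * (3 * q * l)) = 30 * Y := by
      rw [hY]
      ring
    omega
  have a5 : 5 * N ≤ 10 * (q * T) := by
    have : 2 * q * T = 2 * (q * T) := by ring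
    omega
  omega

end

section

variable {σ : Signature} {V : Type} {A : Structure σ V} (E : Presentation A)

/-- The arities of the relations. -/
def Signature.arities (σ : Signature) : List ℕ := (List.finRange σ.card).map σ.arity

/-- The arities and the tuples of the relations, as they are listed in the input. -/
def Presentation.rels : List (ℕ × List (List ℕ)) :=
  (List.finRange σ.card).map fun R => (σ.arity R, (E.list R).map fun a => E.word ⟨σ.arity R, a⟩)

theorem Presentation.rels_arities : E.rels.map (·.1) = σ.arities := by
  simp [Presentation.rels, Signature.arities, Function.comp_def]

theorem Presentation.input_eq : E.input = E.n :: relWord E.rels := by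
  simp only [Presentation.input, relWord, Presentation.rels, List.flatMap_map, List.length_map]
  congr 1

theorem Presentation.rels_tuples : E.rels.flatMap (·.2) = E.listed.map E.word := by
  simp [Presentation.rels, Presentation.listed, List.flatMap_map, List.map_flatMap,
    Function.comp_def]

theorem Presentation.mem_listed (a : Tup V) : a ∈ E.listed ↔ a ∈ A.tuples := by
  simp only [Presentation.listed, List.mem_flatMap, List.mem_finRange, true_and, List.mem_map,
    E.mem_list, A.mem_tuples]
  exact ⟨fun ⟨R, b, h, e⟩ => ⟨R, b, h, e.symm⟩, fun ⟨R, b, h, e⟩ => ⟨R, b, h, e.symm⟩⟩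

theorem Presentation.rels_toFinset : (E.rels.flatMap (·.2)).toFinset = E.words := by
  ext l
  rw [List.mem_toFinset, E.rels_tuples, List.mem_map, Presentation.mem_words]
  simp only [E.mem_listed]

theorem Presentation.rels_vertexLists :
    (E.rels.map fun r => r.2.map (key E.n)) = E.vertexLists := by
  simp [Presentation.rels, Presentation.vertexLists, Presentation.vertex, Function.comp_def]

theorem Presentation.card_words : E.words.card = A.size := by
  classical
  rw [Structure.size, Presentation.words, Finset.card_image_of_injective _ E.word_injective]

theorem Structure.size_pos (A : Structure σ V) : 0 < A.size := by
  obtain ⟨v⟩ := A.nonempty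
  obtain ⟨R, a, ha, -⟩ := A.covers v
  exact Finset.card_pos.2 ⟨_, (A.mem_tuples _).2 ⟨R, a, ha, rfl⟩⟩

theorem Presentation.rels_valid :
    (∀ r ∈ E.rels, 0 < r.1 ∧ ∀ a ∈ r.2, a.length = r.1) ∧
      Valid E.n (σ.maxArity + 1) (E.rels.flatMap (·.2)) := by
  constructor
  · intro r hr
    obtain ⟨R, -, rfl⟩ := List.mem_map.1 hr
    refine ⟨σ.arity_pos R, fun a ha => ?_⟩
    obtain ⟨b, -, rfl⟩ := List.mem_map.1 ha
    exact E.length_word _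
  · intro a ha
    rw [E.rels_tuples] at ha
    obtain ⟨b, hb, rfl⟩ := List.mem_map.1 ha
    have := A.arity_pos_le ((E.mem_listed b).1 hb)
    rw [E.length_word]
    exact ⟨this.1, by omega, E.word_lt b⟩

/-- Every element occurs in a tuple, so there are at most as many elements as entries. -/
theorem Presentation.n_le : E.n ≤ (σ.maxArity + 1) * A.size := by
  classical
  have h : (Finset.univ : Finset (Fin E.n)) ⊆
      A.tuples.biUnion fun a => Finset.univ.image fun i => E.num (a.2 i) := by
    intro x _
    obtain ⟨R, a, ha, i, hi⟩ := A.covers (E.num.symm x)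
    refine Finset.mem_biUnion.2 ⟨⟨σ.arity R, a⟩, (A.mem_tuples _).2 ⟨R, a, ha, rfl⟩, ?_⟩
    exact Finset.mem_image.2 ⟨i, Finset.mem_univ _, by simp [hi]⟩
  have h1 := Finset.card_le_card h
  rw [Finset.card_univ, Fintype.card_fin] at h1
  refine h1.trans (Finset.card_biUnion_le.trans ?_)
  rw [mul_comm, Structure.size, ← smul_eq_mul, ← Finset.sum_const]
  refine Finset.sum_le_sum fun a ha => Finset.card_image_le.trans ?_
  rw [Finset.card_univ, Fintype.card_fin]
  have := A.arity_pos_le ha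
  omega

theorem Presentation.length_input_le :
    E.input.length ≤ (1 + σ.card * (σ.maxArity + 2)) * A.size := by
  have hT := A.size_pos
  have h1 : ∀ R, (E.list R).length ≤ A.size := by
    intro R
    classical
    rw [← List.toFinset_card_of_nodup (E.nodup R)]
    refine Finset.card_le_card_of_injOn (fun a => (⟨σ.arity R, a⟩ : Tup V)) ?_ ?_
    · intro a ha
      have := (E.mem_list R a).1 (List.mem_toFinset.1 ha)
      exact (A.mem_tuples _).2 ⟨R, a, this, rfl⟩
    · intro a _ b _ hab
      simpa using hab
  have h2 : (relWord E.rels).length ≤ σ.card * ((σ.maxArity + 2) * A.size) := by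
    rw [length_relWord, Presentation.rels, List.map_map]
    refine (List.sum_le_card_nsmul _ ((σ.maxArity + 2) * A.size) ?_).trans_eq (by simp)
    intro x hx
    obtain ⟨R, -, rfl⟩ := List.mem_map.1 hx
    have h3 : (((E.list R).map fun a => E.word ⟨σ.arity R, a⟩).flatten).length =
        (E.list R).length * σ.arity R := by
      rw [length_flatten_of_forall (m := σ.arity R)]
      · simp
      · intro a ha
        obtain ⟨b, -, rfl⟩ := List.mem_map.1 ha
        exact E.length_word _
    simp only [Function.comp_apply, h3]
    have h4 : σ.arity R ≤ σ.maxArity := Finset.le_sup (Finset.mem_univ R)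
    have h5 := Nat.mul_le_mul (h1 R) h4
    nlinarith
  rw [E.input_eq, List.length_cons]
  nlinarith

end

/-! ### Execution on the machine -/

section

variable {σ : Signature} {V : Type} {A : Structure σ V} (E : Presentation A)

theorem Presentation.mem_input_le {x : ℕ} (hx : x ∈ E.input) : x ≤ E.n + E.input.length := by
  rw [E.input_eq, List.mem_cons] at hx
  rcases hx with rfl | hx
  · omega
  · obtain ⟨r, hr, hx⟩ := List.mem_flatMap.1 hx
    rcases List.mem_cons.1 hx with rfl | hx
    · have h1 := length_le_relWord E.rels_valid.1
      have h2 : r.2.length ≤ (E.rels.flatMap (·.2)).length := by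
        rw [List.length_flatMap]
        exact List.single_le_sum (fun _ _ => Nat.zero_le _) _ (List.mem_map.2 ⟨r, hr, rfl⟩)
      rw [E.input_eq, List.length_cons]
      omega
    · obtain ⟨a, ha, hx⟩ := List.mem_flatten.1 hx
      have := (E.rels_valid.2 a (List.mem_flatMap.2 ⟨r, hr, ha⟩)).2.2 x hx
      omega

/-- The program for Relational Color Refinement. -/
noncomputable def Signature.program (σ : Signature) : Cmd := rcrCmd (σ.maxArity + 1) σ.arities

/-- A bound on the number of operations of the program. -/
noncomputable def Presentation.time : ℕ :=
  130 * E.input.length + 4000 * (((σ.maxArity + 1) ^ (σ.maxArity + 1)) ^ 3 *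
    (A.size * (Nat.log 2 A.size + 1)))

/-- A bound on the numbers in the input and on the sums that the program computes. -/
def Presentation.space : ℕ :=
  (E.n + 1) ^ (σ.maxArity + 1) + (σ.maxArity + 2) * (E.n + 1) + E.input.length

/-- The compiled program halts with a correct output. The numbers that occur are bounded by those in the
input, the sums that are formed for indices, and what the running time can add to them; `32` is the
number by which array addresses are multiplied. -/
theorem Presentation.exec {B : ℕ}
    (hB : E.input.length + 32 * (E.space + σ.program.maxConst * E.time) + 32 ≤ B) :
    ∃ S t, Exec B σ.program.compile (State.init E.input) S t ∧ E.IsOutput S ∧ t ≤ 10 * E.time := by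
  obtain ⟨K, hK⟩ : ∃ K, K = σ.maxArity + 1 := ⟨_, rfl⟩
  have hK1 : 1 < K := hK ▸ σ.one_lt
  obtain ⟨s, hs⟩ : ∃ s : St, s = ⟨fun _ => 0, fun _ _ => 0, fun i => E.input.getD i 0, 0⟩ := ⟨_, rfl⟩
  have hL : 1 + (relWord E.rels).length = E.input.length := by
    rw [E.input_eq, List.length_cons, add_comm]
  have hraw : ∀ i, s.raw i ≤ E.n + E.input.length := by
    intro i
    rw [hs]
    by_cases hi : i < E.input.length
    · simp only [List.getD_eq_getElem _ _ hi]
      exact E.mem_input_le (List.getElem_mem _)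
    · simp only [List.getD_eq_default _ _ (not_lt.1 hi)]
      omega
  have hm : E.n + E.input.length ≤ E.space := by
    unfold Presentation.space
    nlinarith [Nat.zero_le ((E.n + 1) ^ (σ.maxArity + 1))]
  have hSim : Sim E.input.length B s (State.init E.input) := by
    subst hs
    refine ⟨fun _ => rfl, rfl, fun _ _ => rfl, fun Ar i => ?_, fun _ => Nat.zero_le _, fun i => ?_⟩
    · exact List.getD_eq_default _ _ (by omega)
    · exact (hraw i).trans (by omega)
  obtain ⟨s', h1, es, cls, h2, h3, h4, h5, h6⟩ := wp_rcr (G := E.space) (L := E.input.length)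
    (n := E.n) (K := K) (s := s) (rels := E.rels) (by simp [hs]) (by simp [hs]) (by simp [hs])
    (by rw [hs, E.input_eq]; rfl)
    (by
      intro i hi
      simp only [hs, E.input_eq, add_comm 1 i, List.getD_cons_succ, List.getD_eq_getElem _ _ hi])
    E.rels_valid.1 hL hK1 (by rw [hK]; exact E.rels_valid.2)
    (by
      intro h
      have := E.rels_toFinset
      rw [h] at this
      have h7 := E.card_words
      rw [← this] at h7
      have := A.size_pos
      simp at h7
      omega)
    (by
      rw [hK]
      exact Nat.le_add_right _ _)
  rw [E.rels_toFinset] at h2 h3 h4 h6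
  rw [E.rels_vertexLists] at h3 h4
  rw [E.card_words] at h6
  have htime : s'.tick ≤ E.time := by
    refine h6.trans ((total_cost_le hK1 E.card_words.symm A.size_pos (by omega) ?_ h2
      (E.words_length hK)).trans_eq ?_)
    · rw [hK]
      exact E.n_le
    · rw [hK]
      rfl
  rw [E.rels_arities, hK] at h1
  obtain ⟨S, t, k1, k2, k3⟩ := h1.compile_correct (m := E.space) (T := E.time) le_rfl
    ⟨fun x => by simp [hs], fun Ar i => by simp [hs], fun i => ((hraw i).trans hm).trans (by omega)⟩
    le_rfl htime hB hSim
  refine ⟨S, t, k1, ?_, by omega⟩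
  have hlen : E.listed.length ≤ (relWord E.rels).length := by
    have := length_le_relWord E.rels_valid.1
    rwa [E.rels_tuples, List.length_map] at this
  have hout : ∀ i : Fin E.listed.length,
      S.mem (S.reg 0 + i) = cls (E.vertex (E.listed.get i)) := by
    intro i
    have hi := i.2
    rw [k2.zero, zero_add, k2.raw _ (by omega), h5 i (by
      rw [E.rels_tuples, List.length_map]
      exact hi)]
    simp only [E.rels_tuples, List.getElem_map]
    rfl
  intro i j
  rw [hout, hout]
  exact E.stableColor_iff hK h2 h3 h4 ((E.mem_listed _).1 (List.get_mem _ _))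
    ((E.mem_listed _).1 (List.get_mem _ _))

theorem log_succ_le (T : ℕ) (hT : 0 < T) :
    1 ≤ Real.logb 2 (T + 1) ∧ ((Nat.log 2 T + 1 : ℕ) : ℝ) ≤ 2 * Real.logb 2 (T + 1) := by
  have hT' : (1 : ℝ) ≤ T := by exact_mod_cast hT
  have h1 : 1 ≤ Real.logb 2 (T + 1) := by
    rw [Real.le_logb_iff_rpow_le (by norm_num) (by positivity)]
    norm_num
    linarith
  have h2 : (Nat.log 2 T : ℝ) ≤ Real.logb 2 (T + 1) := by
    rw [Real.le_logb_iff_rpow_le (by norm_num) (by positivity), Real.rpow_natCast]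
    have : (2 : ℝ) ^ Nat.log 2 T ≤ T := by exact_mod_cast Nat.pow_log_le_self 2 (by omega)
    linarith
  refine ⟨h1, ?_⟩
  push_cast
  linarith

/-- The factor in the running time is `2 ^ O(k log k)`. -/
theorem pow_arity_le {k : ℕ} (hk : 0 < k) :
    (80000 : ℝ) * (((k + 1 : ℕ) : ℝ) ^ (k + 1)) ^ 3 ≤ 2 ^ ((1300 : ℕ) * (k * Real.logb 2 (k + 1))) := by
  have h1 := (log_succ_le k hk).1
  have hk' : (1 : ℝ) ≤ k := by exact_mod_cast hk
  set e := Real.logb 2 (k + 1) with he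
  have h2 : ((k + 1 : ℕ) : ℝ) = 2 ^ e := by
    rw [he, Real.rpow_logb (by norm_num) (by norm_num) (by positivity)]
    push_cast
    rfl
  have h3 : (80000 : ℝ) ≤ 2 ^ (17 : ℝ) := by norm_num
  rw [h2, ← Real.rpow_natCast, ← Real.rpow_natCast, ← Real.rpow_mul (by positivity),
    ← Real.rpow_mul (by norm_num)]
  refine (mul_le_mul_of_nonneg_right h3 (by positivity)).trans ?_
  rw [← Real.rpow_add (by norm_num)]
  refine Real.rpow_le_rpow_of_exponent_le (by norm_num) ?_
  push_cast
  nlinarith [mul_le_mul hk' h1 (by norm_num) (by linarith)]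

/-- The numbers that occur are bounded by a polynomial in the size of the structure. -/
theorem exists_space_bound (σ : Signature) : ∃ D, ∀ (V : Type) (A : Structure σ V)
    (E : Presentation A), E.input.length + 32 * (E.space + σ.program.maxConst * E.time) + 32 ≤
      (A.size + 2) ^ D := by
  obtain ⟨K, hK⟩ : ∃ K, K = σ.maxArity + 1 := ⟨_, rfl⟩
  obtain ⟨l, hl⟩ : ∃ l, l = 1 + σ.card * (σ.maxArity + 2) := ⟨_, rfl⟩
  obtain ⟨c, hc⟩ : ∃ c, c = σ.program.maxConst := ⟨_, rfl⟩
  obtain ⟨C, hC⟩ : ∃ C, C = l + 32 * (K ^ K + (K + 1) * K + l +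
    c * (130 * l + 4000 * (K ^ K) ^ 3)) + 32 := ⟨_, rfl⟩
  refine ⟨C + (K + 2), fun V A E => ?_⟩
  obtain ⟨x, hx⟩ : ∃ x, x = A.size + 2 := ⟨_, rfl⟩
  have hT := A.size_pos
  have hx2 : 2 ≤ x := by omega
  have hL : E.input.length ≤ l * x := by
    rw [hl, hx]
    exact E.length_input_le.trans (Nat.mul_le_mul_left _ (by omega))
  have hn : E.n + 1 ≤ K * x := by
    have := E.n_le
    rw [← hK] at this
    have : K * A.size + 2 * K = K * x := by rw [hx]; ring
    omega
  have hpow : ∀ i ≤ K + 2, x ^ i ≤ x ^ (K + 2) := fun i hi => Nat.pow_le_pow_right (by omega) hi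
  have p1 : x ≤ x ^ (K + 2) := by simpa using hpow 1 (by omega)
  have hsp : E.space ≤ (K ^ K + (K + 1) * K + l) * x ^ (K + 2) := by
    have h1 : (E.n + 1) ^ K ≤ K ^ K * x ^ (K + 2) :=
      ((Nat.pow_le_pow_left hn K).trans_eq (mul_pow K x K)).trans
        (Nat.mul_le_mul_left _ (hpow K (by omega)))
    have h2 : (K + 1) * (E.n + 1) ≤ (K + 1) * K * x ^ (K + 2) := by
      rw [mul_assoc]
      exact Nat.mul_le_mul_left _ (hn.trans (Nat.mul_le_mul_left _ p1))
    have h3 : E.input.length ≤ l * x ^ (K + 2) := hL.trans (Nat.mul_le_mul_left _ p1)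
    unfold Presentation.space
    rw [← hK, show σ.maxArity + 2 = K + 1 by omega]
    have h4 : (K ^ K + (K + 1) * K + l) * x ^ (K + 2) =
      K ^ K * x ^ (K + 2) + (K + 1) * K * x ^ (K + 2) + l * x ^ (K + 2) := by ring
    omega
  have htm : E.time ≤ (130 * l + 4000 * (K ^ K) ^ 3) * x ^ (K + 2) := by
    have h1 : A.size * (Nat.log 2 A.size + 1) ≤ x ^ (K + 2) := by
      refine le_trans ?_ (hpow 2 (by omega))
      rw [pow_two]
      refine Nat.mul_le_mul (by omega) ?_
      have := Nat.log_le_self 2 A.size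
      omega
    unfold Presentation.time
    rw [← hK, add_mul]
    refine Nat.add_le_add ?_ ?_
    · rw [mul_assoc]
      exact Nat.mul_le_mul_left _ (hL.trans (Nat.mul_le_mul_left _ p1))
    · rw [mul_assoc]
      exact Nat.mul_le_mul_left _ (Nat.mul_le_mul_left _ h1)
  have hctm := Nat.mul_le_mul_left c htm
  rw [← hc, ← hx]
  calc E.input.length + 32 * (E.space + c * E.time) + 32
      ≤ l * x ^ (K + 2) + 32 * ((K ^ K + (K + 1) * K + l) * x ^ (K + 2) +
          c * ((130 * l + 4000 * (K ^ K) ^ 3) * x ^ (K + 2))) + 32 * x ^ (K + 2) := by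
        have h1 : l * x ≤ l * x ^ (K + 2) := Nat.mul_le_mul_left _ p1
        have h2 : 32 ≤ 32 * x ^ (K + 2) := by omega
        omega
    _ = C * x ^ (K + 2) := by
        rw [hC]
        ring
    _ ≤ x ^ C * x ^ (K + 2) := Nat.mul_le_mul_right _
        (Nat.lt_two_pow_self.le.trans (Nat.pow_le_pow_left hx2 C))
    _ = x ^ (C + (K + 2)) := (pow_add _ _ _).symm

end

end RCR

theorem theoremC :
    ∃ c : ℕ, ∀ σ : RCR.Signature, ∃ (P : RCR.Program) (C D : ℕ),
      ∀ (V : Type) (A : RCR.Structure σ V) (E : RCR.Presentation A),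
        ∃ (s : RCR.State) (t : ℕ),
          RCR.Exec ((A.size + 2) ^ D) P (RCR.State.init E.input) s t ∧
          E.IsOutput s ∧
          (t : ℝ) ≤ C * (A.size * Real.logb 2 (A.size + 1)) ∧
          (t : ℝ) ≤ c * E.input.length +
            (2 : ℝ) ^ (c * (σ.maxArity * Real.logb 2 (σ.maxArity + 1))) *
              (A.size * Real.logb 2 (A.size + 1)) := by
  refine ⟨1300, fun σ => ?_⟩
  obtain ⟨D, hD⟩ := RCR.exists_space_bound σ
  refine ⟨σ.program.compile, 1300 * (1 + σ.card * (σ.maxArity + 2)) +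
    80000 * ((σ.maxArity + 1) ^ (σ.maxArity + 1)) ^ 3, D, fun V A E => ?_⟩
  obtain ⟨S, t, h1, h2, h3⟩ := E.exec (hD V A E)
  refine ⟨S, t, h1, h2, ?_⟩
  obtain ⟨hg, hlog⟩ := RCR.log_succ_le A.size A.size_pos
  have hk : 0 < σ.maxArity := by
    have := σ.one_lt
    omega
  have hT : (0 : ℝ) < A.size := by exact_mod_cast A.size_pos
  have ht : (t : ℝ) ≤ 1300 * E.input.length + 80000 *
      (((σ.maxArity + 1 : ℕ) : ℝ) ^ (σ.maxArity + 1)) ^ 3 *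
      (A.size * Real.logb 2 (A.size + 1)) := by
    have h4 : (t : ℝ) ≤ (10 * E.time : ℕ) := by exact_mod_cast h3
    unfold RCR.Presentation.time at h4
    rw [Nat.cast_mul, Nat.cast_add, Nat.cast_mul, Nat.cast_mul, Nat.cast_mul, Nat.cast_pow,
      Nat.cast_pow, Nat.cast_mul] at h4
    have h5 := mul_le_mul_of_nonneg_left hlog hT.le
    have h6 := mul_le_mul_of_nonneg_left h5
      (by positivity : (0 : ℝ) ≤ (((σ.maxArity + 1 : ℕ) : ℝ) ^ (σ.maxArity + 1)) ^ 3)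
    norm_num at h4 h6 ⊢
    linarith
  constructor
  · have hL : (E.input.length : ℝ) ≤ (1 + σ.card * (σ.maxArity + 2)) * A.size := by
      exact_mod_cast E.length_input_le
    have hL' : (1 + (σ.card : ℝ) * (σ.maxArity + 2)) * A.size ≤
        (1 + σ.card * (σ.maxArity + 2)) * (A.size * Real.logb 2 (A.size + 1)) := by
      refine mul_le_mul_of_nonneg_left ?_ (by positivity)
      nlinarith
    push_cast at ht ⊢
    linarith
  · refine ht.trans (add_le_add (by push_cast; exact le_rfl) ?_)
    exact mul_le_mul_of_nonneg_right (RCR.pow_arity_le hk) (by positivity)
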